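/- **Setting.** Let $G$ be a finite graph with vertex set $W$ that has a hamiltonian cycle. Let $X$ be the (finite) set of hamiltonian cycles of $G$ with the uniform probability measure $\mu$, let $\phi$ send a cycle to its adjacency matrix, let $V$ be the linear span of $\phi(X)$, let $g:V\to\mathbb R$ be $\frac1{2|W|}$ times the sum of the entries, and $\overline x=\int_X\phi\,d\mu$. Let $C=\mathrm{Cone}(\phi(X))$ be the traveling salesman cone and $C^*\subseteq V^*$ its dual. For a vector space $\mathcal F$ of real functions on $X$ let $C^*(\mathcal F)$ be the cone of $\lambda\in V^*$ with $\int_X\lambda(\phi(u))\,p(u)^2\,d\mu(u)\ge 0$ for all $p\in\mathcal F$, and let $C(\mathcal F)=\{v\in V:\lambda(v)\ge0\ \forall\lambda\in C^*(\mathcal F)\}$. Put $B=C\cap\{g=1\}$, $B(\mathcal F)=C(\mathcal F)\cap\{g=1\}$, $B^\vee=\{\lambda\in C^*:\lambda(\overline x)=1\}$ and $B^\vee(\mathcal F)=\{\lambda\in C^*(\mathcal F):\lambda(\overline x)=1\}$. The scaling constant $\alpha(\mathcal F)\in[1,\infty]$ is the infimum of the reals $a\ge1$ such that $$\tfrac1a\left(B^\vee(\mathcal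 F)-g\right)\subseteq B^\vee-g\quad\text{and}\quad B-\overline x\subseteq a\left(B(\mathcal F)-\overline x\right)$$ ($\infty$ if there are none). Let $\mathcal F_k$ be the space of restrictions to $X$, via $\phi$, of the homogeneous polynomials of degree $k$ in the matrix entries. We write $a\wedge b=\min(a,b)$, and binomial coefficients $\binom{m}{j}$ with $j<0$ or $0\le m<j$ are $0$ (a term that contains such a factor is $0$). **Theorem.** (1) Let $G=K_n$ with $n\ge3$, and let $1\le k\le\lfloor n/2\rfloor$. Then $\sum_{i=k}^{\lfloor n/2\rfloor\wedge 2k}\binom ik(\alpha_i-\beta_i)>0$ and $$\alpha(\mathcal F_k)\le 1+\frac{n-1}{2}\cdot\frac{\sum_{i=k}^{\lfloor n/2\rfloor\wedge 2k}\binom ik\beta_i}{\sum_{i=k}^{\lfloor n/2\rfloor\wedge 2k}\binom ik(\alpha_i-\beta_i)}\le\frac nk+\frac{10}n,$$ where for $n=2r$ $$\alpha_k=2^{k-2}\left(4(k+2)r^2-2(k(k+7)+4)r+3k(k+3)\right)\frac{(r-2)!\,(2r-k-2)!}{k!\,(r-k)!},$$ $$\beta_k=2^{k-1}\left(\binom{r-2}{k-2}+4\binom{r-1}{k}\right)(2r-k-2)!,$$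 and for $n=2r+1$ $$\alpha_k=2^{k-2}\left(4(k+2)r^2-2k(k+4)r+(k-1)k+4r\right)\frac{(r-1)!\,(2r-k-1)!}{k!\,(r-k)!},$$ $$\beta_k=2^{k-2}\left(k^2(2r-1)-8kr^2+6kr+k+4(r-1)r(2r+1)\right)\frac{(r-2)!\,(2r-k-1)!}{k!\,(r-k)!}$$ (for $n=3$, where the polynomial factor of $\beta_1$ vanishes, $\beta_1=0$). (2) Let $G=K_{n,n}$ with $n\ge3$, and let $1\le k\le n$. Then $\sum_{i=k}^{n\wedge2k}\binom ik(\gamma_i-\eta_i)>0$ and $$\alpha(\mathcal F_k)\le 1+\frac n2\cdot\frac{\sum_{i=k}^{n\wedge2k}\binom ik\eta_i}{\sum_{i=k}^{n\wedge2k}\binom ik(\gamma_i-\eta_i)},$$ and, if $2n-k-3>0$ (that is, $(n,k)\ne(3,3)$), the right-hand side is at most $$\frac{2n}k+\frac{2(k+1)}{k(2n-k-3)},$$ where $$\gamma_k=\binom{n-1}{k-1}\frac{(2n-k-1)!}{\binom{2n-2k}{n-k}}+\left(\binom{n-1}{k}+\binom{n-2}{k}\right)\frac{(2n-k-2)!}{\binom{2(n-k-1)}{n-k-1}}+\left(4\binom{n-2}{k-1}+\binom{n-2}{k-2}\right)\frac{(2n-k-2)!}{\binom{2n-2k}{n-k}},$$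 $$\eta_k=2\left(\binom{n-2}{k}\frac{(2n-k-2)!}{\binom{2(n-k-1)}{n-k-1}}+\left(4\binom{n-2}{k-1}+\binom{n-2}{k-2}\right)\frac{(2n-k-2)!}{\binom{2n-2k}{n-k}}\right).$$ -/

import Mathlib

noncomputable section

/-! ### Approximations of cones over finite sets with the uniform probability measure -/

section BVL

open scoped Pointwise

variable {X V : Type*} [Fintype X] [AddCommGroup V] [Module ℝ V]

/-- The integral of `f` with respect to the uniform probability measure on the finite set `X`. -/
def unifIntegral {E : Type*} [AddCommGroup E] [Module ℝ E] (f : X → E) : E :=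
  (Fintype.card X : ℝ)⁻¹ • ∑ u, f u

/-- The distinguished point `x̄ = ∫ φ dμ`. -/
def barycenter (φ : X → V) : V := unifIntegral φ

/-- The convex cone `C` generated by `φ(X)`. -/
def genCone (φ : X → V) : Set V := (PointedCone.hull ℝ (Set.range φ) : Set V)

/-- The dual cone `D^*` of a cone `D ⊆ V`. -/
def dualCone (D : Set V) : Set (Module.Dual ℝ V) := {l | ∀ d ∈ D, 0 ≤ l d}

/-- The bilinear form `Q_l(p,q) = ∫ l(φ(u)) p(u) q(u) dμ(u)`. -/
def bvlForm (φ : X → V) (l : Module.Dual ℝ V) (p q : X → ℝ) : ℝ :=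
  unifIntegral fun u => l (φ u) * p u * q u

/-- The spectrahedral cone `C^*(F)`: the linear forms `l` such that `Q_l` is positive semidefinite
on the space of functions `F`. -/
def bvlDualCone (φ : X → V) (F : Submodule ℝ (X → ℝ)) : Set (Module.Dual ℝ V) :=
  {l | ∀ p ∈ F, 0 ≤ bvlForm φ l p p}

/-- The cone `C(F) ⊆ V` dual to `C^*(F)`. -/
def bvlCone (φ : X → V) (F : Submodule ℝ (X → ℝ)) : Set V :=
  {v | ∀ l ∈ bvlDualCone φ F, 0 ≤ l v}

/-- `B = C ∩ {g = 1}`. -/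
def coneBase (φ : X → V) (g : Module.Dual ℝ V) : Set V := genCone φ ∩ {v | g v = 1}

/-- `B(F) = C(F) ∩ {g = 1}`. -/
def bvlBase (φ : X → V) (g : Module.Dual ℝ V) (F : Submodule ℝ (X → ℝ)) : Set V :=
  bvlCone φ F ∩ {v | g v = 1}

/-- `B^∨ = C^* ∩ {l | l(x̄) = 1}`. -/
def dualBase (φ : X → V) : Set (Module.Dual ℝ V) :=
  dualCone (genCone φ) ∩ {l | l (barycenter φ) = 1}

/-- `B^∨(F) = C^*(F) ∩ {l | l(x̄) = 1}`. -/
def bvlDualBase (φ : X → V) (F : Submodule ℝ (X → ℝ)) : Set (Module.Dual ℝ V) :=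
  bvlDualCone φ F ∩ {l | l (barycenter φ) = 1}

/-- The scaling constant `α(F)`: the infimum of the factors `a` such that
`a⁻¹ (B^∨(F) - g) ⊆ B^∨ - g` and `B - x̄ ⊆ a (B(F) - x̄)`, and `∞` if there are none.
A scaling factor is by convention at least `1`; this discards the negative factors, and gives
`α(F) = 1` when the bases are single points. -/
def scalingConstant (φ : X → V) (g : Module.Dual ℝ V) (F : Submodule ℝ (X → ℝ)) : EReal :=
  sInf ((fun a : ℝ => (a : EReal)) '' {a : ℝ | 1 ≤ a ∧
    a⁻¹ • (bvlDualBase φ F - {g}) ⊆ dualBase φ - {g} ∧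
    coneBase φ g - {barycenter φ} ⊆ a • (bvlBase φ g F - {barycenter φ})})

end BVL

/-! ### Traveling salesman cones -/

section TSP

variable {W : Type*} [Fintype W]

/-- The hamiltonian cycles of `G`, as subgraphs of `G`: the spanning subgraphs that are isomorphic
to the cycle on as many vertices as `G` (at least three). -/
def HamCycle (G : SimpleGraph W) : Type _ :=
  {H : SimpleGraph W // H ≤ G ∧ 3 ≤ Fintype.card W ∧
    Nonempty (SimpleGraph.cycleGraph (Fintype.card W) ≃g H)}

instance (G : SimpleGraph W) : Finite (HamCycle G) :=
  Subtype.finite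

instance (G : SimpleGraph W) : Fintype (HamCycle G) := Fintype.ofFinite _

open Classical in
/-- The adjacency matrix of a hamiltonian cycle. -/
def cycleMatrix (G : SimpleGraph W) (u : HamCycle G) : Matrix W W ℝ := u.1.adjMatrix ℝ

/-- The span `V` of the adjacency matrices of the hamiltonian cycles of `G`. -/
def tspSpace (G : SimpleGraph W) : Submodule ℝ (Matrix W W ℝ) :=
  Submodule.span ℝ (Set.range (cycleMatrix G))

/-- The map `φ`, which sends a hamiltonian cycle to its adjacency matrix, as a map into `V`. -/
def tspMap (G : SimpleGraph W) (u : HamCycle G) : tspSpace G :=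
  ⟨cycleMatrix G u, Submodule.subset_span ⟨u, rfl⟩⟩

/-- The linear function `g` on `V`: the sum of the entries divided by `2 |W|`, where `|W|` is the
number of vertices. -/
def tspForm (G : SimpleGraph W) : Module.Dual ℝ (tspSpace G) :=
  (2 * (Fintype.card W : ℝ))⁻¹ •
    (∑ i, ∑ j, Matrix.entryLinearMap ℝ ℝ i j).comp (tspSpace G).subtype

/-- The restrictions via `φ` of the homogeneous polynomials of degree `k` in the matrix entries. -/
def tspPoly (G : SimpleGraph W) (k : ℕ) : Submodule ℝ (HamCycle G → ℝ) :=
  (MvPolynomial.homogeneousSubmodule (W × W) ℝ k).map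
    (LinearMap.pi fun u =>
      (MvPolynomial.aeval fun e : W × W => cycleMatrix G u e.1 e.2).toLinearMap)

/-- The scaling constant `α(F_k)` of the traveling salesman cone of `G`. -/
def tspScaling (G : SimpleGraph W) (k : ℕ) : EReal :=
  scalingConstant (tspMap G) (tspForm G) (tspPoly G k)

end TSP

/-! ### The explicit constants -/

section Constants

open scoped Nat

/-- The binomial coefficient `m choose (k - 2)`, which is `0` for `k < 2`. -/
def chooseSubTwo (m k : ℕ) : ℕ := if 2 ≤ k then m.choose (k - 2) else 0

/-- The constants `α_k` for the complete graph on `n` vertices. -/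
def veomettAlpha (n k : ℕ) : ℝ :=
  let r : ℕ := n / 2
  if Even n then
    (2 : ℝ) ^ ((k : ℤ) - 2) *
      (4 * (k + 2) * (r : ℝ) ^ 2 - 2 * (k * (k + 7) + 4) * r + 3 * k * (k + 3)) *
      (((r - 2)! * (2 * r - k - 2)! : ℕ) : ℝ) / ((k ! * (r - k)! : ℕ) : ℝ)
  else
    (2 : ℝ) ^ ((k : ℤ) - 2) *
      (4 * (k + 2) * (r : ℝ) ^ 2 - 2 * k * (k + 4) * r + (k - 1) * k + 4 * r) *
      (((r - 1)! * (2 * r - k - 1)! : ℕ) : ℝ) / ((k ! * (r - k)! : ℕ) : ℝ)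

/-- The constants `β_k` for the complete graph on `n` vertices. (For `n = 3`, `k = 1` the
polynomial factor vanishes, so that `β_1 = 0`.) -/
def veomettBeta (n k : ℕ) : ℝ :=
  let r : ℕ := n / 2
  if Even n then
    (2 : ℝ) ^ ((k : ℤ) - 1) *
      ((chooseSubTwo (r - 2) k : ℝ) + 4 * ((r - 1).choose k : ℝ)) * ((2 * r - k - 2)! : ℝ)
  else
    (2 : ℝ) ^ ((k : ℤ) - 2) *
      ((k : ℝ) ^ 2 * (2 * r - 1) - 8 * k * (r : ℝ) ^ 2 + 6 * k * r + k
        + 4 * (r - 1) * r * (2 * r + 1)) *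
      (((r - 2)! * (2 * r - k - 1)! : ℕ) : ℝ) / ((k ! * (r - k)! : ℕ) : ℝ)

/-- The constants `γ_k` for the complete bipartite graph `K_{n,n}`. -/
def bipGamma (n k : ℕ) : ℝ :=
  ((n - 1).choose (k - 1) : ℝ) * ((2 * n - k - 1)! : ℝ) *
      ((2 * n - 2 * k).choose (n - k) : ℝ)⁻¹
    + ((n - 1).choose k : ℝ) * ((2 * n - k - 2)! : ℝ) *
      ((2 * (n - k - 1)).choose (n - k - 1) : ℝ)⁻¹
    + ((n - 2).choose k : ℝ) * ((2 * n - k - 2)! : ℝ) *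
      ((2 * (n - k - 1)).choose (n - k - 1) : ℝ)⁻¹
    + 2 ^ 2 * ((n - 2).choose (k - 1) : ℝ) * ((2 * n - k - 2)! : ℝ) *
      ((2 * n - 2 * k).choose (n - k) : ℝ)⁻¹
    + (chooseSubTwo (n - 2) k : ℝ) * ((2 * n - k - 2)! : ℝ) *
      ((2 * n - 2 * k).choose (n - k) : ℝ)⁻¹

/-- The constants `η_k` for the complete bipartite graph `K_{n,n}`. -/
def bipEta (n k : ℕ) : ℝ :=
  2 * (((n - 2).choose k : ℝ) * ((2 * n - k - 2)! : ℝ) *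
      ((2 * (n - k - 1)).choose (n - k - 1) : ℝ)⁻¹
    + 2 ^ 2 * ((n - 2).choose (k - 1) : ℝ) * ((2 * n - k - 2)! : ℝ) *
      ((2 * n - 2 * k).choose (n - k) : ℝ)⁻¹
    + (chooseSubTwo (n - 2) k : ℝ) * ((2 * n - k - 2)! : ℝ) *
      ((2 * n - 2 * k).choose (n - k) : ℝ)⁻¹)

/-- The numerator `∑ (i choose k) β_i` over `k ≤ i ≤ min(⌊n/2⌋, 2k)`. -/
def knNum (n k : ℕ) : ℝ :=
  ∑ i ∈ Finset.Icc k (min (n / 2) (2 * k)), (i.choose k : ℝ) * veomettBeta n i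

/-- The denominator `∑ (i choose k) (α_i - β_i)` over `k ≤ i ≤ min(⌊n/2⌋, 2k)`. -/
def knDen (n k : ℕ) : ℝ :=
  ∑ i ∈ Finset.Icc k (min (n / 2) (2 * k)),
    (i.choose k : ℝ) * (veomettAlpha n i - veomettBeta n i)

/-- The numerator `∑ (i choose k) η_i` over `k ≤ i ≤ min(n, 2k)`. -/
def knnNum (n k : ℕ) : ℝ :=
  ∑ i ∈ Finset.Icc k (min n (2 * k)), (i.choose k : ℝ) * bipEta n i

/-- The denominator `∑ (i choose k) (γ_i - η_i)` over `k ≤ i ≤ min(n, 2k)`. -/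
def knnDen (n k : ℕ) : ℝ :=
  ∑ i ∈ Finset.Icc k (min n (2 * k)), (i.choose k : ℝ) * (bipGamma n i - bipEta n i)

end Constants

end

/-! A form `l` lies in `C^*(F_k)` exactly when it is nonnegative on every matrix `∫ p² φ dμ` with `p
∈ F_k`. To prove `α(F_k) ≤ a` it therefore suffices to write, for each hamiltonian cycle `u`, a
positive multiple of `φ(u) + (a - 1) x̄` as a sum of such matrices (`scalingConstant_le`,
`tspScaling_le`).

The squares come from matchings. Every second edge of `u` forms a perfect matching, or one that
misses a single vertex; consider all its rotations along `u`. For one of them let `t` count the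
matching edges on a variable hamiltonian cycle, and let `Q(t) = ∏ (t - c_j)²` with `k` factors, the
square of an element of `F_k`. The matrix `∫ Q(t) φ dμ` is invariant under the automorphisms of `G`
that preserve the matching. Hence it is constant on the matching, on the edges at the missed vertex,
and on the other edges. Row sums and the sum over the matching express these constants by `E = ∫
Q(t)` and `E₁ = ∫ t Q(t)`. Each edge of `u` lies in equally many rotations, so the sum over the
rotations has entries `A φ(u) + B` on the edges of `G`. The outcome is a bound `κ E / (E₁ - λ E)`,
where `κ` and `λ` depend only on the graph: `λ = n/(n-1)` for `K_n` with `n` even, `1` for `n` odd,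
`2` for `K_{n,n}`. The bound improves as `E₁ / E` grows.

The law of `t` is accessible through its binomial moments `μ_l = ∫ (t choose l)`. Listing a cycle as
a cyclic arrangement of the vertices, `(t choose l)` counts `l`-sets of pairwise nonconsecutive
positions at which matching edges are used; a swap of two vertices shows that all such sets are
equally likely and gives the probability. So `(l + 1) μ_{l+1} = ρ_l μ_l` with explicit rational
`ρ_l`, and `∫ t (t choose l) = μ_l (l + ρ_l)`.

For `c_j = j` the polynomial `Q` is `k!² (t choose k)²`, which expands with weights `(k choose i-k)
(i choose k)` at `(t choose i)`. The closed forms of `α_i, β_i, γ_i, η_i` show that the bound of the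
theorem is the same expression with the weights `(i choose k)` alone. What remains is to see that
the extra symmetric unimodal weights `(k choose i-k)` do not lower the average of `i + ρ_i`. This is
a reflected Chebyshev argument (`sum_choose_mul_le`, `binomMoment_comparison`), which uses that `i +
ρ_i` is increasing and essentially concave and that `μ_i` decays factorially. It covers `K_n`
throughout, and `K_{n,n}` except for `k = 2, 3` with `n` not too small; there the roots `0, 2` and
`0, 1, 3` are used and the inequality is checked explicitly. The final estimates hold term by term
in `i`. -/

/-! ### Bounding the scaling constant by a condition on the generators. -/

/-- If every `l ∈ C^*(F)` satisfies `l(φ(u)) + (a - 1) l(x̄) ≥ 0` on `X`, then `α(F) ≤ a`. -/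
theorem scalingConstant_le {X V : Type*} [Fintype X] [AddCommGroup V] [Module ℝ V]
    (φ : X → V) (g : Module.Dual ℝ V) (F : Submodule ℝ (X → ℝ)) (hg : ∀ u, g (φ u) = 1)
    {a : ℝ} (ha : 1 ≤ a)
    (h : ∀ l ∈ bvlDualCone φ F, ∀ u, 0 ≤ l (φ u) + (a - 1) * l (barycenter φ)) :
    scalingConstant φ g F ≤ (a : EReal) := by
  have ha0 : (0 : ℝ) < a := by linarith
  have nonneg_on : ∀ l : Module.Dual ℝ V, (∀ u, 0 ≤ l (φ u)) → l ∈ dualCone (genCone φ) := by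
    intro l hl d hd
    have hd' : d ∈ Submodule.span {c : ℝ // 0 ≤ c} (Set.range φ) := hd
    induction hd' using Submodule.span_induction with
    | mem x hx => obtain ⟨u, rfl⟩ := hx; exact hl u
    | zero => simp
    | add x y hx hy h1 h2 => rw [map_add]; exact add_nonneg (h1 hx) (h2 hy)
    | smul c x hx h1 =>
      have : l (c • x) = (c : ℝ) * l x := by
        rw [← smul_eq_mul, ← map_smul]; rfl
      rw [this]
      exact mul_nonneg c.2 (h1 hx)
  rcases isEmpty_or_nonempty X with hX | hX
  -- For empty `X` the factor `(card X)⁻¹` is `0`, so `x̄ = 0` and both `B^∨(F)` and `B` are empty;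
  -- the inclusions are vacuous.
  · have hb : barycenter φ = 0 := by simp [barycenter, unifIntegral]
    have hr : Set.range φ = ∅ := Set.range_eq_empty φ
    refine sInf_le ⟨a, ⟨ha, ?_, ?_⟩, rfl⟩
    · rintro _ ⟨_, ⟨l, ⟨-, hl⟩, _, _, _⟩, _⟩
      simp [hb] at hl
    · rintro _ ⟨v, ⟨hv, hv1⟩, _, _, _⟩
      exfalso
      simp only [genCone, hr, PointedCone.hull] at hv
      have : v = 0 := by simpa using hv
      simp [this] at hv1
  have hgb : g (barycenter φ) = 1 := by
    simp [barycenter, unifIntegral, hg]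
  refine sInf_le ⟨a, ⟨ha, ?_, ?_⟩, rfl⟩
  · rintro _ ⟨_, ⟨l, ⟨hl, hl1⟩, g', (hg' : g' = g), rfl⟩, rfl⟩
    simp only [hg']
    -- The form obtained by contracting `l` towards `g`; its value at `φ(u)` is `(l(φ(u)) + (a - 1)
    -- l(x̄)) / a`, since `l(x̄) = 1`.
    refine ⟨g + a⁻¹ • (l - g), ⟨nonneg_on _ fun u => ?_, ?_⟩, g, rfl, by simp⟩
    · have h1 := h l hl u
      have h2 : l (barycenter φ) = 1 := hl1
      rw [h2] at h1
      have : (g + a⁻¹ • (l - g)) (φ u) = a⁻¹ * (l (φ u) + (a - 1) * 1) := by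
        simp [hg]; field_simp; ring
      rw [this]; positivity
    · have h2 : l (barycenter φ) = 1 := hl1
      simp [hgb, h2]
  · rintro _ ⟨v, ⟨hv, hv1⟩, b, (hb : b = barycenter φ), rfl⟩
    simp only [hb]
    refine ⟨a⁻¹ • (v - barycenter φ), ⟨barycenter φ + a⁻¹ • (v - barycenter φ), ⟨?_, ?_⟩,
      barycenter φ, rfl, by simp⟩, by simp [smul_smul, ha0.ne']⟩
    · intro l hl
      -- The dual computation: on `{g = 1}` the contracted point `x̄ + (v - x̄)/a` sees `l` as `1/a`
      -- times this form, evaluated at `v`.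
      have h1 : l + ((a - 1) * l (barycenter φ)) • g ∈ dualCone (genCone φ) :=
        nonneg_on _ fun u => by simpa [hg] using h l hl u
      have h2 := h1 v hv
      have h3 : g v = 1 := hv1
      simp only [LinearMap.add_apply, LinearMap.smul_apply, h3, smul_eq_mul, mul_one] at h2
      have : l (barycenter φ + a⁻¹ • (v - barycenter φ))
          = a⁻¹ * (l v + (a - 1) * l (barycenter φ)) := by
        simp; field_simp; ring
      rw [this]; positivity
    · have h3 : g v = 1 := hv1
      simp [hgb, h3]

/-! ### Hamiltonian cycles, degree `k` functions on them, and averages under automorphisms. -/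

noncomputable section

section HamiltonianCycles

variable {W : Type*} [Fintype W]

/-- The underlying graph of a hamiltonian cycle. -/
def HamCycle.graph {G : SimpleGraph W} (u : HamCycle G) : SimpleGraph W := u.1

theorem HamCycle.graph_le {G : SimpleGraph W} (u : HamCycle G) : u.graph ≤ G := u.2.1

theorem HamCycle.three_le_card {G : SimpleGraph W} (u : HamCycle G) : 3 ≤ Fintype.card W := u.2.2.1

theorem HamCycle.exists_iso {G : SimpleGraph W} (u : HamCycle G) {N : ℕ}
    (hN : Fintype.card W = N) : Nonempty (SimpleGraph.cycleGraph N ≃g u.graph) := by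
  subst hN; exact u.2.2.2

theorem HamCycle.ext {G : SimpleGraph W} {u v : HamCycle G} (h : u.graph = v.graph) : u = v :=
  Subtype.ext h

open Classical in
theorem cycleMatrix_apply (G : SimpleGraph W) (u : HamCycle G) (x y : W) :
    cycleMatrix G u x y = if u.graph.Adj x y then 1 else 0 := by
  rw [cycleMatrix, SimpleGraph.adjMatrix_apply]; rfl

theorem cycleMatrix_comm (G : SimpleGraph W) (u : HamCycle G) (x y : W) :
    cycleMatrix G u x y = cycleMatrix G u y x := by
  classical
  rw [cycleMatrix_apply, cycleMatrix_apply]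
  exact if_congr (u.graph.adj_comm x y) rfl rfl

theorem cycleMatrix_self (G : SimpleGraph W) (u : HamCycle G) (x : W) :
    cycleMatrix G u x x = 0 := by
  simp [cycleMatrix_apply]

theorem cycleMatrix_eq_zero (G : SimpleGraph W) (u : HamCycle G) {x y : W} (h : ¬ G.Adj x y) :
    cycleMatrix G u x y = 0 := by
  rw [cycleMatrix_apply, if_neg fun h' => h (u.graph_le h')]

theorem sum_cycleMatrix (G : SimpleGraph W) (u : HamCycle G) (x : W) :
    ∑ y, cycleMatrix G u x y = 2 := by
  classical
  obtain ⟨m, hm⟩ := Nat.exists_eq_add_of_le' u.three_le_card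
  obtain ⟨e⟩ := u.exists_iso hm
  have h1 : u.graph.degree x = 2 := by
    have := e.degree_eq (e.symm x)
    rw [RelIso.apply_symm_apply] at this
    rw [this, SimpleGraph.cycleGraph_degree_three_le]
  simp only [cycleMatrix_apply]
  rw [Finset.sum_boole]
  have : (Finset.univ.filter fun y => u.graph.Adj x y) = u.graph.neighborFinset x := by
    ext y; simp
  rw [this, SimpleGraph.card_neighborFinset_eq_degree, h1]; norm_num

theorem card_pos_of_hamCycle {G : SimpleGraph W} (u : HamCycle G) : 0 < Fintype.card W := by
  have := u.three_le_card; omega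

theorem tspForm_tspMap (G : SimpleGraph W) (u : HamCycle G) : tspForm G (tspMap G u) = 1 := by
  have h : (0 : ℝ) < Fintype.card W := by exact_mod_cast card_pos_of_hamCycle u
  have : tspForm G (tspMap G u)
      = (2 * (Fintype.card W : ℝ))⁻¹ * ∑ i, ∑ j, cycleMatrix G u i j := by
    simp [tspForm, tspMap]
  rw [this]
  simp only [sum_cycleMatrix]
  simp
  field_simp

/-! ### Polynomials in the entries -/

theorem mem_tspPoly {G : SimpleGraph W} {k : ℕ} {f : HamCycle G → ℝ} :
    f ∈ tspPoly G k ↔ ∃ P : MvPolynomial (W × W) ℝ, P.IsHomogeneous k ∧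
      ∀ u, MvPolynomial.aeval (fun e : W × W => cycleMatrix G u e.1 e.2) P = f u := by
  simp only [tspPoly, Submodule.mem_map, MvPolynomial.mem_homogeneousSubmodule]
  refine exists_congr fun P => and_congr_right fun _ => ?_
  rw [funext_iff]; rfl

theorem one_mem_tspPoly_zero (G : SimpleGraph W) : (fun _ => 1) ∈ tspPoly G 0 :=
  mem_tspPoly.2 ⟨1, MvPolynomial.isHomogeneous_one _ _, fun u => by simp⟩

theorem mul_mem_tspPoly {G : SimpleGraph W} {k l : ℕ} {f g : HamCycle G → ℝ}
    (hf : f ∈ tspPoly G k) (hg : g ∈ tspPoly G l) : (fun u => f u * g u) ∈ tspPoly G (k + l) := by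
  obtain ⟨P, hP, hP'⟩ := mem_tspPoly.1 hf
  obtain ⟨Q, hQ, hQ'⟩ := mem_tspPoly.1 hg
  exact mem_tspPoly.2 ⟨P * Q, hP.mul hQ, fun u => by rw [map_mul, hP', hQ']⟩

theorem entry_mem_tspPoly (G : SimpleGraph W) (x y : W) :
    (fun u => cycleMatrix G u x y) ∈ tspPoly G 1 :=
  mem_tspPoly.2 ⟨MvPolynomial.X (x, y), MvPolynomial.isHomogeneous_X _ _, fun u => by simp⟩

/-- Half of a row sum is a linear form equal to `1` on every cycle. Thus inhomogeneous factors such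
as `t - c` still have degree one. -/
theorem one_mem_tspPoly_one (G : SimpleGraph W) : (fun _ => 1) ∈ tspPoly G 1 := by
  rcases isEmpty_or_nonempty W with h | ⟨⟨x⟩⟩
  · convert Submodule.zero_mem (tspPoly G 1)
    rename_i u
    exact absurd (card_pos_of_hamCycle u) (by simp)
  have h : (1 / 2 : ℝ) • ∑ y, (fun u => cycleMatrix G u x y) ∈ tspPoly G 1 :=
    Submodule.smul_mem _ _ (Submodule.sum_mem _ fun y _ => entry_mem_tspPoly G x y)
  convert h using 1
  ext u
  simp [sum_cycleMatrix]

/-- The number of edges `{x, i x}` that lie on a hamiltonian cycle, for an involution `i`. -/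
def matchCount (G : SimpleGraph W) (i : W → W) (u : HamCycle G) : ℝ :=
  (1 / 2) * ∑ x, cycleMatrix G u x (i x)

theorem matchCount_mem_tspPoly (G : SimpleGraph W) (i : W → W) :
    matchCount G i ∈ tspPoly G 1 := by
  have h : (1 / 2 : ℝ) • ∑ x, (fun u => cycleMatrix G u x (i x)) ∈ tspPoly G 1 :=
    Submodule.smul_mem _ _ (Submodule.sum_mem _ fun x _ => entry_mem_tspPoly G x (i x))
  convert h using 1
  ext u
  simp [matchCount]

theorem prod_mem_tspPoly (G : SimpleGraph W) (i : W → W) (c : ℕ → ℝ) (k : ℕ) :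
    (fun u => ∏ j ∈ Finset.range k, (matchCount G i u - c j)) ∈ tspPoly G k := by
  induction k with
  | zero => simpa using one_mem_tspPoly_zero G
  | succ k ih =>
    simp only [Finset.prod_range_succ]
    refine mul_mem_tspPoly ih ?_
    have := Submodule.sub_mem _ (matchCount_mem_tspPoly G i)
      (Submodule.smul_mem _ (c k) (one_mem_tspPoly_one G))
    convert this using 1
    ext u; simp

/-! ### Averages and automorphisms -/

/-- The image of a hamiltonian cycle of `G` under the inverse of an automorphism of `G`. -/
def HamCycle.comap {G : SimpleGraph W} (u : HamCycle G) (τ : Equiv.Perm W)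
    (hτ : ∀ x y, G.Adj (τ x) (τ y) ↔ G.Adj x y) : HamCycle G :=
  ⟨u.1.comap τ, fun x y h => (hτ x y).1 (u.2.1 h), u.2.2.1,
    u.2.2.2.map fun e => e.trans (SimpleGraph.Iso.comap τ u.1).symm⟩

theorem HamCycle.graph_comap {G : SimpleGraph W} (u : HamCycle G) (τ : Equiv.Perm W)
    (hτ : ∀ x y, G.Adj (τ x) (τ y) ↔ G.Adj x y) : (u.comap τ hτ).graph = u.graph.comap τ := rfl

theorem cycleMatrix_comap {G : SimpleGraph W} (u : HamCycle G) (τ : Equiv.Perm W)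
    (hτ : ∀ x y, G.Adj (τ x) (τ y) ↔ G.Adj x y) (x y : W) :
    cycleMatrix G (u.comap τ hτ) x y = cycleMatrix G u (τ x) (τ y) := by
  simp only [cycleMatrix_apply]; rfl

theorem unifIntegral_comap {G : SimpleGraph W} (τ : Equiv.Perm W)
    (hτ : ∀ x y, G.Adj (τ x) (τ y) ↔ G.Adj x y) (f : HamCycle G → ℝ) :
    unifIntegral (fun u : HamCycle G => f (u.comap τ hτ)) = unifIntegral f := by
  have hτ' : ∀ x y, G.Adj (τ.symm x) (τ.symm y) ↔ G.Adj x y := fun x y => by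
    rw [← hτ]; simp
  let e : HamCycle G ≃ HamCycle G :=
    { toFun := fun u => u.comap τ hτ
      invFun := fun u => u.comap τ.symm hτ'
      left_inv := fun u => by
        apply HamCycle.ext; ext x y; simp [HamCycle.graph_comap]
      right_inv := fun u => by
        apply HamCycle.ext; ext x y; simp [HamCycle.graph_comap] }
  unfold unifIntegral
  rw [← e.sum_comp f]; rfl

theorem matchCount_comap {G : SimpleGraph W} (u : HamCycle G) (τ : Equiv.Perm W)
    (hτ : ∀ x y, G.Adj (τ x) (τ y) ↔ G.Adj x y) (i : W → W) (hi : ∀ x, τ (i x) = i (τ x)) :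
    matchCount G i (u.comap τ hτ) = matchCount G i u := by
  unfold matchCount
  simp only [cycleMatrix_comap, hi]
  rw [Equiv.sum_comp τ fun x => cycleMatrix G u x (i x)]

theorem unifIntegral_add {X : Type*} [Fintype X] (f g : X → ℝ) :
    unifIntegral (fun u => f u + g u) = unifIntegral f + unifIntegral g := by
  simp [unifIntegral, Finset.sum_add_distrib, mul_add]

theorem unifIntegral_sum {X ι : Type*} [Fintype X] (s : Finset ι) (f : ι → X → ℝ) :
    unifIntegral (fun u => ∑ i ∈ s, f i u) = ∑ i ∈ s, unifIntegral (f i) := by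
  simp only [unifIntegral, smul_eq_mul]
  rw [Finset.sum_comm, Finset.mul_sum]

theorem unifIntegral_mul_left {X : Type*} [Fintype X] (c : ℝ) (f : X → ℝ) :
    unifIntegral (fun u => c * f u) = c * unifIntegral f := by
  simp only [unifIntegral, smul_eq_mul]
  rw [← Finset.mul_sum]; ring

/-- The average of `Q(t(u)) φ(u)_{xy}`, where `t` counts the edges `{x, i x}`. -/
def entryMoment (G : SimpleGraph W) (i : W → W) (Q : ℝ → ℝ) (x y : W) : ℝ :=
  unifIntegral fun u => Q (matchCount G i u) * cycleMatrix G u x y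

/-- The average of `Q(t(u))`. -/
def matchMoment (G : SimpleGraph W) (i : W → W) (Q : ℝ → ℝ) : ℝ :=
  unifIntegral fun u => Q (matchCount G i u)

theorem entryMoment_comm (G : SimpleGraph W) (i : W → W) (Q : ℝ → ℝ) (x y : W) :
    entryMoment G i Q x y = entryMoment G i Q y x := by
  simp only [entryMoment, cycleMatrix_comm G _ x y]

theorem entryMoment_eq_zero (G : SimpleGraph W) (i : W → W) (Q : ℝ → ℝ) {x y : W}
    (h : ¬ G.Adj x y) : entryMoment G i Q x y = 0 := by
  simp [entryMoment, cycleMatrix_eq_zero G _ h, unifIntegral]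

/-- An automorphism that commutes with `i` preserves the count `t` and permutes the hamiltonian
cycles, so it preserves the averaged matrix. All its symmetry is drawn from here. -/
theorem entryMoment_map {G : SimpleGraph W} (i : W → W) (Q : ℝ → ℝ) (τ : Equiv.Perm W)
    (hτ : ∀ x y, G.Adj (τ x) (τ y) ↔ G.Adj x y) (hi : ∀ x, τ (i x) = i (τ x)) (x y : W) :
    entryMoment G i Q (τ x) (τ y) = entryMoment G i Q x y := by
  unfold entryMoment
  rw [← unifIntegral_comap τ hτ fun u => Q (matchCount G i u) * cycleMatrix G u x y]
  simp only [matchCount_comap _ τ hτ i hi, cycleMatrix_comap]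

theorem sum_entryMoment (G : SimpleGraph W) (i : W → W) (Q : ℝ → ℝ) (x : W) :
    ∑ y, entryMoment G i Q x y = 2 * matchMoment G i Q := by
  unfold entryMoment matchMoment
  rw [← unifIntegral_sum, ← unifIntegral_mul_left]
  congr 1; ext u
  rw [← Finset.mul_sum, sum_cycleMatrix, mul_comm]

/-- Summing over vertices counts each matched edge from both of its ends. -/
theorem sum_entryMoment_match (G : SimpleGraph W) (i : W → W) (Q : ℝ → ℝ) :
    ∑ x, entryMoment G i Q x (i x) = 2 * matchMoment G i fun t => t * Q t := by
  unfold entryMoment matchMoment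
  rw [← unifIntegral_sum, ← unifIntegral_mul_left]
  congr 1; ext u
  rw [← Finset.mul_sum, matchCount]; ring

end HamiltonianCycles

end

/-! ### Certificates, and the averaged matrix of a symmetric matching. -/

noncomputable section

section Certificates

variable {W : Type*} [Fintype W]

/-- A certificate of nonnegativity bounds the scaling constant. -/
theorem tspScaling_le {G : SimpleGraph W} {k : ℕ} {D A B : ℝ} (hD : 0 < D) (hA : 0 < A)
    (hB : 0 ≤ B)
    (hbar : HamCycle G → ∀ x y, G.Adj x y → unifIntegral (fun v => cycleMatrix G v x y) = 2 / D)
    (h : ∀ u, ∃ (n : ℕ) (p : Fin n → HamCycle G → ℝ), (∀ c, p c ∈ tspPoly G k) ∧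
      ∀ x y, G.Adj x y → ∑ c, unifIntegral (fun v => p c v ^ 2 * cycleMatrix G v x y)
        = A * cycleMatrix G u x y + B) :
    tspScaling G k ≤ ((1 + B * D / (2 * A) : ℝ) : EReal) := by
  refine scalingConstant_le _ _ _ (tspForm_tspMap G) (by
    have : 0 ≤ B * D / (2 * A) := by positivity
    linarith) fun l hl u => ?_
  obtain ⟨n, p, hp, hsum⟩ := h u
  have h1 : 0 ≤ ∑ c, bvlForm (tspMap G) l (p c) (p c) :=
    Finset.sum_nonneg fun c _ => hl _ (hp c)
  -- Both sides vanish off the edges of `G`. On the edges `x̄` is constantly `2 / D`, so the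
  -- constant `B` is the entry of `(B D / 2) x̄`.
  have h2 : ∑ c, (Fintype.card (HamCycle G) : ℝ)⁻¹ • ∑ v, (p c v ^ 2) • tspMap G v
      = A • tspMap G u + (B * D / 2) • barycenter (tspMap G) := by
    apply Subtype.ext
    ext x y
    have e1 : ((∑ c, (Fintype.card (HamCycle G) : ℝ)⁻¹ • ∑ v, (p c v ^ 2) • tspMap G v :
        tspSpace G) : Matrix W W ℝ) x y
        = ∑ c, unifIntegral (fun v => p c v ^ 2 * cycleMatrix G v x y) := by
      simp [unifIntegral, tspMap, Matrix.sum_apply]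
    have e2 : ((A • tspMap G u + (B * D / 2) • barycenter (tspMap G) :
        tspSpace G) : Matrix W W ℝ) x y
        = A * cycleMatrix G u x y
          + (B * D / 2) * unifIntegral (fun v => cycleMatrix G v x y) := by
      simp [unifIntegral, tspMap, Matrix.sum_apply, barycenter]
    rw [e1, e2]
    by_cases hxy : G.Adj x y
    · rw [hsum x y hxy, hbar u x y hxy]; field_simp
    · simp [cycleMatrix_eq_zero G _ hxy, unifIntegral]
  have h3 : ∑ c, bvlForm (tspMap G) l (p c) (p c)
      = A * l (tspMap G u) + (B * D / 2) * l (barycenter (tspMap G)) := by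
    have := congrArg l h2
    simp only [map_sum, map_add, map_smul, smul_eq_mul] at this
    rw [← this]
    refine Finset.sum_congr rfl fun c _ => ?_
    simp only [bvlForm, unifIntegral, smul_eq_mul]
    congr 1
    exact Finset.sum_congr rfl fun v _ => by ring
  rw [h3] at h1
  have : l (tspMap G u) + (1 + B * D / (2 * A) - 1) * l (barycenter (tspMap G))
      = A⁻¹ * (A * l (tspMap G u) + (B * D / 2) * l (barycenter (tspMap G))) := by
    field_simp; ring
  rw [this]; positivity

/-! ### Symmetric matchings -/

/-- An involution `i` of the vertices that matches adjacent vertices of `G` (or fixes a vertex),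
such that the automorphisms of `G` that commute with `i` act transitively on the matched pairs
and on the other neighbours of each vertex. -/
structure SymmMatching (G : SimpleGraph W) (i : W → W) : Prop where
  invol : ∀ x, i (i x) = x
  adj : ∀ x, i x ≠ x → G.Adj x (i x)
  move_other : ∀ x y y', G.Adj x y → G.Adj x y' → y ≠ i x → y' ≠ i x → i y ≠ y → i y' ≠ y' →
    ∃ τ : Equiv.Perm W, (∀ x y, G.Adj (τ x) (τ y) ↔ G.Adj x y) ∧ (∀ z, τ (i z) = i (τ z)) ∧
      τ x = x ∧ τ y = y'
  move_pair : ∀ x x', i x ≠ x → i x' ≠ x' →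
    ∃ τ : Equiv.Perm W, (∀ x y, G.Adj (τ x) (τ y) ↔ G.Adj x y) ∧ (∀ z, τ (i z) = i (τ z)) ∧
      (τ x = x' ∨ τ x = i x')

namespace SymmMatching

variable {G : SimpleGraph W} {i : W → W}

theorem entryMoment_other (h : SymmMatching G i) (Q : ℝ → ℝ) {x y y' : W} (hy : G.Adj x y)
    (hy' : G.Adj x y') (h1 : y ≠ i x) (h2 : y' ≠ i x) (h3 : i y ≠ y) (h4 : i y' ≠ y') :
    entryMoment G i Q x y = entryMoment G i Q x y' := by
  obtain ⟨τ, ha, hc, hx, hyy⟩ := h.move_other x y y' hy hy' h1 h2 h3 h4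
  have := entryMoment_map i Q τ ha hc x y
  rw [hx, hyy] at this
  exact this.symm

theorem entryMoment_pair (h : SymmMatching G i) (Q : ℝ → ℝ) {x x' : W} (hx : i x ≠ x)
    (hx' : i x' ≠ x') : entryMoment G i Q x (i x) = entryMoment G i Q x' (i x') := by
  obtain ⟨τ, ha, hc, h1⟩ := h.move_pair x x' hx hx'
  have := entryMoment_map i Q τ ha hc x (i x)
  rw [hc] at this
  rcases h1 with h1 | h1
  · rw [← this, h1]
  · rw [← this, h1, h.invol, entryMoment_comm]

open Classical in
/-- The entries of `∫ φ Q(t) dμ` for a perfect matching. -/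
theorem entryMoment_perfect (h : SymmMatching G i) (hi : ∀ x, i x ≠ x) (Q : ℝ → ℝ) {D : ℕ}
    (hD : ∀ x, (Finset.univ.filter fun y => G.Adj x y).card = D) (hD1 : 1 < D) {E E₁ : ℝ}
    (hE : matchMoment G i Q = E) (hE₁ : matchMoment G i (fun t => t * Q t) = E₁) {x y : W}
    (hxy : G.Adj x y) :
    entryMoment G i Q x y = if i x = y then 2 * E₁ / Fintype.card W
      else (2 * E - 2 * E₁ / Fintype.card W) / (D - 1) := by
  have hpair : entryMoment G i Q x (i x) = 2 * E₁ / Fintype.card W := by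
    have h1 := sum_entryMoment_match G i Q
    rw [Finset.sum_congr rfl fun z _ => h.entryMoment_pair Q (hi z) (hi x), hE₁] at h1
    have : (0 : ℝ) < Fintype.card W := by
      exact_mod_cast Fintype.card_pos_iff.2 ⟨x⟩
    simp at h1
    field_simp
    linarith
  split_ifs with hix
  · rw [← hix, hpair]
  -- The row of `x` sums to `2 E`: its partner contributes the entry just found, and the other `D -
  -- 1` neighbours contribute equally.
  · have h1 := sum_entryMoment G i Q x
    have h2 : ∑ z, entryMoment G i Q x z
        = ∑ z ∈ Finset.univ.filter fun z => G.Adj x z, entryMoment G i Q x z := by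
      symm
      apply Finset.sum_subset (Finset.subset_univ _)
      intro z _ hz
      exact entryMoment_eq_zero _ _ _ (by simpa using hz)
    have hmem : i x ∈ Finset.univ.filter fun z => G.Adj x z := by simp [h.adj x (hi x)]
    rw [h2, ← Finset.add_sum_erase _ _ hmem, hpair, hE] at h1
    rw [Finset.sum_congr rfl (g := fun _ => entryMoment G i Q x y), Finset.sum_const,
      Finset.card_erase_of_mem hmem, hD, nsmul_eq_mul, Nat.cast_sub hD1.le] at h1
    · have : (1 : ℝ) < D := by exact_mod_cast hD1
      rw [eq_div_iff (by linarith)]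
      push_cast at h1
      linarith
    · intro z hz
      simp only [Finset.mem_erase, Finset.mem_filter, Finset.mem_univ, true_and] at hz
      exact h.entryMoment_other Q hz.2 hxy hz.1 (Ne.symm hix) (hi z) (hi y)

open Classical in
/-- The entries of `∫ φ Q(t) dμ` for a matching of a complete graph that misses one vertex `v`. -/
theorem entryMoment_near_perfect (h : SymmMatching (⊤ : SimpleGraph W) i) {v : W}
    (hi : ∀ x, i x = x ↔ x = v) (Q : ℝ → ℝ) (hN : 4 ≤ Fintype.card W) {E E₁ : ℝ}
    (hE : matchMoment ⊤ i Q = E) (hE₁ : matchMoment ⊤ i (fun t => t * Q t) = E₁) {x y : W}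
    (hxy : x ≠ y) :
    entryMoment ⊤ i Q x y = if x = v ∨ y = v then 2 * E / (Fintype.card W - 1)
      else if i x = y then 2 * E₁ / (Fintype.card W - 1)
      else (2 * E - 2 * E₁ / (Fintype.card W - 1) - 2 * E / (Fintype.card W - 1))
        / (Fintype.card W - 3) := by
  have hN' : (4 : ℝ) ≤ Fintype.card W := by exact_mod_cast hN
  have hself : ∀ z, entryMoment ⊤ i Q z z = 0 := fun z => entryMoment_eq_zero _ _ _ (by simp)
  have hv : ∀ y, y ≠ v → entryMoment ⊤ i Q v y = 2 * E / (Fintype.card W - 1) := by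
    intro y hy
    have h1 := sum_entryMoment ⊤ i Q v
    rw [← Finset.add_sum_erase _ _ (Finset.mem_univ v), hself, hE, zero_add,
      Finset.sum_congr rfl (g := fun _ => entryMoment ⊤ i Q v y), Finset.sum_const,
      Finset.card_erase_of_mem (Finset.mem_univ _), Finset.card_univ, nsmul_eq_mul,
      Nat.cast_sub (by omega)] at h1
    · rw [eq_div_iff (by linarith)]
      push_cast at h1; linarith
    · intro z hz
      have hz' : z ≠ v := by simpa using hz
      have hiv : i v = v := (hi v).2 rfl
      refine h.entryMoment_other Q ?_ ?_ ?_ ?_ ?_ ?_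
      · simpa using hz'.symm
      · simpa using hy.symm
      · rwa [hiv]
      · rwa [hiv]
      · rwa [Ne, hi]
      · rwa [Ne, hi]
  have hpair : ∀ x, x ≠ v → entryMoment ⊤ i Q x (i x) = 2 * E₁ / (Fintype.card W - 1) := by
    intro x hx
    have h1 := sum_entryMoment_match ⊤ i Q
    rw [← Finset.add_sum_erase _ _ (Finset.mem_univ v), (hi v).2 rfl, hself, hE₁, zero_add,
      Finset.sum_congr rfl (g := fun _ => entryMoment ⊤ i Q x (i x)), Finset.sum_const,
      Finset.card_erase_of_mem (Finset.mem_univ _), Finset.card_univ, nsmul_eq_mul,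
      Nat.cast_sub (by omega)] at h1
    · rw [eq_div_iff (by linarith)]
      push_cast at h1; linarith
    · intro z hz
      have hz' : z ≠ v := by simpa using hz
      exact h.entryMoment_pair Q (by rwa [Ne, hi]) (by rwa [Ne, hi])
  split_ifs with hxv hix
  · rcases hxv with rfl | rfl
    · exact hv y (Ne.symm hxy)
    · rw [entryMoment_comm]; exact hv x hxy
  · push Not at hxv
    rw [← hix, hpair x hxv.1]
  · push Not at hxv
    have hix' : i x ≠ x := by rw [Ne, hi]; exact hxv.1
    have hixv : i x ≠ v := fun h0 => hix' (by
      have h5 := congrArg i h0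
      rw [h.invol, (hi v).2 rfl] at h5
      rw [h0, h5])
    -- In the row of `x ≠ v` the diagonal is zero, the entries at the partner and at `v` are known,
    -- and the other `N - 3` are equal.
    have h1 := sum_entryMoment ⊤ i Q x
    have m1 : i x ∈ Finset.univ.erase x := by simp [hix']
    have m2 : v ∈ (Finset.univ.erase x).erase (i x) := by simp [hixv.symm, Ne.symm hxv.1]
    rw [← Finset.add_sum_erase _ _ (Finset.mem_univ x), ← Finset.add_sum_erase _ _ m1,
      ← Finset.add_sum_erase _ _ m2, hself, hE, zero_add, hpair x hxv.1,
      entryMoment_comm _ _ _ x v, hv x hxv.1,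
      Finset.sum_congr rfl (g := fun _ => entryMoment ⊤ i Q x y), Finset.sum_const,
      Finset.card_erase_of_mem m2, Finset.card_erase_of_mem m1,
      Finset.card_erase_of_mem (Finset.mem_univ _), Finset.card_univ, nsmul_eq_mul,
      show Fintype.card W - 1 - 1 - 1 = Fintype.card W - 3 by omega,
      Nat.cast_sub (by omega)] at h1
    · rw [eq_div_iff (by linarith)]
      push_cast at h1; linarith
    · intro z hz
      simp only [Finset.mem_erase, Finset.mem_univ, and_true] at hz
      refine h.entryMoment_other Q ?_ ?_ hz.2.1 (Ne.symm hix) ?_ ?_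
      · simpa using hz.2.2.symm
      · simpa using hxy
      · rw [Ne, hi]; exact hz.1
      · rw [Ne, hi]; exact hxv.2

end SymmMatching

/-! ### Automorphisms of complete and complete bipartite graphs -/

/-- Exchanging the pair of `y` with the pair of `y'`, partners included, respects the matching.
These permutations supply nearly all the symmetry needed. -/
theorem swap_mul_swap_comm {W : Type*} [DecidableEq W] {i : W → W} (hi : ∀ x, i (i x) = x) {y y' : W}
    (h1 : y' ≠ i y) (h2 : i y ≠ y) (h3 : i y' ≠ y') (z : W) :
    (Equiv.swap y y' * Equiv.swap (i y) (i y')) (i z)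
      = i ((Equiv.swap y y' * Equiv.swap (i y) (i y')) z) := by
  have inj : Function.Injective i := Function.LeftInverse.injective hi
  have a1 : ∀ w, i z = w ↔ z = i w := fun w =>
    ⟨fun h => by rw [← h, hi], fun h => by rw [h, hi]⟩
  by_cases hyy : y = y'
  · subst hyy; simp
  have b1 : i y ≠ i y' := fun h => hyy (inj h)
  have b2 : i y' ≠ y := fun h => h1 (by rw [← h, hi])
  simp only [Equiv.Perm.coe_mul, Function.comp_apply, Equiv.swap_apply_def, a1, hi]
  grind

theorem swap_mul_swap_apply {W : Type*} [DecidableEq W] {i : W → W} (hi : ∀ x, i (i x) = x) {y y' : W}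
    (h1 : y' ≠ i y) (h2 : i y ≠ y) :
    (Equiv.swap y y' * Equiv.swap (i y) (i y')) y = y' := by
  have b2 : i y' ≠ y := fun h => h1 (by rw [← h, hi])
  rw [Equiv.Perm.coe_mul, Function.comp_apply,
    Equiv.swap_apply_of_ne_of_ne h2.symm b2.symm, Equiv.swap_apply_left]

theorem swap_mul_swap_of_ne {W : Type*} [DecidableEq W] {i : W → W} (hi : ∀ x, i (i x) = x) {x y y' : W}
    (h1 : x ≠ y) (h2 : x ≠ y') (h3 : y ≠ i x) (h4 : y' ≠ i x) :
    (Equiv.swap y y' * Equiv.swap (i y) (i y')) x = x := by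
  have b1 : x ≠ i y := fun h => h3 (by rw [h, hi])
  have b2 : x ≠ i y' := fun h => h4 (by rw [h, hi])
  rw [Equiv.Perm.coe_mul, Function.comp_apply, Equiv.swap_apply_of_ne_of_ne b1 b2,
    Equiv.swap_apply_of_ne_of_ne h1 h2]

theorem symmMatching_top {W : Type*} {i : W → W} (hi : ∀ x, i (i x) = x) :
    SymmMatching (⊤ : SimpleGraph W) i := by
  classical
  have aut : ∀ τ : Equiv.Perm W, ∀ x y,
      (⊤ : SimpleGraph W).Adj (τ x) (τ y) ↔ (⊤ : SimpleGraph W).Adj x y := fun τ x y => by simp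
  have inj : Function.Injective i := Function.LeftInverse.injective hi
  refine ⟨hi, fun x hx => by simpa using hx.symm, ?_, ?_⟩
  · intro x y y' hxy hxy' h1 h2 h3 h4
    have hxy : x ≠ y := by simpa using hxy
    have hxy' : x ≠ y' := by simpa using hxy'
    -- If `y` and `y'` are matched to each other, the double swap would cancel to the identity; the
    -- single transposition already commutes with `i`.
    by_cases h5 : y' = i y
    · refine ⟨Equiv.swap y y', aut _, fun z => ?_,
        Equiv.swap_apply_of_ne_of_ne hxy hxy', Equiv.swap_apply_left _ _⟩
      subst h5
      have a1 : ∀ w, i z = w ↔ z = i w := fun w =>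
        ⟨fun h => by rw [← h, hi], fun h => by rw [h, hi]⟩
      simp only [Equiv.swap_apply_def, a1, hi]
      grind
    · exact ⟨_, aut _, swap_mul_swap_comm hi h5 h3 h4,
        swap_mul_swap_of_ne hi hxy hxy' h1 h2, swap_mul_swap_apply hi h5 h3⟩
  · intro x x' hx hx'
    by_cases h5 : x' = i x
    · exact ⟨1, aut _, fun z => rfl, Or.inr (by simp [h5, hi])⟩
    · exact ⟨_, aut _, swap_mul_swap_comm hi h5 hx hx', Or.inl (swap_mul_swap_apply hi h5 hx)⟩

/-- Neighbours of one vertex lie on the same side, so they are never matched to each other and the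
double swap is a side-preserving automorphism. Since no such swap exchanges the sides, a vertex `x`
is moved to `x'` or to `i x'`, whichever lies on its side. -/
theorem symmMatching_completeBipartite {V₁ V₂ : Type*}
    {i : V₁ ⊕ V₂ → V₁ ⊕ V₂} (hi : ∀ x, i (i x) = x)
    (hadj : ∀ x, (completeBipartiteGraph V₁ V₂).Adj x (i x)) :
    SymmMatching (completeBipartiteGraph V₁ V₂) i := by
  classical
  have adj_iff : ∀ x y : V₁ ⊕ V₂, (completeBipartiteGraph V₁ V₂).Adj x y ↔
      x.isLeft ≠ y.isLeft := by
    rintro (x | x) (y | y) <;> simp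
  have side : ∀ y y' z : V₁ ⊕ V₂, y.isLeft = y'.isLeft →
      ((Equiv.swap y y' z : V₁ ⊕ V₂)).isLeft = z.isLeft := by
    intro y y' z h
    rw [Equiv.swap_apply_def]; split_ifs with h1 h2
    · rw [h1, h]
    · rw [h2, h]
    · rfl
  have hneg : ∀ x, (i x).isLeft = !x.isLeft := by
    intro x
    have := (adj_iff _ _).1 (hadj x)
    exact (by decide : ∀ a b : Bool, a ≠ b → b = !a) _ _ this
  have hne : ∀ x, i x ≠ x := fun x => (hadj x).ne'
  have aut : ∀ y y' : V₁ ⊕ V₂, y.isLeft = y'.isLeft → ∀ x z,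
      (completeBipartiteGraph V₁ V₂).Adj ((Equiv.swap y y' * Equiv.swap (i y) (i y')) x)
        ((Equiv.swap y y' * Equiv.swap (i y) (i y')) z) ↔
      (completeBipartiteGraph V₁ V₂).Adj x z := by
    intro y y' h x z
    have h' : (i y).isLeft = (i y').isLeft := by rw [hneg, hneg, h]
    rw [adj_iff, adj_iff, Equiv.Perm.coe_mul, Function.comp_apply, Function.comp_apply,
      side _ _ _ h, side _ _ _ h, side _ _ _ h', side _ _ _ h']
  have ne_of_side : ∀ y y' : V₁ ⊕ V₂, y.isLeft = y'.isLeft → y' ≠ i y := by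
    rintro y y' h rfl
    rw [hneg] at h
    exact (by decide : ∀ a : Bool, a ≠ !a) _ h
  refine ⟨hi, fun x _ => hadj x, ?_, ?_⟩
  · intro x y y' hxy hxy' h1 h2 h3 h4
    have hs : y.isLeft = y'.isLeft := by
      rw [adj_iff] at hxy hxy'
      exact (by decide : ∀ a b c : Bool, a ≠ b → a ≠ c → b = c) _ _ _ hxy hxy'
    exact ⟨_, aut y y' hs, swap_mul_swap_comm hi (ne_of_side _ _ hs) h3 h4,
      swap_mul_swap_of_ne hi hxy.ne hxy'.ne h1 h2, swap_mul_swap_apply hi (ne_of_side _ _ hs) h3⟩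
  · intro x x' hx hx'
    by_cases hs : x.isLeft = x'.isLeft
    · exact ⟨_, aut x x' hs, swap_mul_swap_comm hi (ne_of_side _ _ hs) hx hx',
        Or.inl (swap_mul_swap_apply hi (ne_of_side _ _ hs) hx)⟩
    · have hs' : x.isLeft = (i x').isLeft := by
        rw [hneg]
        exact (by decide : ∀ a b : Bool, ¬ a = b → a = !b) _ _ hs
      exact ⟨_, aut x (i x') hs', swap_mul_swap_comm hi (ne_of_side _ _ hs') hx (hne _),
        Or.inr (swap_mul_swap_apply hi (ne_of_side _ _ hs') hx)⟩

end Certificates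

end

/-! ### The alternate edges of a cycle and their rotations. -/

noncomputable section

section Rotations

/-- The involution of `Fin (m + 3)` that pairs consecutive elements from the top downwards, and
fixes `0` when their number is odd. -/
def pairing (m : ℕ) (j : Fin (m + 3)) : Fin (m + 3) :=
  -- For odd length the element `0` falls into the second case, and the truncated `0 - 1 = 0` makes
  -- it a fixed point.
  if h : (j.val + (m + 3)) % 2 = 0 then ⟨j.val + 1, by omega⟩ else ⟨j.val - 1, by omega⟩

theorem pairing_val (m : ℕ) (j : Fin (m + 3)) :
    (pairing m j).val = if (j.val + (m + 3)) % 2 = 0 then j.val + 1 else j.val - 1 := by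
  unfold pairing; split_ifs <;> rfl

theorem pairing_pairing (m : ℕ) (j : Fin (m + 3)) : pairing m (pairing m j) = j := by
  apply Fin.ext
  have := j.isLt
  rw [pairing_val, pairing_val]
  split_ifs <;> omega

theorem pairing_eq_self_iff (m : ℕ) (j : Fin (m + 3)) :
    pairing m j = j ↔ (m + 3) % 2 = 1 ∧ j = 0 := by
  rw [Fin.ext_iff, Fin.ext_iff, pairing_val, Fin.val_zero]
  have := j.isLt
  split_ifs <;> omega

theorem pairing_eq_add_one_iff (m : ℕ) (j : Fin (m + 3)) :
    pairing m j = j + 1 ↔ (j.val + (m + 3)) % 2 = 0 := by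
  rw [Fin.ext_iff, pairing_val, Fin.val_add_one]
  have := j.isLt
  split_ifs with h1 h2 h2
  · rw [h2, Fin.val_last] at h1; omega
  · omega
  · rw [h2, Fin.val_last] at *; omega
  · omega

theorem pairing_add_one_eq_iff (m : ℕ) (j : Fin (m + 3)) :
    pairing m j + 1 = j ↔ (j.val + (m + 3)) % 2 = 1 ∧ j ≠ 0 := by
  have h : pairing m j + 1 = j ↔ pairing m (pairing m j) = pairing m j + 1 := by
    rw [pairing_pairing, eq_comm]
  rw [h, pairing_eq_add_one_iff, pairing_val, Ne, Fin.ext_iff, Fin.val_zero]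
  have := j.isLt
  split_ifs <;> omega

theorem card_pairing_add_one_eq (m : ℕ) :
    (Finset.univ.filter fun j : Fin (m + 3) => pairing m j + 1 = j).card
      = (Finset.univ.filter fun j : Fin (m + 3) => pairing m j = j + 1).card := by
  refine Finset.card_bij (fun j _ => pairing m j) ?_ ?_ ?_
  · intro j hj
    simp only [Finset.mem_filter, Finset.mem_univ, true_and] at hj ⊢
    rw [pairing_pairing, hj]
  · intro j _ j' _ h
    rw [← pairing_pairing m j, h, pairing_pairing]
  · intro j hj
    simp only [Finset.mem_filter, Finset.mem_univ, true_and] at hj ⊢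
    exact ⟨pairing m j, by rw [pairing_pairing, hj], pairing_pairing m j⟩

theorem card_pairing_eq_self (m : ℕ) :
    (Finset.univ.filter fun j : Fin (m + 3) => pairing m j = j).card = (m + 3) % 2 := by
  simp only [pairing_eq_self_iff]
  rcases Nat.mod_two_eq_zero_or_one (m + 3) with h | h
  · simp [h]
  · simp [h, Finset.filter_eq']

/-- Every element is fixed, the lower element of a consecutive pair, or the upper one; `pairing` is
a bijection between the last two kinds. -/
theorem card_pairing_eq_add_one (m : ℕ) :
    (Finset.univ.filter fun j : Fin (m + 3) => pairing m j = j + 1).card = (m + 3) / 2 := by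
  have h1 := Finset.card_filter_add_card_filter_not (s := (Finset.univ : Finset (Fin (m + 3))))
    (fun j => pairing m j = j + 1)
  have h2 := Finset.card_filter_add_card_filter_not
    (s := Finset.univ.filter fun j : Fin (m + 3) => ¬ pairing m j = j + 1)
    (fun j => pairing m j = j)
  rw [Finset.filter_filter, Finset.filter_filter] at h2
  have h3 : (Finset.univ.filter fun j : Fin (m + 3) => ¬ pairing m j = j + 1 ∧ pairing m j = j)
      = Finset.univ.filter fun j => pairing m j = j := by
    ext j
    simp only [Finset.mem_filter, Finset.mem_univ, true_and, and_iff_right_iff_imp]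
    intro h h'
    rw [h] at h'
    simp at h'
  have h4 : (Finset.univ.filter fun j : Fin (m + 3) => ¬ pairing m j = j + 1 ∧ ¬ pairing m j = j)
      = Finset.univ.filter fun j => pairing m j + 1 = j := by
    ext j
    simp only [Finset.mem_filter, Finset.mem_univ, true_and]
    rw [pairing_add_one_eq_iff, pairing_eq_add_one_iff, pairing_eq_self_iff]
    have : j = 0 → j.val = 0 := fun h => by rw [h]; rfl
    have h0 : j.val = 0 → j = 0 := fun h => Fin.ext h
    by_cases hj : j = 0
    · have := this hj
      simp only [hj, ne_eq, not_true_eq_false, and_false, iff_false, and_true]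
      simp only [Fin.val_zero]; omega
    · simp [hj]
  rw [h3, h4, card_pairing_eq_self, card_pairing_add_one_eq] at h2
  rw [Finset.card_univ, Fintype.card_fin] at h1
  omega

variable {W : Type*}

/-- The rotations of the matching `pairing` along a hamiltonian cycle. -/
def rotatedMatching {m : ℕ} (e : Fin (m + 3) ≃ W) (c : Fin (m + 3)) (x : W) : W :=
  e (pairing m (e.symm x - c) + c)

theorem rotatedMatching_invol {m : ℕ} (e : Fin (m + 3) ≃ W) (c : Fin (m + 3)) (x : W) :
    rotatedMatching e c (rotatedMatching e c x) = x := by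
  simp [rotatedMatching, pairing_pairing]

/-- For odd length the `c`-th rotation misses exactly the vertex `e c`, so each vertex is missed by
one rotation. -/
theorem rotatedMatching_eq_self_iff {m : ℕ} (e : Fin (m + 3) ≃ W) (c : Fin (m + 3)) (x : W) :
    rotatedMatching e c x = x ↔ (m + 3) % 2 = 1 ∧ x = e c := by
  rw [rotatedMatching, ← Equiv.eq_symm_apply, ← eq_sub_iff_add_eq, pairing_eq_self_iff,
    sub_eq_zero, Equiv.symm_apply_eq]

theorem rotatedMatching_adj {m : ℕ} {H : SimpleGraph W}
    (e : SimpleGraph.cycleGraph (m + 3) ≃g H) (c : Fin (m + 3)) (x : W)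
    (hx : rotatedMatching e.toEquiv c x ≠ x) : H.Adj x (rotatedMatching e.toEquiv c x) := by
  have h1 : H.Adj (e (e.symm x)) (e (pairing m (e.symm x - c) + c)) := by
    rw [e.map_adj_iff, SimpleGraph.cycleGraph_adj]
    set j := e.symm x - c with hj
    have hjx : e.symm x = j + c := by rw [hj]; abel
    have hne : pairing m j ≠ j := by
      intro h
      apply hx
      have : e.toEquiv.symm x = e.symm x := rfl
      rw [rotatedMatching, this, ← hj, h, hj, sub_add_cancel]
      exact e.apply_symm_apply x
    rw [hjx]
    have h2 : pairing m j = j + 1 ∨ pairing m j + 1 = j := by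
      rw [pairing_eq_add_one_iff, pairing_add_one_eq_iff]
      rw [Ne, pairing_eq_self_iff] at hne
      by_cases h0 : j = 0
      · have : j.val = 0 := by rw [h0]; rfl
        simp only [h0, and_true] at hne
        left; omega
      · simp only [ne_eq, h0, not_false_eq_true, and_true]
        omega
    rcases h2 with h2 | h2
    · right; rw [h2]; abel
    · left
      rw [show j + c - (pairing m j + c) = j - pairing m j by abel, sub_eq_iff_eq_add, ← h2,
        show pairing m (pairing m j + 1) = pairing m j from by rw [h2]]
      abel
  rw [e.apply_symm_apply] at h1
  exact h1

-- In terms of `d = a - c` the condition reads `pairing m d - d = b - a`, where `x = e a`, `y = e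
-- b`. This difference is `±1` off the fixed point, and each sign occurs for half of the positions,
-- rounded down. Hence only edges of the cycle are covered, all equally often.
open Classical in
theorem card_rotatedMatching {m : ℕ} {H : SimpleGraph W}
    (e : SimpleGraph.cycleGraph (m + 3) ≃g H) {x y : W} (hxy : x ≠ y) :
    (Finset.univ.filter fun c => rotatedMatching e.toEquiv c x = y).card
      = (m + 3) / 2 * if H.Adj x y then 1 else 0 := by
  obtain ⟨a, rfl⟩ := e.surjective x
  obtain ⟨b, rfl⟩ := e.surjective y
  have hab : a ≠ b := fun h => hxy (by rw [h])
  rw [show (H.Adj (e a) (e b)) = ((SimpleGraph.cycleGraph (m + 3)).Adj a b) from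
    propext e.map_adj_iff, SimpleGraph.cycleGraph_adj]
  have h1 : (Finset.univ.filter fun c => rotatedMatching e.toEquiv c (e a) = e b).card
      = (Finset.univ.filter fun d : Fin (m + 3) => pairing m d - d = b - a).card := by
    refine Finset.card_bij (fun c _ => a - c) ?_ ?_ ?_
    · intro c hc
      simp only [Finset.mem_filter, Finset.mem_univ, true_and] at hc ⊢
      have h2 : e (pairing m (a - c) + c) = e b := by
        rw [← hc]
        have : e.toEquiv.symm (e a) = a := e.symm_apply_apply a
        rw [rotatedMatching, this]; rfl
      rw [← e.injective h2]; abel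
    · intro c _ c' _ h
      exact sub_right_injective h
    · intro d hd
      simp only [Finset.mem_filter, Finset.mem_univ, true_and] at hd ⊢
      refine ⟨a - d, ?_, by abel⟩
      have : e.toEquiv.symm (e a) = a := e.symm_apply_apply a
      rw [rotatedMatching, this, sub_sub_cancel]
      have : pairing m d + (a - d) = b := by
        rw [show pairing m d + (a - d) = (pairing m d - d) + a by abel, hd]; abel
      rw [this]; rfl
  rw [h1]
  split_ifs with h
  · rw [mul_one]
    rcases h with h | h
    · rw [show b - a = -1 by rw [← h]; abel, ← card_pairing_eq_add_one,
        ← card_pairing_add_one_eq]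
      congr 1
      ext d
      simp only [Finset.mem_filter, Finset.mem_univ, true_and]
      rw [sub_eq_iff_eq_add, ← eq_sub_iff_add_eq]
      rw [show -1 + d = d - 1 by abel]
    · rw [h, ← card_pairing_eq_add_one]
      congr 1
      ext d
      simp only [Finset.mem_filter, Finset.mem_univ, true_and]
      rw [sub_eq_iff_eq_add, add_comm d 1]
  · rw [mul_zero, Finset.card_eq_zero, Finset.filter_eq_empty_iff]
    intro d _ hd
    push Not at h
    by_cases h2 : pairing m d = d + 1
    · apply h.2; rw [← hd, h2]; abel
    by_cases h3 : pairing m d + 1 = d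
    · apply h.1; rw [← neg_sub b a, ← hd]
      nth_rewrite 2 [← h3]; abel
    have h4 : pairing m d = d := by
      rw [pairing_eq_add_one_iff] at h2
      rw [pairing_add_one_eq_iff] at h3
      rw [pairing_eq_self_iff]
      by_cases h0 : d = 0
      · have : d.val = 0 := by rw [h0]; rfl
        exact ⟨by omega, h0⟩
      · exact absurd ⟨by omega, h0⟩ h3
    rw [h4, sub_self] at hd
    exact hab (sub_eq_zero.1 hd.symm).symm

end Rotations

end

/-! ### Scaling bounds in terms of the moments `E` and `E₁`. -/

noncomputable section

section ScalingBounds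

variable {W : Type*} [Fintype W]

theorem unifIntegral_mono {X : Type*} [Fintype X] {f g : X → ℝ} (h : ∀ u, f u ≤ g u) :
    unifIntegral f ≤ unifIntegral g := by
  unfold unifIntegral
  simp only [smul_eq_mul]
  exact mul_le_mul_of_nonneg_left (Finset.sum_le_sum fun u _ => h u) (by positivity)

theorem unifIntegral_nonneg {X : Type*} [Fintype X] {f : X → ℝ} (h : ∀ u, 0 ≤ f u) :
    0 ≤ unifIntegral f := by
  unfold unifIntegral
  exact mul_nonneg (by positivity) (Finset.sum_nonneg fun u _ => h u)

theorem unifIntegral_const {X : Type*} [Fintype X] [Nonempty X] (c : ℝ) :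
    unifIntegral (fun _ : X => c) = c := by
  simp [unifIntegral]

/-- A matching supported on `s` has at most `card s / 2` edges, so `t ≤ card s / 2`. This keeps the
constant `B` of the certificate nonnegative. -/
theorem matchMoment_mul_le (G : SimpleGraph W) (i : W → W) {Q : ℝ → ℝ} (hQ : ∀ t, 0 ≤ Q t)
    {s : Finset W} (hs : ∀ x, x ∉ s → i x = x) :
    2 * matchMoment G i (fun t => t * Q t) ≤ s.card * matchMoment G i Q := by
  classical
  unfold matchMoment
  rw [← unifIntegral_mul_left, ← unifIntegral_mul_left]
  refine unifIntegral_mono fun u => ?_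
  rw [← mul_assoc]
  refine mul_le_mul_of_nonneg_right ?_ (hQ _)
  rw [matchCount, ← mul_assoc, mul_one_div_cancel two_ne_zero, one_mul]
  rw [← Finset.sum_subset (Finset.subset_univ s)
    (fun x _ hx => by rw [hs x hx, cycleMatrix_self]), ← nsmul_one, ← Finset.sum_const]
  refine Finset.sum_le_sum fun x _ => ?_
  rw [cycleMatrix_apply]; split_ifs <;> norm_num

theorem matchMoment_nonneg (G : SimpleGraph W) (i : W → W) {Q : ℝ → ℝ} (hQ : ∀ t, 0 ≤ Q t) :
    0 ≤ matchMoment G i Q := unifIntegral_nonneg fun _ => hQ _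

open Classical in
/-- The entries of `x̄`. -/
theorem unifIntegral_cycleMatrix {G : SimpleGraph W} {D : ℕ}
    (hD : ∀ x, (Finset.univ.filter fun y => G.Adj x y).card = D)
    (hswap : ∀ x y y', G.Adj x y → G.Adj x y' → ∃ τ : Equiv.Perm W,
      (∀ x y, G.Adj (τ x) (τ y) ↔ G.Adj x y) ∧ τ x = x ∧ τ y = y')
    (u : HamCycle G) {x y : W} (hxy : G.Adj x y) :
    unifIntegral (fun v => cycleMatrix G v x y) = 2 / D := by
  have : Nonempty (HamCycle G) := ⟨u⟩
  have key : ∀ z, G.Adj x z → entryMoment G id (fun _ => 1) x z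
      = entryMoment G id (fun _ => 1) x y := by
    intro z hz
    obtain ⟨τ, ha, hx, hy⟩ := hswap x y z hxy hz
    have := entryMoment_map id (fun _ => 1) τ ha (fun _ => rfl) x y
    rwa [hx, hy] at this
  have h1 := sum_entryMoment G id (fun _ => 1) x
  rw [← Finset.sum_subset (Finset.subset_univ (Finset.univ.filter fun y => G.Adj x y))
    (fun z _ hz => entryMoment_eq_zero _ _ _ (by simpa using hz)),
    Finset.sum_congr rfl fun z hz => key z (by simpa using hz), Finset.sum_const, hD,
    matchMoment, unifIntegral_const, nsmul_eq_mul] at h1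
  simp only [entryMoment, one_mul, mul_one] at h1
  have hD0 : (D : ℝ) ≠ 0 := by
    intro h; rw [h] at h1; norm_num at h1
  rw [eq_div_iff hD0, mul_comm, h1]

open Classical in
/-- The bound for the scaling constant from the moments of the number of edges of a hamiltonian
cycle in a perfect matching. -/
theorem tspScaling_le_of_perfect {G : SimpleGraph W} {m D : ℕ} (hm : Fintype.card W = m + 3)
    (heven : (m + 3) % 2 = 0) (hD : ∀ x, (Finset.univ.filter fun y => G.Adj x y).card = D)
    (hD1 : 1 < D)
    (hswap : ∀ x y y', G.Adj x y → G.Adj x y' → ∃ τ : Equiv.Perm W,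
      (∀ x y, G.Adj (τ x) (τ y) ↔ G.Adj x y) ∧ τ x = x ∧ τ y = y')
    (hsym : ∀ i : W → W, (∀ x, i (i x) = x) → (∀ x, G.Adj x (i x)) → SymmMatching G i)
    [Nonempty (HamCycle G)] (k : ℕ) (c : ℕ → ℝ) {E E₁ : ℝ}
    (hE : ∀ i : W → W, (∀ x, i (i x) = x) → (∀ x, G.Adj x (i x)) →
      matchMoment G i (fun t => ∏ j ∈ Finset.range k, (t - c j) ^ 2) = E)
    (hE₁ : ∀ i : W → W, (∀ x, i (i x) = x) → (∀ x, G.Adj x (i x)) →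
      matchMoment G i (fun t => t * ∏ j ∈ Finset.range k, (t - c j) ^ 2) = E₁)
    (hpos : (Fintype.card W : ℝ) * E < D * E₁) :
    tspScaling G k ≤ (((D - 1) * Fintype.card W * E / (D * E₁ - Fintype.card W * E) : ℝ) :
      EReal) := by
  set Q : ℝ → ℝ := fun t => ∏ j ∈ Finset.range k, (t - c j) ^ 2 with hQ
  have hQ0 : ∀ t, 0 ≤ Q t := fun t => Finset.prod_nonneg fun j _ => sq_nonneg _
  set N : ℝ := (Fintype.card W : ℝ) with hN
  have hN3 : N = m + 3 := by rw [hN, hm]; push_cast; ring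
  have hN0 : 0 < N := by rw [hN3]; positivity
  have hD1' : (1 : ℝ) < D := by exact_mod_cast hD1
  have hfam : ∀ u : HamCycle G, ∃ I : Fin (m + 3) → W → W, (∀ c x, I c (I c x) = x) ∧
      (∀ c x, G.Adj x (I c x)) ∧ ∀ x y, x ≠ y →
        (((Finset.univ.filter fun c => I c x = y).card : ℕ) : ℝ) = N / 2 * cycleMatrix G u x y := by
    intro u
    obtain ⟨e⟩ := u.exists_iso hm
    refine ⟨rotatedMatching e.toEquiv, rotatedMatching_invol _, fun c x =>
      u.graph_le (rotatedMatching_adj e c x ?_), fun x y hxy => ?_⟩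
    · rw [Ne, rotatedMatching_eq_self_iff]; omega
    · rw [card_rotatedMatching e hxy, cycleMatrix_apply, hN3]
      have : (((m + 3) / 2 : ℕ) : ℝ) = ((m : ℝ) + 3) / 2 := by
        rw [Nat.cast_div (Nat.dvd_of_mod_eq_zero heven) two_ne_zero]; push_cast; ring
      rw [Nat.cast_mul, this]; push_cast; ring
  have hE0 : 0 ≤ E ∧ 2 * E₁ ≤ N * E := by
    obtain ⟨I, hI1, hI2, -⟩ := hfam (Classical.arbitrary _)
    refine ⟨hE (I 0) (hI1 0) (hI2 0) ▸ matchMoment_nonneg _ _ hQ0, ?_⟩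
    rw [← hE (I 0) (hI1 0) (hI2 0), ← hE₁ (I 0) (hI1 0) (hI2 0), hN]
    exact matchMoment_mul_le G (I 0) hQ0 (s := Finset.univ) (by simp)
  -- The entry of `∫ Q(t) φ dμ` at the edges off the matching; on the matching it is `2 E₁ / N`. The
  -- hypothesis `hpos` says that the latter is larger.
  set C : ℝ := (2 * E - 2 * E₁ / N) / (D - 1) with hC
  have hC0 : 0 ≤ C := by
    refine div_nonneg ?_ (by linarith)
    have : 2 * E₁ / N ≤ E := by rw [div_le_iff₀ hN0]; linarith
    linarith
  have hIC : 2 * E₁ / N - C = 2 * (D * E₁ - N * E) / (N * (D - 1)) := by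
    have : (D : ℝ) - 1 ≠ 0 := by linarith
    rw [hC]; field_simp; ring
  have hIC0 : 0 < 2 * E₁ / N - C := by
    rw [hIC]
    exact div_pos (by linarith) (mul_pos hN0 (by linarith))
  -- There are `N` rotations, each contributing `C` everywhere, and an edge of `u` receives the
  -- excess `2 E₁ / N - C` from `N / 2` of them.
  have main := tspScaling_le (G := G) (k := k) (D := D) (A := N / 2 * (2 * E₁ / N - C))
    (B := N * C) (by linarith) (by positivity) (by positivity)
    (fun u x y hxy => unifIntegral_cycleMatrix hD hswap u hxy) ?_
  · convert main using 2
    rw [hIC, hC]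
    have h1 : (D : ℝ) - 1 ≠ 0 := by linarith
    have h2 : D * E₁ - N * E ≠ 0 := by linarith
    field_simp; ring
  · intro u
    obtain ⟨I, hI1, hI2, hI3⟩ := hfam u
    refine ⟨m + 3, fun d v => ∏ j ∈ Finset.range k, (matchCount G (I d) v - c j),
      fun d => prod_mem_tspPoly G (I d) c k, fun x y hxy => ?_⟩
    have h1 : ∀ d, unifIntegral (fun v => (∏ j ∈ Finset.range k, (matchCount G (I d) v - c j)) ^ 2
        * cycleMatrix G v x y) = C + (2 * E₁ / N - C) * if I d x = y then 1 else 0 := by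
      intro d
      have h2 := (hsym (I d) (hI1 d) (hI2 d)).entryMoment_perfect (fun x => (hI2 d x).ne') Q hD hD1
        (hE _ (hI1 d) (hI2 d)) (hE₁ _ (hI1 d) (hI2 d)) hxy
      simp only [entryMoment, hQ, Finset.prod_pow] at h2
      rw [h2]
      split_ifs <;> ring
    rw [Finset.sum_congr rfl fun d _ => h1 d, Finset.sum_add_distrib, ← Finset.mul_sum,
      Finset.sum_boole, hI3 x y hxy.ne, Finset.sum_const, Finset.card_univ, Fintype.card_fin,
      nsmul_eq_mul, hN3]
    push_cast; ring

open Classical in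
/-- The bound for the scaling constant of a complete graph on an odd number of vertices from the
moments of the number of edges of a hamiltonian cycle in a matching that misses one vertex. -/
theorem tspScaling_le_of_near_perfect {m : ℕ} (hm : Fintype.card W = m + 3)
    (hodd : (m + 3) % 2 = 1) (hm1 : 1 ≤ m) [Nonempty (HamCycle (⊤ : SimpleGraph W))]
    (k : ℕ) (c : ℕ → ℝ) {E E₁ : ℝ}
    (hE : ∀ (i : W → W) (v : W), (∀ x, i (i x) = x) → (∀ x, i x = x ↔ x = v) →
      matchMoment ⊤ i (fun t => ∏ j ∈ Finset.range k, (t - c j) ^ 2) = E)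
    (hE₁ : ∀ (i : W → W) (v : W), (∀ x, i (i x) = x) → (∀ x, i x = x ↔ x = v) →
      matchMoment ⊤ i (fun t => t * ∏ j ∈ Finset.range k, (t - c j) ^ 2) = E₁)
    (hpos : E < E₁) :
    tspScaling (⊤ : SimpleGraph W) k ≤
      (((Fintype.card W : ℝ) * (Fintype.card W - 3) * E
        / ((Fintype.card W - 2) * (E₁ - E)) : ℝ) : EReal) := by
  set Q : ℝ → ℝ := fun t => ∏ j ∈ Finset.range k, (t - c j) ^ 2 with hQ
  have hQ0 : ∀ t, 0 ≤ Q t := fun t => Finset.prod_nonneg fun j _ => sq_nonneg _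
  set N : ℝ := (Fintype.card W : ℝ) with hN
  have hN3 : N = m + 3 := by rw [hN, hm]; push_cast; ring
  have hm1' : (1 : ℝ) ≤ m := by exact_mod_cast hm1
  have hfam : ∀ u : HamCycle (⊤ : SimpleGraph W), ∃ (I : Fin (m + 3) → W → W)
      (v : Fin (m + 3) ≃ W), (∀ c x, I c (I c x) = x) ∧
      (∀ c x, I c x = x ↔ x = v c) ∧ ∀ x y, x ≠ y →
        (((Finset.univ.filter fun c => I c x = y).card : ℕ) : ℝ)
          = (N - 1) / 2 * cycleMatrix ⊤ u x y := by
    intro u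
    obtain ⟨e⟩ := u.exists_iso hm
    refine ⟨rotatedMatching e.toEquiv, e.toEquiv, rotatedMatching_invol _, fun c x => ?_,
      fun x y hxy => ?_⟩
    · rw [rotatedMatching_eq_self_iff]; simp [hodd]
    · rw [card_rotatedMatching e hxy, cycleMatrix_apply, hN3]
      have : (((m + 3) / 2 : ℕ) : ℝ) = ((m : ℝ) + 3 - 1) / 2 := by
        have h : 2 * ((m + 3) / 2) + 1 = m + 3 := by omega
        have : (2 * ((m + 3) / 2 : ℕ) + 1 : ℝ) = m + 3 := by exact_mod_cast h
        linarith
      rw [Nat.cast_mul, this]; push_cast; ring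
  have hE0 : 0 ≤ E ∧ 2 * E₁ ≤ (N - 1) * E := by
    obtain ⟨I, v, hI1, hI2, -⟩ := hfam (Classical.arbitrary _)
    refine ⟨hE (I 0) (v 0) (hI1 0) (hI2 0) ▸ matchMoment_nonneg _ _ hQ0, ?_⟩
    rw [← hE (I 0) (v 0) (hI1 0) (hI2 0), ← hE₁ (I 0) (v 0) (hI1 0) (hI2 0), hN]
    have h := matchMoment_mul_le ⊤ (I 0) hQ0 (s := Finset.univ.erase (v 0))
      (fun x hx => (hI2 0 x).2 (by simpa using hx))
    rw [Finset.card_erase_of_mem (Finset.mem_univ _), Finset.card_univ, Nat.cast_sub (by omega),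
      Nat.cast_one] at h
    exact h
  set C : ℝ := (2 * E - 2 * E₁ / (N - 1) - 2 * E / (N - 1)) / (N - 3) with hC
  have hN1 : 0 < N - 1 := by linarith
  have hN3' : 0 < N - 3 := by linarith
  have hN2 : 0 < N - 2 := by linarith
  -- Over all rotations an edge gets `C` from each of the `N` matchings, plus the excess `2 E / (N -
  -- 1) - C` twice, from the rotations that miss one of its two ends.
  have hB : N * C + 2 * (2 * E / (N - 1) - C) = ((N - 2) * (2 * E - 2 * E₁ / (N - 1))
      + (N - 4) * (2 * E / (N - 1))) / (N - 3) := by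
    rw [hC]; field_simp; ring
  have hB0 : 0 ≤ N * C + 2 * (2 * E / (N - 1) - C) := by
    rw [hB]
    refine div_nonneg ?_ hN3'.le
    have h1 : 2 * E₁ / (N - 1) ≤ E := by rw [div_le_iff₀ hN1]; linarith
    have h2 : 0 ≤ 2 * E / (N - 1) := div_nonneg (by linarith) hN1.le
    exact add_nonneg (mul_nonneg hN2.le (by linarith)) (mul_nonneg (by linarith) h2)
  have hIC : 2 * E₁ / (N - 1) - C = 2 * (N - 2) * (E₁ - E) / ((N - 1) * (N - 3)) := by
    rw [hC]; field_simp; ring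
  have hIC0 : 0 < 2 * E₁ / (N - 1) - C := by
    rw [hIC]
    have : 0 < E₁ - E := by linarith
    positivity
  have hdeg : ∀ x : W, (Finset.univ.filter fun y => (⊤ : SimpleGraph W).Adj x y).card = m + 2 := by
    intro x
    have : (Finset.univ.filter fun y => (⊤ : SimpleGraph W).Adj x y) = Finset.univ.erase x := by
      ext y; simp [eq_comm]
    rw [this, Finset.card_erase_of_mem (Finset.mem_univ _), Finset.card_univ, hm]; rfl
  have main := tspScaling_le (G := (⊤ : SimpleGraph W)) (k := k) (D := ((m + 2 : ℕ) : ℝ))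
    (A := (N - 1) / 2 * (2 * E₁ / (N - 1) - C)) (B := N * C + 2 * (2 * E / (N - 1) - C))
    (by positivity) (by positivity) hB0
    (fun u x y hxy => unifIntegral_cycleMatrix (fun x => by convert hdeg x) (fun x y y' hy hy' =>
      ⟨Equiv.swap y y', fun _ _ => by simp, Equiv.swap_apply_of_ne_of_ne
        (by simpa using hy) (by simpa using hy'), Equiv.swap_apply_left _ _⟩) u hxy) ?_
  · convert main using 2
    rw [hIC, hB]
    have h2 : 0 < E₁ - E := by linarith
    have h3 : ((m + 2 : ℕ) : ℝ) = N - 1 := by rw [hN3]; push_cast; ring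
    rw [h3]
    field_simp; ring
  · intro u
    obtain ⟨I, v, hI1, hI2, hI3⟩ := hfam u
    refine ⟨m + 3, fun d w => ∏ j ∈ Finset.range k, (matchCount ⊤ (I d) w - c j),
      fun d => prod_mem_tspPoly ⊤ (I d) c k, fun x y hxy => ?_⟩
    have hxy' : x ≠ y := hxy.ne
    have h1 : ∀ d, unifIntegral (fun w => (∏ j ∈ Finset.range k, (matchCount ⊤ (I d) w - c j)) ^ 2
        * cycleMatrix ⊤ w x y) = C + (2 * E₁ / (N - 1) - C) * (if I d x = y then 1 else 0)
          + (2 * E / (N - 1) - C) * ((if v d = x then 1 else 0) + (if v d = y then 1 else 0)) := by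
      intro d
      have h2 := (symmMatching_top (hI1 d)).entryMoment_near_perfect (hI2 d) Q (by omega)
        (hE _ _ (hI1 d) (hI2 d)) (hE₁ _ _ (hI1 d) (hI2 d)) hxy'
      simp only [entryMoment, hQ, Finset.prod_pow] at h2
      rw [h2]
      have hx := hI2 d x
      have hy := hI2 d y
      by_cases c1 : x = v d
      · have c2 : y ≠ v d := fun h => hxy' (c1.trans h.symm)
        have c3 : I d x ≠ y := by rw [hx.2 c1]; exact hxy'
        simp only [c1.symm, true_or, if_true, if_false, c3]
        rw [if_neg hxy']; ring
      · by_cases c2 : y = v d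
        · have c3 : I d x ≠ y := fun h => hxy' (by rw [← hI1 d x, h, hy.2 c2])
          rw [if_pos (Or.inr c2), if_neg c3, if_neg (Ne.symm c1), if_pos c2.symm]; ring
        · rw [if_neg (by tauto), if_neg (Ne.symm c1), if_neg (Ne.symm c2)]
          split_ifs <;> ring
    -- The missed vertex runs through all vertices exactly once, so its effect on the sum is the
    -- same for every edge.
    have h4 : ∀ z : W, ∑ d, (if v d = z then (1 : ℝ) else 0) = 1 := by
      intro z
      rw [Finset.sum_eq_single (v.symm z)] <;> simp [Equiv.eq_symm_apply]
    rw [Finset.sum_congr rfl fun d _ => h1 d, Finset.sum_add_distrib, Finset.sum_add_distrib,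
      ← Finset.mul_sum, ← Finset.mul_sum, Finset.sum_add_distrib, h4, h4,
      Finset.sum_boole, hI3 x y hxy', Finset.sum_const, Finset.card_univ, Fintype.card_fin,
      nsmul_eq_mul, hN3]
    push_cast; ring

end ScalingBounds

end

/-! ### Counting sets without consecutive elements on a path and on a cycle. -/

section NonconsecutiveSets

open Finset

/-- The `i`-element subsets of `{0, …, n - 1}` without two consecutive elements. -/
def sparseSets (n i : ℕ) : Finset (Finset ℕ) :=
  ((range n).powersetCard i).filter fun P => ∀ j ∈ P, j + 1 ∉ P

theorem mem_sparseSets {n i : ℕ} {P : Finset ℕ} :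
    P ∈ sparseSets n i ↔ ((∀ j ∈ P, j < n) ∧ P.card = i) ∧ ∀ j ∈ P, j + 1 ∉ P := by
  simp [sparseSets, mem_powersetCard, Finset.subset_iff]

/-- Split by whether the top element `n + 1` occurs; if it does, `n` cannot, and the rest lives
below `n`. -/
theorem sparseSets_succ_succ (n i : ℕ) :
    sparseSets (n + 2) (i + 1)
      = sparseSets (n + 1) (i + 1) ∪ (sparseSets n i).image (insert (n + 1)) := by
  ext P
  simp only [mem_union, mem_image, mem_sparseSets]
  constructor
  · rintro ⟨⟨h1, h2⟩, h3⟩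
    by_cases hP : n + 1 ∈ P
    · right
      refine ⟨P.erase (n + 1), ⟨⟨fun j hj => ?_, by rw [card_erase_of_mem hP, h2]; rfl⟩,
        fun j hj hj' => h3 j (mem_of_mem_erase hj) (mem_of_mem_erase hj')⟩, insert_erase hP⟩
      have a1 := h1 j (mem_of_mem_erase hj)
      have a2 := ne_of_mem_erase hj
      have a3 : j ≠ n := fun h => h3 j (mem_of_mem_erase hj) (h ▸ hP)
      omega
    · left
      refine ⟨⟨fun j hj => ?_, h2⟩, h3⟩
      have a1 := h1 j hj
      have a2 : j ≠ n + 1 := fun h => hP (h ▸ hj)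
      omega
  · rintro (⟨⟨h1, h2⟩, h3⟩ | ⟨P, ⟨⟨h1, h2⟩, h3⟩, rfl⟩)
    · exact ⟨⟨fun j hj => (h1 j hj).trans (by omega), h2⟩, h3⟩
    · have hP : n + 1 ∉ P := fun h => by have := h1 _ h; omega
      refine ⟨⟨fun j hj => ?_, by rw [card_insert_of_notMem hP, h2]⟩, fun j hj hj' => ?_⟩
      · rcases mem_insert.1 hj with rfl | hj
        · omega
        · have := h1 j hj; omega
      · rcases mem_insert.1 hj with rfl | hj <;> rcases mem_insert.1 hj' with hj' | hj'
        · omega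
        · have := h1 _ hj'; omega
        · have := h1 _ hj; omega
        · exact h3 j hj hj'

theorem card_sparseSets (n i : ℕ) : (sparseSets n i).card = (n + 1 - i).choose i := by
  induction n using Nat.strong_induction_on generalizing i with
  | _ n ih =>
    match n, i with
    | n, 0 =>
      have : sparseSets n 0 = {∅} := by
        ext P; simp only [mem_sparseSets, mem_singleton, card_eq_zero]
        constructor
        · exact fun h => h.1.2
        · rintro rfl; simp
      simp [this]
    | 0, i + 1 =>
      have : sparseSets 0 (i + 1) = ∅ := by
        simp [sparseSets]
      simp [this]
    | 1, 1 => decide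
    | 1, i + 2 =>
      have : sparseSets 1 (i + 2) = ∅ := by
        simp [sparseSets]
      rw [this, Nat.choose_eq_zero_of_lt (by omega)]; rfl
    | n + 2, i + 1 =>
      have hdisj : Disjoint (sparseSets (n + 1) (i + 1))
          ((sparseSets n i).image (insert (n + 1))) := by
        rw [Finset.disjoint_left]
        intro P hP hP'
        obtain ⟨Q, -, rfl⟩ := mem_image.1 hP'
        have := (mem_sparseSets.1 hP).1.1 (n + 1) (mem_insert_self _ _)
        omega
      rw [sparseSets_succ_succ, card_union_of_disjoint hdisj, card_image_of_injOn, ih _ (by omega),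
        ih _ (by omega)]
      · rcases Nat.lt_or_ge (n + 1) i with h | h
        · rw [Nat.choose_eq_zero_of_lt (by omega), Nat.choose_eq_zero_of_lt (by omega),
            Nat.choose_eq_zero_of_lt (by omega)]
        · rw [show n + 2 + 1 - (i + 1) = (n + 1 - i) + 1 by omega,
            show n + 1 + 1 - (i + 1) = n + 1 - i by omega, Nat.choose_succ_succ, add_comm]
      · intro P hP Q hQ h
        have hP' : n + 1 ∉ P := fun h => by have := (mem_sparseSets.1 hP).1.1 _ h; omega
        have hQ' : n + 1 ∉ Q := fun h => by have := (mem_sparseSets.1 hQ).1.1 _ h; omega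
        rw [← erase_insert hP', ← erase_insert hQ']
        exact congrArg (fun R => erase R (n + 1)) h

/-- The `i`-element subsets of the cycle `Fin (m + 3)` without two consecutive elements. -/
def cyclicSparseSets (m i : ℕ) : Finset (Finset (Fin (m + 3))) :=
  (univ.powersetCard i).filter fun P => ∀ j ∈ P, j + 1 ∉ P

theorem mem_cyclicSparseSets {m i : ℕ} {P : Finset (Fin (m + 3))} :
    P ∈ cyclicSparseSets m i ↔ P.card = i ∧ ∀ j ∈ P, j + 1 ∉ P := by
  simp [cyclicSparseSets, mem_powersetCard]

/-- Cut the cycle at the top position `m + 2`. Sets without it are sparse sets of a path. Sets with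
it avoid both neighbours `m + 1` and `0`, so the rest lies in `{1, …, m}` and is shifted to start at
`0`. -/
theorem cyclicSparseSets_map (m i : ℕ) :
    (cyclicSparseSets m (i + 1)).image (fun P => P.map Fin.valEmbedding)
      = sparseSets (m + 2) (i + 1) ∪
        (sparseSets m i).image fun P => insert (m + 2) (P.map (addRightEmbedding 1)) := by
  ext P
  simp only [mem_union, mem_image, mem_sparseSets, mem_cyclicSparseSets]
  have memval : ∀ (R : Finset (Fin (m + 3))) (j : ℕ), j ∈ R.map Fin.valEmbedding ↔
      ∃ h : j < m + 3, (⟨j, h⟩ : Fin (m + 3)) ∈ R := by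
    intro R j
    simp only [mem_map, Fin.valEmbedding_apply]
    constructor
    · rintro ⟨a, ha, rfl⟩; exact ⟨a.2, ha⟩
    · rintro ⟨h, hR⟩; exact ⟨_, hR, rfl⟩
  have succ_lt : ∀ (j : ℕ) (h : j < m + 3) (h' : j + 1 < m + 3),
      (⟨j, h⟩ : Fin (m + 3)) + 1 = ⟨j + 1, h'⟩ := by
    intro j h h'
    apply Fin.ext
    rw [Fin.val_add_one, if_neg]
    intro h2; have := Fin.ext_iff.1 h2; simp at this; omega
  have succ_last : ∀ (h : m + 2 < m + 3), (⟨m + 2, h⟩ : Fin (m + 3)) + 1 = 0 := by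
    intro h; exact Fin.last_add_one (m + 2)
  constructor
  · rintro ⟨R, ⟨h1, h2⟩, rfl⟩
    have h3 : ∀ j ∈ R.map Fin.valEmbedding, j + 1 ∉ R.map Fin.valEmbedding := by
      intro j hj hj'
      obtain ⟨a, ha⟩ := (memval _ _).1 hj
      obtain ⟨b, hb⟩ := (memval _ _).1 hj'
      exact h2 _ ha (by rwa [succ_lt j a b])
    have h4 : ∀ j ∈ R.map Fin.valEmbedding, j < m + 3 := fun j hj => ((memval _ _).1 hj).1
    by_cases hR : m + 2 ∈ R.map Fin.valEmbedding
    · right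
      -- The position `0` follows `m + 2` on the cycle.
      have h0 : 0 ∉ R.map Fin.valEmbedding := by
        intro h
        obtain ⟨a, ha⟩ := (memval _ _).1 hR
        obtain ⟨b, hb⟩ := (memval _ _).1 h
        exact h2 _ ha (by rwa [succ_last])
      have hQ : ((R.map Fin.valEmbedding).erase (m + 2)) = (((R.map Fin.valEmbedding).erase
          (m + 2)).image (fun j => j - 1)).map (addRightEmbedding 1) := by
        ext j
        simp only [mem_map, mem_image, addRightEmbedding_apply]
        constructor
        · intro hj
          refine ⟨j - 1, ⟨j, hj, rfl⟩, ?_⟩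
          have : j ≠ 0 := fun h => h0 (h ▸ mem_of_mem_erase hj)
          omega
        · rintro ⟨_, ⟨a, ha, rfl⟩, rfl⟩
          have : a ≠ 0 := fun h => h0 (h ▸ mem_of_mem_erase ha)
          rwa [Nat.sub_add_cancel (by omega)]
      have hQmem : ∀ j, j ∈ ((R.map Fin.valEmbedding).erase (m + 2)).image (fun j => j - 1) ↔
          j + 1 ∈ (R.map Fin.valEmbedding).erase (m + 2) := by
        intro j
        conv_rhs => rw [hQ]
        simp
      refine ⟨((R.map Fin.valEmbedding).erase (m + 2)).image (fun j => j - 1),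
        ⟨⟨fun j hj => ?_, ?_⟩, fun j hj hj' => ?_⟩, ?_⟩
      · rw [hQmem] at hj
        have a1 := h4 _ (mem_of_mem_erase hj)
        have a2 := ne_of_mem_erase hj
        have a3 : j + 1 ≠ m + 1 := fun h => h3 _ (mem_of_mem_erase hj) (by rw [h]; exact hR)
        omega
      · rw [← card_map (addRightEmbedding 1), ← hQ, card_erase_of_mem hR, card_map, h1]; rfl
      · rw [hQmem] at hj hj'
        exact h3 _ (mem_of_mem_erase hj) (mem_of_mem_erase hj')
      · rw [← hQ, insert_erase hR]
    · left
      refine ⟨⟨fun j hj => ?_, by rw [card_map, h1]⟩, h3⟩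
      have a1 := h4 j hj
      have a2 : j ≠ m + 2 := fun h => hR (h ▸ hj)
      omega
  · intro h
    have key : (∀ j ∈ P, j < m + 3) ∧ P.card = i + 1 ∧ (∀ j ∈ P, j + 1 ∉ P) ∧
        ¬ (m + 2 ∈ P ∧ 0 ∈ P) := by
      rcases h with ⟨⟨h1, h2⟩, h3⟩ | ⟨P, ⟨⟨h1, h2⟩, h3⟩, rfl⟩
      · exact ⟨fun j hj => (h1 j hj).trans (by omega), h2, h3, fun h => by
          have := h1 _ h.1; omega⟩
      · have mem : ∀ j, j ∈ P.map (addRightEmbedding 1) ↔ ∃ a ∈ P, a + 1 = j := by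
          intro j; simp
        have hP : m + 2 ∉ P.map (addRightEmbedding 1) := by
          rw [mem]; rintro ⟨a, ha, h⟩; have := h1 a ha; omega
        refine ⟨fun j hj => ?_, by rw [card_insert_of_notMem hP, card_map, h2],
          fun j hj hj' => ?_, fun h => ?_⟩
        · rcases mem_insert.1 hj with rfl | hj
          · omega
          · obtain ⟨a, ha, rfl⟩ := (mem _).1 hj
            have := h1 a ha; omega
        · rcases mem_insert.1 hj with rfl | hj <;> rcases mem_insert.1 hj' with hj' | hj'
          · omega
          · obtain ⟨a, ha, h⟩ := (mem _).1 hj'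
            have := h1 a ha; omega
          · obtain ⟨a, ha, h⟩ := (mem _).1 hj
            have := h1 a ha; omega
          · obtain ⟨a, ha, h⟩ := (mem _).1 hj
            obtain ⟨b, hb, h'⟩ := (mem _).1 hj'
            exact h3 a ha (by rwa [show a + 1 = b by omega])
        · rcases mem_insert.1 h.2 with h' | h'
          · omega
          · obtain ⟨a, ha, h⟩ := (mem _).1 h'
            omega
    obtain ⟨h1, h2, h3, h4⟩ := key
    have hmap : (univ.filter fun j : Fin (m + 3) => j.val ∈ P).map Fin.valEmbedding = P := by
      ext j
      rw [memval]
      simp only [mem_filter, mem_univ, true_and]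
      exact ⟨fun h => h.2, fun h => ⟨h1 j h, h⟩⟩
    refine ⟨univ.filter fun j : Fin (m + 3) => j.val ∈ P, ⟨?_, fun j hj hj' => ?_⟩, hmap⟩
    · rw [← card_map Fin.valEmbedding, hmap, h2]
    · simp only [mem_filter, mem_univ, true_and] at hj hj'
      rw [Fin.val_add_one] at hj'
      split_ifs at hj' with h
      · rw [h, Fin.val_last] at hj
        exact h4 ⟨hj, hj'⟩
      · exact h3 _ hj hj'

theorem card_cyclicSparseSets_zero (m : ℕ) : (cyclicSparseSets m 0).card = 1 := by
  have : cyclicSparseSets m 0 = {∅} := by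
    ext P
    simp only [mem_cyclicSparseSets, mem_singleton, card_eq_zero]
    constructor
    · exact fun h => h.1
    · rintro rfl; simp
  simp [this]

theorem card_cyclicSparseSets_succ (m i : ℕ) :
    (cyclicSparseSets m (i + 1)).card = (m + 2 - i).choose (i + 1) + (m + 1 - i).choose i := by
  have h1 : (cyclicSparseSets m (i + 1)).card
      = ((cyclicSparseSets m (i + 1)).image (fun P => P.map Fin.valEmbedding)).card :=
    (card_image_of_injective _ (Finset.map_injective _)).symm
  have mem_succ : ∀ P ∈ sparseSets m i, m + 2 ∉ P.map (addRightEmbedding 1) := by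
    intro P hP h
    simp only [mem_map, addRightEmbedding_apply] at h
    obtain ⟨a, ha, h⟩ := h
    have := (mem_sparseSets.1 hP).1.1 a ha
    omega
  have hdisj : Disjoint (sparseSets (m + 2) (i + 1))
      ((sparseSets m i).image fun P => insert (m + 2) (P.map (addRightEmbedding 1))) := by
    rw [Finset.disjoint_left]
    intro P hP hP'
    obtain ⟨Q, -, rfl⟩ := mem_image.1 hP'
    have := (mem_sparseSets.1 hP).1.1 (m + 2) (mem_insert_self _ _)
    omega
  rw [h1, cyclicSparseSets_map, card_union_of_disjoint hdisj, card_sparseSets,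
    card_image_of_injOn, card_sparseSets]
  · rw [show m + 2 + 1 - (i + 1) = m + 2 - i by omega]
  · intro P hP Q hQ h
    have h2 := congrArg (fun R => erase R (m + 2)) h
    simp only [erase_insert (mem_succ P hP), erase_insert (mem_succ Q hQ)] at h2
    exact Finset.map_injective _ h2

/-- The classical count `N / (N - i) * (N - i choose i)` on a cycle of length `N = m + 3`, with `d =
N - i` and the denominator cleared. -/
theorem mul_card_cyclicSparseSets {m i d : ℕ} (h : m + 3 = i + d) (hd : 0 < d) :
    d * (cyclicSparseSets m i).card = (m + 3) * d.choose i := by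
  cases i with
  | zero => rw [card_cyclicSparseSets_zero]; simp; omega
  | succ i =>
    obtain ⟨d, rfl⟩ := Nat.exists_eq_add_of_lt hd
    rw [card_cyclicSparseSets_succ, show m + 2 - i = 0 + d + 1 by omega,
      show m + 1 - i = d by omega, h, zero_add]
    have := Nat.add_one_mul_choose_eq d i
    rw [mul_add, this]; ring

/-- The recursion for the numbers of `i`-element subsets of a cycle without two consecutive
elements. -/
theorem card_cyclicSparseSets_recursion {m i d : ℕ} (h : m + 3 = 2 * i + 1 + d) :
    (i + 1) * ((i + d) * (cyclicSparseSets m (i + 1)).card)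
      = (d + 1) * d * (cyclicSparseSets m i).card := by
  rcases Nat.eq_zero_or_pos (i + d) with h0 | h0
  · omega
  rw [mul_card_cyclicSparseSets (d := i + d) (by omega) h0]
  have h1 := mul_card_cyclicSparseSets (m := m) (i := i) (d := i + d + 1) (by omega) (by omega)
  have h2 := Nat.choose_mul_succ_eq (i + d) i
  have h3 := Nat.choose_succ_right_eq (i + d) i
  rw [show i + d + 1 - i = d + 1 by omega] at h2
  rw [show i + d - i = d by omega] at h3
  apply Nat.eq_of_mul_eq_mul_left (show 0 < i + d + 1 by omega)
  calc (i + d + 1) * ((i + 1) * ((m + 3) * (i + d).choose (i + 1)))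
      = (i + d + 1) * (m + 3) * ((i + d).choose (i + 1) * (i + 1)) := by ring
    _ = (m + 3) * d * ((i + d).choose i * (i + d + 1)) := by rw [h3]; ring
    _ = d * (d + 1) * ((m + 3) * (i + d + 1).choose i) := by rw [h2]; ring
    _ = (i + d + 1) * ((d + 1) * d * (cyclicSparseSets m i).card) := by rw [← h1]; ring

theorem cyclicSparseSets_eq_empty {m i : ℕ} (h : m + 3 < 2 * i) : cyclicSparseSets m i = ∅ := by
  obtain ⟨i, rfl⟩ : ∃ i', i = i' + 1 := ⟨i - 1, by omega⟩
  rw [← card_eq_zero, card_cyclicSparseSets_succ, Nat.choose_eq_zero_of_lt (by omega),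
    Nat.choose_eq_zero_of_lt (by omega)]

end NonconsecutiveSets

/-! ### Cyclic arrangements of the vertices and their hits with a matching. -/

noncomputable section

section Arrangements

open Finset

variable {W : Type*} [Fintype W]

/-- The arrangements of the vertices on a cycle for which consecutive vertices are adjacent. -/
structure Arrangement (G : SimpleGraph W) (m : ℕ) where
  toEquiv : Fin (m + 3) ≃ W
  adj : ∀ j, G.Adj (toEquiv j) (toEquiv (j + 1))

theorem Arrangement.toEquiv_injective {W : Type*} {G : SimpleGraph W} {m : ℕ} :
    Function.Injective (Arrangement.toEquiv : Arrangement G m → _) := by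
  rintro ⟨σ, _⟩ ⟨τ, _⟩ h
  congr

instance (G : SimpleGraph W) (m : ℕ) : Finite (Arrangement G m) :=
  Finite.of_injective _ Arrangement.toEquiv_injective

instance (G : SimpleGraph W) (m : ℕ) : Fintype (Arrangement G m) := Fintype.ofFinite _

theorem fin_one_add_one_ne_zero (m : ℕ) : (1 : Fin (m + 3)) + 1 ≠ 0 := by
  intro h
  have h1 := Fin.ext_iff.1 h
  rw [Fin.val_add, Fin.val_one, Fin.val_zero, Nat.mod_eq_of_lt (by omega)] at h1
  omega

theorem cycleGraph_map_le {W : Type*} {G : SimpleGraph W} {m : ℕ} {σ : Fin (m + 3) ≃ W}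
    (hσ : ∀ j, G.Adj (σ j) (σ (j + 1))) :
    (SimpleGraph.cycleGraph (m + 3)).map σ.toEmbedding ≤ G := by
  rw [SimpleGraph.map_le_iff_le_comap]
  intro a b h
  rw [SimpleGraph.cycleGraph_adj] at h
  rw [SimpleGraph.comap_adj]
  rcases h with h | h
  · rw [sub_eq_iff_eq_add] at h
    have := hσ b
    rw [h, add_comm 1 b]; exact this.symm
  · rw [sub_eq_iff_eq_add] at h
    have := hσ a
    rw [h, add_comm 1 a]; exact this

/-- The hamiltonian cycle of an arrangement. -/
def Arrangement.toHamCycle {G : SimpleGraph W} {m : ℕ} (hm : Fintype.card W = m + 3)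
    (σ : Arrangement G m) : HamCycle G :=
  ⟨(SimpleGraph.cycleGraph (m + 3)).map σ.toEquiv.toEmbedding, cycleGraph_map_le σ.adj, by omega,
    by rw [hm]; exact ⟨SimpleGraph.Iso.map σ.toEquiv _⟩⟩

theorem Arrangement.graph_toHamCycle {G : SimpleGraph W} {m : ℕ} (hm : Fintype.card W = m + 3)
    (σ : Arrangement G m) : (σ.toHamCycle hm).graph
      = (SimpleGraph.cycleGraph (m + 3)).map σ.toEquiv.toEmbedding := rfl

theorem Arrangement.adj_toHamCycle {G : SimpleGraph W} {m : ℕ} (hm : Fintype.card W = m + 3)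
    (σ : Arrangement G m) (a b : Fin (m + 3)) :
    (σ.toHamCycle hm).graph.Adj (σ.toEquiv a) (σ.toEquiv b) ↔ a - b = 1 ∨ b - a = 1 := by
  rw [Arrangement.graph_toHamCycle, ← SimpleGraph.cycleGraph_adj]
  exact SimpleGraph.map_adj_apply (f := σ.toEquiv.toEmbedding)

/-- The arrangements of one cycle are the isomorphisms from the standard cycle onto it. Comparison
with a fixed one makes them a torsor under the automorphisms, so all fibres have the same size. -/
theorem card_arrangement_fiber {G : SimpleGraph W} {m : ℕ} (hm : Fintype.card W = m + 3)
    (u : HamCycle G) : Nat.card {σ : Arrangement G m // σ.toHamCycle hm = u}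
      = Nat.card (SimpleGraph.cycleGraph (m + 3) ≃g SimpleGraph.cycleGraph (m + 3)) := by
  obtain ⟨e₀⟩ := u.exists_iso hm
  have map_adj_trans : ∀ (f : SimpleGraph.cycleGraph (m + 3) ≃g SimpleGraph.cycleGraph (m + 3))
      {a b}, u.graph.Adj ((f.trans e₀) a) ((f.trans e₀) b) ↔
        (SimpleGraph.cycleGraph (m + 3)).Adj a b := fun f {a b} => (f.trans e₀).map_rel_iff
  have hiso : ∀ σ : Arrangement G m, σ.toHamCycle hm = u → ∀ a b,
      u.graph.Adj (σ.toEquiv a) (σ.toEquiv b) ↔ (SimpleGraph.cycleGraph (m + 3)).Adj a b := by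
    rintro σ rfl a b
    rw [Arrangement.adj_toHamCycle, SimpleGraph.cycleGraph_adj]
  refine Nat.card_congr
    { toFun := fun σ => RelIso.trans (⟨σ.1.toEquiv, fun {a b} => hiso σ.1 σ.2 a b⟩ :
          SimpleGraph.cycleGraph (m + 3) ≃g u.graph) e₀.symm
      invFun := fun f => ⟨⟨(f.trans e₀).toEquiv, fun j => u.graph_le
          ((map_adj_trans f).2 ?_)⟩, ?_⟩
      left_inv := fun σ => ?_
      right_inv := fun f => ?_ }
  · rw [SimpleGraph.cycleGraph_adj]; right; abel
  · apply HamCycle.ext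
    rw [Arrangement.graph_toHamCycle]
    ext x y
    obtain ⟨a, rfl⟩ := (f.trans e₀).toEquiv.surjective x
    obtain ⟨b, rfl⟩ := (f.trans e₀).toEquiv.surjective y
    have h1 := map_adj_trans f (a := a) (b := b)
    refine Iff.trans ?_ h1.symm
    exact SimpleGraph.map_adj_apply (f := (f.trans e₀).toEquiv.toEmbedding)
  · apply Subtype.ext; apply Arrangement.toEquiv_injective; ext x
    exact e₀.apply_symm_apply _
  · ext x
    exact congrArg _ (e₀.symm_apply_apply _)

/-- The average over the hamiltonian cycles is the average over the arrangements. -/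
theorem unifIntegral_toHamCycle {G : SimpleGraph W} {m : ℕ} (hm : Fintype.card W = m + 3)
    (f : HamCycle G → ℝ) :
    unifIntegral f = unifIntegral fun σ : Arrangement G m => f (σ.toHamCycle hm) := by
  classical
  set K := Nat.card (SimpleGraph.cycleGraph (m + 3) ≃g SimpleGraph.cycleGraph (m + 3)) with hK
  have hK0 : (K : ℝ) ≠ 0 := by
    have : Nonempty (SimpleGraph.cycleGraph (m + 3) ≃g SimpleGraph.cycleGraph (m + 3)) :=
      ⟨RelIso.refl _⟩
    have : Finite (SimpleGraph.cycleGraph (m + 3) ≃g SimpleGraph.cycleGraph (m + 3)) :=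
      Finite.of_injective _ (RelIso.toEquiv_injective)
    exact_mod_cast Nat.card_pos.ne'
  have key : ∀ f : HamCycle G → ℝ, ∑ σ : Arrangement G m, f (σ.toHamCycle hm) = K * ∑ u, f u := by
    intro f
    rw [← Finset.sum_fiberwise univ (fun σ : Arrangement G m => σ.toHamCycle hm), Finset.mul_sum]
    refine Finset.sum_congr rfl fun u _ => ?_
    rw [Finset.sum_congr rfl (g := fun _ => f u) fun σ hσ => by rw [(mem_filter.1 hσ).2],
      Finset.sum_const, nsmul_eq_mul]
    congr 2
    rw [hK, ← card_arrangement_fiber hm u, Nat.card_eq_fintype_card, Fintype.card_subtype]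
  have hcard := key fun _ => 1
  simp only [sum_const, card_univ, nsmul_eq_mul, mul_one] at hcard
  unfold unifIntegral
  rw [key, hcard, smul_eq_mul, smul_eq_mul, mul_inv]
  field_simp

open Classical in
/-- The positions at which an arrangement uses an edge `{x, i x}`. -/
def hits {m : ℕ} (i : W → W) (σ : Fin (m + 3) ≃ W) : Finset (Fin (m + 3)) :=
  univ.filter fun j => i (σ j) = σ (j + 1)

theorem mem_hits {W : Type*} {m : ℕ} {i : W → W} {σ : Fin (m + 3) ≃ W} {j : Fin (m + 3)} :
    j ∈ hits i σ ↔ i (σ j) = σ (j + 1) := by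
  simp [hits]

theorem add_one_notMem_hits {W : Type*} {m : ℕ} {i : W → W} (hi : ∀ x, i (i x) = x) {σ : Fin (m + 3) ≃ W}
    {j : Fin (m + 3)} (hj : j ∈ hits i σ) : j + 1 ∉ hits i σ := by
  rw [mem_hits] at *
  intro h
  rw [← hj, hi] at h
  have h1 := σ.injective h
  rw [add_assoc, left_eq_add] at h1
  exact fin_one_add_one_ne_zero m h1

/-- A matched edge of the cycle joins consecutive positions and is seen from both ends, once as a
hit at `j` and once as a hit at `j - 1`; the factor `1 / 2` compensates. -/
theorem matchCount_toHamCycle {G : SimpleGraph W} {m : ℕ} (hm : Fintype.card W = m + 3)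
    {i : W → W} (hi : ∀ x, i (i x) = x) (σ : Arrangement G m) :
    matchCount G i (σ.toHamCycle hm) = (hits i σ.toEquiv).card := by
  classical
  -- Because the cycle has at least three positions, the successor and the predecessor of a position
  -- differ, so the two indicators never overlap.
  have hone : (1 : Fin (m + 3)) ≠ -1 := by
    intro h
    exact fin_one_add_one_ne_zero m (by nth_rewrite 1 [h]; simp)
  have h1 : ∀ j : Fin (m + 3), cycleMatrix G (σ.toHamCycle hm) (σ.toEquiv j) (i (σ.toEquiv j))
      = (if i (σ.toEquiv j) = σ.toEquiv (j + 1) then 1 else 0) +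
        (if i (σ.toEquiv (j - 1)) = σ.toEquiv (j - 1 + 1) then 1 else 0) := by
    intro j
    obtain ⟨b, hb⟩ := σ.toEquiv.surjective (i (σ.toEquiv j))
    rw [cycleMatrix_apply, ← hb]
    have e1 : (σ.toEquiv b = σ.toEquiv (j + 1)) ↔ b - j = 1 := by
      rw [σ.toEquiv.injective.eq_iff, sub_eq_iff_eq_add, add_comm j 1]
    have e2 : (i (σ.toEquiv (j - 1)) = σ.toEquiv (j - 1 + 1)) ↔ j - b = 1 := by
      rw [sub_add_cancel]
      constructor
      · intro h
        rw [← h, hi] at hb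
        rw [σ.toEquiv.injective hb]; abel
      · intro h
        rw [← h, sub_sub_cancel, hb, hi]
    rw [if_congr (Arrangement.adj_toHamCycle hm σ j b) rfl rfl, if_congr e1 rfl rfl,
      if_congr e2 rfl rfl]
    by_cases c1 : j - b = 1
    · have c2 : b - j ≠ 1 := by
        rw [← neg_sub, c1]; exact hone.symm
      simp [c1, c2]
    · simp [c1]
  rw [matchCount, ← Equiv.sum_comp σ.toEquiv, Finset.sum_congr rfl fun j _ => h1 j, sum_add_distrib]
  have h2 := (Equiv.subRight (1 : Fin (m + 3))).sum_comp
    (fun j => if i (σ.toEquiv j) = σ.toEquiv (j + 1) then (1 : ℝ) else 0)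
  simp only [Equiv.subRight_apply] at h2
  rw [h2, sum_boole, hits]
  ring

/-- Swapping positions that are not involved in the hits at `P` keeps these hits. -/
theorem subset_hits_swap {W : Type*} {m : ℕ} {i : W → W} {σ : Fin (m + 3) ≃ W} {P : Finset (Fin (m + 3))}
    (hP : P ⊆ hits i σ) {b b' : Fin (m + 3)} (hb : b ∉ P ∧ b - 1 ∉ P)
    (hb' : b' ∉ P ∧ b' - 1 ∉ P) : P ⊆ hits i ((Equiv.swap b b').trans σ) := by
  intro j hj
  have h1 := mem_hits.1 (hP hj)
  have aux : ∀ c, (c ∉ P ∧ c - 1 ∉ P) → j ≠ c ∧ j + 1 ≠ c := by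
    intro c hc
    refine ⟨fun h => hc.1 (h ▸ hj), fun h => hc.2 ?_⟩
    rw [← h, add_sub_cancel_right]; exact hj
  rw [mem_hits, Equiv.trans_apply, Equiv.trans_apply,
    Equiv.swap_apply_of_ne_of_ne (aux b hb).1 (aux b' hb').1,
    Equiv.swap_apply_of_ne_of_ne (aux b hb).2 (aux b' hb').2, h1]

open Classical in
/-- The number of arrangements with hits at `P`. -/
def hitCount (G : SimpleGraph W) (m : ℕ) (i : W → W) (P : Finset (Fin (m + 3))) : ℕ :=
  (univ.filter fun σ : Arrangement G m => P ⊆ hits i σ.toEquiv).card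

/-- The arrangement that results from exchanging the vertices at two positions. -/
def Arrangement.swap {G : SimpleGraph W} {m : ℕ} (σ : Arrangement G m) (b b' : Fin (m + 3))
    (h : ∀ j, G.Adj (((Equiv.swap b b').trans σ.toEquiv) j) (((Equiv.swap b b').trans σ.toEquiv) (j + 1))) :
    Arrangement G m := ⟨(Equiv.swap b b').trans σ.toEquiv, h⟩

/-- The set `A c` holds the positions where the partner of the vertex at `c` can stand. If the hits
at `P` are already there, the partner is at some position `b` of `A c` not used by `P`. Swapping `b`
with `c + 1` turns this into a hit at `c` without disturbing `P`, and the swap is reversible. So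
each admissible `b` accounts for the same number of arrangements. -/
theorem hitCount_insert {W : Type*} {G : SimpleGraph W} {m : ℕ} {i : W → W} (hi : ∀ x, i (i x) = x)
    (A : Fin (m + 3) → Finset (Fin (m + 3)))
    (hA : ∀ (σ : Arrangement G m) c, i (σ.toEquiv c) ≠ σ.toEquiv c → σ.toEquiv.symm (i (σ.toEquiv c)) ∈ A c)
    (hA₁ : ∀ c, c ∉ A c) (hA₂ : ∀ c, c + 1 ∈ A c)
    (hswap : ∀ c, ∀ b ∈ A c, ∀ b' ∈ A c, ∀ σ : Arrangement G m, ∀ j,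
      G.Adj (((Equiv.swap b b').trans σ.toEquiv) j) (((Equiv.swap b b').trans σ.toEquiv) (j + 1)))
    {P : Finset (Fin (m + 3))} {c : Fin (m + 3)} (hc : c ∉ P)
    (hP : ∀ j ∈ insert c P, j + 1 ∉ insert c P) :
    ((A c).filter fun b => b ∉ P ∧ b - 1 ∉ P).card * hitCount G m i (insert c P)
      = Nat.card {σ : Arrangement G m // P ⊆ hits i σ.toEquiv ∧ i (σ.toEquiv c) ≠ σ.toEquiv c} := by
  classical
  set B := (A c).filter fun b => b ∉ P ∧ b - 1 ∉ P with hB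
  have hc1 : c + 1 ∉ P ∧ c + 1 - 1 ∉ P := by
    refine ⟨fun h => hP c (mem_insert_self _ _) (mem_insert_of_mem h), ?_⟩
    rwa [add_sub_cancel_right]
  have hcm : c - 1 ∉ P := fun h => hP _ (mem_insert_of_mem h) (by
    rw [sub_add_cancel]; exact mem_insert_self _ _)
  rw [Nat.card_eq_fintype_card, Fintype.card_subtype]
  -- Positions used by `P` hold vertices matched to each other, so a partner there would force `c`
  -- itself to be used by `P`.
  have hmaps : ∀ σ ∈ univ.filter fun σ : Arrangement G m =>
      P ⊆ hits i σ.toEquiv ∧ i (σ.toEquiv c) ≠ σ.toEquiv c, σ.toEquiv.symm (i (σ.toEquiv c)) ∈ B := by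
    intro σ hσ
    simp only [mem_filter, mem_univ, true_and] at hσ
    rw [hB, mem_filter]
    refine ⟨hA σ c hσ.2, fun h => ?_, fun h => ?_⟩
    · have h1 := mem_hits.1 (hσ.1 h)
      rw [Equiv.apply_symm_apply, hi] at h1
      have h2 := σ.toEquiv.injective h1
      apply hcm
      rw [h2, add_sub_cancel_right]; exact h
    · have h1 := mem_hits.1 (hσ.1 h)
      rw [sub_add_cancel, Equiv.apply_symm_apply] at h1
      have h2 := σ.toEquiv.injective ((Function.LeftInverse.injective hi) h1)
      exact hc (h2 ▸ h)
  rw [Finset.card_eq_sum_card_fiberwise hmaps, ← smul_eq_mul, ← Finset.sum_const]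
  refine Finset.sum_congr rfl fun b hb => ?_
  obtain ⟨hbA, hbP⟩ := mem_filter.1 hb
  have hcb : c ≠ b := fun h => hA₁ c (h ▸ hbA)
  have hcc : c ≠ c + 1 := fun h => hA₁ c (by
    have := hA₂ c
    rwa [← h] at this)
  have swap_c : Equiv.swap b (c + 1) c = c := Equiv.swap_apply_of_ne_of_ne hcb hcc
  unfold hitCount
  refine Finset.card_bij (fun σ _ => σ.swap b (c + 1) (hswap c b hbA _ (hA₂ c) σ)) ?_ ?_ ?_
  · intro σ hσ
    simp only [mem_filter, mem_univ, true_and] at hσ ⊢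
    have h0 := mem_hits.1 (hσ (mem_insert_self _ _))
    have h1 : i (((Equiv.swap b (c + 1)).trans σ.toEquiv) c) = σ.toEquiv (c + 1) := by
      rw [Equiv.trans_apply, swap_c, h0]
    refine ⟨⟨subset_hits_swap (fun j hj => hσ (mem_insert_of_mem hj)) hbP hc1, ?_⟩, ?_⟩
    · change i (((Equiv.swap b (c + 1)).trans σ.toEquiv) c) ≠ ((Equiv.swap b (c + 1)).trans σ.toEquiv) c
      rw [h1, Equiv.trans_apply, swap_c]
      exact fun h => hcc (σ.toEquiv.injective h).symm
    · change ((Equiv.swap b (c + 1)).trans σ.toEquiv).symm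
        (i (((Equiv.swap b (c + 1)).trans σ.toEquiv) c)) = b
      rw [h1, Equiv.symm_apply_eq, Equiv.trans_apply, Equiv.swap_apply_left]
  · intro σ _ τ _ h
    apply Arrangement.toEquiv_injective
    have h1 : (Equiv.swap b (c + 1)).trans σ.toEquiv = (Equiv.swap b (c + 1)).trans τ.toEquiv :=
      congrArg Arrangement.toEquiv h
    ext j
    have := congrArg (fun e : Fin (m + 3) ≃ W => e (Equiv.swap b (c + 1) j)) h1
    simpa using this
  · intro τ hτ
    simp only [mem_filter, mem_univ, true_and] at hτ
    refine ⟨τ.swap b (c + 1) (hswap c b hbA _ (hA₂ c) τ), ?_, ?_⟩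
    · simp only [mem_filter, mem_univ, true_and]
      refine insert_subset ?_ (subset_hits_swap hτ.1.1 hbP hc1)
      rw [mem_hits]
      change i (((Equiv.swap b (c + 1)).trans τ.toEquiv) c)
        = ((Equiv.swap b (c + 1)).trans τ.toEquiv) (c + 1)
      rw [Equiv.trans_apply, Equiv.trans_apply, swap_c, Equiv.swap_apply_right,
        ← hτ.2, Equiv.apply_symm_apply]
    · apply Arrangement.toEquiv_injective
      change (Equiv.swap b (c + 1)).trans ((Equiv.swap b (c + 1)).trans τ.toEquiv) = τ.toEquiv
      ext j; simp

end Arrangements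

end

/-! ### Binomial moments of the number of matching edges. -/

noncomputable section

section FactorialMoments

open Finset

/-- The sequence `μ_i` with `μ_0 = 1` and `(i + 1) μ_{i+1} = ρ_i μ_i`. -/
def binomMoment (ρ : ℕ → ℝ) : ℕ → ℝ
  | 0 => 1
  | i + 1 => binomMoment ρ i * ρ i / (i + 1)

variable {W : Type*} [Fintype W]

/-- Double counting of pairs of an arrangement and an `l`-set of its hits; hits are never
consecutive, so only sparse sets occur. -/
theorem sum_choose_hits {W : Type*} {G : SimpleGraph W} {m : ℕ} {i : W → W} (hi : ∀ x, i (i x) = x) (l : ℕ) :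
    ∑ σ : Arrangement G m, (hits i σ.toEquiv).card.choose l
      = ∑ P ∈ cyclicSparseSets m l, hitCount G m i P := by
  classical
  simp only [hitCount, Finset.card_filter]
  rw [Finset.sum_comm]
  refine Finset.sum_congr rfl fun σ _ => ?_
  rw [← card_powersetCard, ← Finset.card_filter]
  congr 1
  ext P
  simp only [mem_powersetCard, mem_filter, mem_cyclicSparseSets]
  constructor
  · rintro ⟨h1, h2⟩
    exact ⟨⟨h2, fun j hj hj' => add_one_notMem_hits hi (h1 hj) (h1 hj')⟩, h1⟩
  · rintro ⟨⟨h1, h2⟩, h3⟩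
    exact ⟨h3, h1⟩

/-- The factorial moments of the number of hits. -/
theorem unifIntegral_choose_hits {W : Type*} {G : SimpleGraph W} {m : ℕ} [Nonempty (Arrangement G m)]
    {i : W → W} (hi : ∀ x, i (i x) = x) (s : ℕ → ℕ) {ρ : ℕ → ℝ}
    (hs : ∀ (P : Finset (Fin (m + 3))) (c : Fin (m + 3)), c ∉ P →
      (∀ j ∈ insert c P, j + 1 ∉ insert c P) →
      s P.card * hitCount G m i (insert c P) = hitCount G m i P)
    (hρ : ∀ l d, m + 3 = 2 * l + 1 + d → s l ≠ 0 ∧ ρ l * ((l + d) * s l) = (d + 1) * d)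
    (hρ' : ∀ l, m + 3 = 2 * l → ρ l = 0) (l : ℕ) :
    unifIntegral (fun σ : Arrangement G m => ((hits i σ.toEquiv).card.choose l : ℝ))
      = binomMoment ρ l := by
  classical
  -- Removing the hits one at a time shows that the number of arrangements with hits at a sparse `P`
  -- depends only on its size.
  have hcnt : ∀ (P : Finset (Fin (m + 3))), (∀ j ∈ P, j + 1 ∉ P) →
      (∏ l ∈ range P.card, s l) * hitCount G m i P = Fintype.card (Arrangement G m) := by
    intro P
    induction P using Finset.induction_on with
    | empty => intro _; simp [hitCount]
    | insert c P hc ih =>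
      intro hP
      rw [card_insert_of_notMem hc, prod_range_succ, mul_assoc, hs P c hc hP]
      exact ih fun j hj hj' => hP j (mem_insert_of_mem hj) (mem_insert_of_mem hj')
  have hK : (Fintype.card (Arrangement G m) : ℝ) ≠ 0 := by
    exact_mod_cast Fintype.card_ne_zero
  have hmom : ∀ l, unifIntegral (fun σ : Arrangement G m =>
      ((hits i σ.toEquiv).card.choose l : ℝ)) * ∏ l ∈ range l, (s l : ℝ)
      = (cyclicSparseSets m l).card := by
    intro l
    have h1 : (∏ l ∈ range l, s l) * ∑ σ : Arrangement G m, (hits i σ.toEquiv).card.choose l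
        = (cyclicSparseSets m l).card * Fintype.card (Arrangement G m) := by
      rw [sum_choose_hits hi, Finset.mul_sum, ← smul_eq_mul (cyclicSparseSets m l).card,
        ← Finset.sum_const]
      refine Finset.sum_congr rfl fun P hP => ?_
      obtain ⟨h2, h3⟩ := mem_cyclicSparseSets.1 hP
      rw [← hcnt P h3, h2]
    have h2 := congrArg (Nat.cast : ℕ → ℝ) h1
    push_cast at h2
    rw [unifIntegral, smul_eq_mul, mul_assoc, mul_comm _ (∏ l ∈ range l, (s l : ℝ)), h2]
    field_simp
  have hzero : ∀ l, m + 3 < 2 * l → unifIntegral (fun σ : Arrangement G m =>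
      ((hits i σ.toEquiv).card.choose l : ℝ)) = 0 := by
    intro l hl
    have h1 := sum_choose_hits (G := G) (m := m) hi l
    rw [cyclicSparseSets_eq_empty hl, sum_empty] at h1
    have h2 := congrArg (Nat.cast : ℕ → ℝ) h1
    push_cast at h2
    rw [unifIntegral, h2, smul_zero]
  induction l with
  | zero => simp [binomMoment, unifIntegral_const]
  | succ l ih =>
    rw [binomMoment, ← ih]
    -- More than half of the positions cannot be sparse. At exactly half the next moment is zero,
    -- which is why `ρ l = 0` is required; below that the counting recursion applies.
    rcases Nat.lt_trichotomy (m + 3) (2 * l) with h | h | h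
    · rw [hzero _ h, hzero _ (by omega)]; simp
    · rw [hρ' l h, hzero _ (by omega)]; simp
    · obtain ⟨d, hd⟩ := Nat.exists_eq_add_of_le (show 2 * l + 1 ≤ m + 3 by omega)
      obtain ⟨hs0, hr⟩ := hρ l d hd
      have hprod : (∏ l ∈ range l, (s l : ℝ)) ≠ 0 := by
        rw [Finset.prod_ne_zero_iff]
        intro a ha
        have := mem_range.1 ha
        exact_mod_cast (hρ a (d + 2 * (l - a)) (by omega)).1
      have hs0' : (s l : ℝ) ≠ 0 := by exact_mod_cast hs0
      have hrec := congrArg (Nat.cast : ℕ → ℝ) (card_cyclicSparseSets_recursion hd)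
      push_cast at hrec
      rw [← hmom, ← hmom, prod_range_succ] at hrec
      have hld : ((l : ℝ) + d) ≠ 0 := by
        have : l + d ≠ 0 := by omega
        exact_mod_cast this
      have hl1 : (l : ℝ) + 1 ≠ 0 := by positivity
      rw [eq_div_iff hl1]
      apply mul_right_cancel₀ (mul_ne_zero hprod (mul_ne_zero hld hs0'))
      rw [← hr] at hrec
      linear_combination hrec

theorem mul_choose_eq (h l : ℕ) : h * h.choose l = l * h.choose l + (l + 1) * h.choose (l + 1) := by
  have h1 := Nat.choose_succ_right_eq h l
  rcases Nat.lt_or_ge h l with h2 | h2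
  · rw [Nat.choose_eq_zero_of_lt h2, Nat.choose_eq_zero_of_lt (by omega)]; simp
  · obtain ⟨d, rfl⟩ := Nat.exists_eq_add_of_le h2
    rw [Nat.add_sub_cancel_left] at h1
    linarith

/-- Moments of a polynomial in the number of matching edges, from its binomial expansion. -/
theorem matchMoment_of_choose {G : SimpleGraph W} {m : ℕ} (hm : Fintype.card W = m + 3)
    {i : W → W} (hi : ∀ x, i (i x) = x) {ρ : ℕ → ℝ}
    (hmom : ∀ l, unifIntegral (fun σ : Arrangement G m =>
      ((hits i σ.toEquiv).card.choose l : ℝ)) = binomMoment ρ l)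
    {Q : ℝ → ℝ} {L : ℕ} {a : ℕ → ℝ}
    (hQ : ∀ h : ℕ, Q h = ∑ l ∈ range L, a l * (h.choose l : ℝ)) :
    matchMoment G i Q = ∑ l ∈ range L, a l * binomMoment ρ l ∧
    matchMoment G i (fun t => t * Q t)
      = ∑ l ∈ range L, a l * (binomMoment ρ l * (l + ρ l)) := by
  constructor
  · rw [matchMoment, unifIntegral_toHamCycle hm]
    simp only [matchCount_toHamCycle hm hi, hQ]
    rw [unifIntegral_sum]
    exact Finset.sum_congr rfl fun l _ => by rw [unifIntegral_mul_left, hmom]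
  · rw [matchMoment, unifIntegral_toHamCycle hm]
    simp only [matchCount_toHamCycle hm hi, hQ, Finset.mul_sum]
    rw [unifIntegral_sum]
    refine Finset.sum_congr rfl fun l _ => ?_
    have h1 : ∀ h : ℕ, (h : ℝ) * (a l * (h.choose l : ℝ))
        = a l * (l * (h.choose l : ℝ) + (l + 1) * (h.choose (l + 1) : ℝ)) := by
      intro h
      have := congrArg (Nat.cast : ℕ → ℝ) (mul_choose_eq h l)
      push_cast at this
      rw [← this]; ring
    simp only [h1]
    rw [unifIntegral_mul_left, unifIntegral_add, unifIntegral_mul_left, unifIntegral_mul_left,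
      hmom, hmom, binomMoment]
    field_simp

/-! ### Hits in complete and complete bipartite graphs -/

/-- Each hit occupies two positions, and sparseness keeps them disjoint. -/
theorem card_free {m : ℕ} {P : Finset (Fin (m + 3))} (hP : ∀ j ∈ P, j + 1 ∉ P) :
    (univ.filter fun b => b ∉ P ∧ b - 1 ∉ P).card + 2 * P.card = m + 3 := by
  classical
  have h1 : (univ.filter fun b => b ∉ P ∧ b - 1 ∉ P)
      = (P ∪ P.map (addRightEmbedding 1))ᶜ := by
    ext b
    simp only [mem_filter, mem_univ, true_and, mem_compl, mem_union, mem_map,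
      addRightEmbedding_apply, not_or, not_exists, not_and]
    refine and_congr_right fun _ => ⟨fun h a ha hab => h ?_, fun h hb => h _ hb (by abel)⟩
    rw [← hab, add_sub_cancel_right]; exact ha
  have h2 : Disjoint P (P.map (addRightEmbedding 1)) := by
    rw [Finset.disjoint_left]
    intro b hb hb'
    obtain ⟨a, ha, rfl⟩ := mem_map.1 hb'
    exact hP a ha hb
  have h3 := card_compl_add_card (P ∪ P.map (addRightEmbedding 1))
  rw [card_union_of_disjoint h2, card_map, Fintype.card_fin, ← h1] at h3
  omega

theorem card_free_erase {m : ℕ} {P : Finset (Fin (m + 3))} {c : Fin (m + 3)} (hc : c ∉ P)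
    (hP : ∀ j ∈ insert c P, j + 1 ∉ insert c P) :
    ((univ.erase c).filter fun b => b ∉ P ∧ b - 1 ∉ P).card + 1
      = (univ.filter fun b => b ∉ P ∧ b - 1 ∉ P).card := by
  have h1 : ((univ.erase c).filter fun b => b ∉ P ∧ b - 1 ∉ P)
      = (univ.filter fun b => b ∉ P ∧ b - 1 ∉ P).erase c := by
    ext b; simp only [mem_filter, mem_erase, mem_univ, and_true, true_and]
  rw [h1, card_erase_add_one]
  simp only [mem_filter, mem_univ, true_and]
  refine ⟨hc, fun h => hP _ (mem_insert_of_mem h) ?_⟩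
  rw [sub_add_cancel]; exact mem_insert_self _ _

theorem one_le_card_free_erase {m : ℕ} {P : Finset (Fin (m + 3))} {c : Fin (m + 3)} (hc : c ∉ P)
    (hP : ∀ j ∈ insert c P, j + 1 ∉ insert c P) :
    1 ≤ ((univ.erase c).filter fun b => b ∉ P ∧ b - 1 ∉ P).card := by
  refine card_pos.2 ⟨c + 1, ?_⟩
  simp only [mem_filter, mem_erase, mem_univ, and_true]
  refine ⟨fun h => hP c (mem_insert_self _ _) (by rw [h]; exact mem_insert_self _ _),
    fun h => hP c (mem_insert_self _ _) (mem_insert_of_mem h), ?_⟩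
  rwa [add_sub_cancel_right]

theorem hitCount_insert_top {W : Type*} {m : ℕ} {i : W → W} (hi : ∀ x, i (i x) = x)
    {P : Finset (Fin (m + 3))} {c : Fin (m + 3)} (hc : c ∉ P)
    (hP : ∀ j ∈ insert c P, j + 1 ∉ insert c P) :
    ((univ.erase c).filter fun b => b ∉ P ∧ b - 1 ∉ P).card
        * hitCount (⊤ : SimpleGraph W) m i (insert c P)
      = Nat.card {σ : Arrangement (⊤ : SimpleGraph W) m //
          P ⊆ hits i σ.toEquiv ∧ i (σ.toEquiv c) ≠ σ.toEquiv c} := by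
  have hne : ∀ c : Fin (m + 3), c + 1 ≠ c := fun c h => by
    rw [add_eq_left] at h; exact one_ne_zero h
  refine hitCount_insert hi (fun c => univ.erase c) ?_ (fun c => by simp)
    (fun c => by simp) ?_ hc hP
  · intro σ c h
    simp only [mem_erase, mem_univ, and_true]
    rw [Ne, Equiv.symm_apply_eq]; exact h
  · intro c b _ b' _ σ j
    simp only [SimpleGraph.top_adj, ne_eq, EmbeddingLike.apply_eq_iff_eq]
    exact (hne j).symm

theorem hitCount_insert_top_even {W : Type*} {m : ℕ} {i : W → W} (hi : ∀ x, i (i x) = x)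
    (hi' : ∀ x, i x ≠ x) {P : Finset (Fin (m + 3))} {c : Fin (m + 3)} (hc : c ∉ P)
    (hP : ∀ j ∈ insert c P, j + 1 ∉ insert c P) :
    (m + 2 - 2 * P.card) * hitCount (⊤ : SimpleGraph W) m i (insert c P)
      = hitCount (⊤ : SimpleGraph W) m i P := by
  classical
  have h1 := hitCount_insert_top hi hc hP
  have h2 := card_free_erase hc hP
  have h3 := card_free (P := P) fun j hj hj' =>
    hP j (mem_insert_of_mem hj) (mem_insert_of_mem hj')
  rw [show m + 2 - 2 * P.card
    = ((univ.erase c).filter fun b => b ∉ P ∧ b - 1 ∉ P).card by omega, h1, hitCount,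
    Nat.card_eq_fintype_card, Fintype.card_subtype]
  simp only [hi', ne_eq, not_false_eq_true, and_true]

/-- The vertex at `c` may be the unmatched `v`, so the swap count covers only the remaining
arrangements. Moving `v` to `c` by a swap counts those with `v` at `c`, and combining the two counts
restores one uniform factor. -/
theorem hitCount_insert_top_odd {W : Type*} {m : ℕ} {i : W → W} (hi : ∀ x, i (i x) = x) {v : W}
    (hv : ∀ x, i x = x ↔ x = v) {P : Finset (Fin (m + 3))} {c : Fin (m + 3)} (hc : c ∉ P)
    (hP : ∀ j ∈ insert c P, j + 1 ∉ insert c P) :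
    (m + 3 - 2 * P.card) * hitCount (⊤ : SimpleGraph W) m i (insert c P)
      = hitCount (⊤ : SimpleGraph W) m i P := by
  classical
  have hne : ∀ c : Fin (m + 3), c + 1 ≠ c := fun c h => by
    rw [add_eq_left] at h; exact one_ne_zero h
  have h1 := hitCount_insert_top hi hc hP
  have h2 := card_free_erase hc hP
  have h3 := card_free (P := P) fun j hj hj' =>
    hP j (mem_insert_of_mem hj) (mem_insert_of_mem hj')
  have h4 := one_le_card_free_erase hc hP
  set U := univ.filter fun b => b ∉ P ∧ b - 1 ∉ P with hU
  set Z := univ.filter fun σ : Arrangement (⊤ : SimpleGraph W) m => P ⊆ hits i σ.toEquiv with hZ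
  have hcU : c ∉ P ∧ c - 1 ∉ P := by
    refine ⟨hc, fun h => hP _ (mem_insert_of_mem h) ?_⟩
    rw [sub_add_cancel]; exact mem_insert_self _ _
  have h5 : U.card * (Z.filter fun σ => σ.toEquiv c = v).card = Z.card := by
    have hmaps : ∀ σ ∈ Z, σ.toEquiv.symm v ∈ U := by
      intro σ hσ
      simp only [hZ, mem_filter, mem_univ, true_and] at hσ
      simp only [hU, mem_filter, mem_univ, true_and]
      have hvv : i v = v := (hv v).2 rfl
      refine ⟨fun h => ?_, fun h => ?_⟩
      · have := mem_hits.1 (hσ h)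
        rw [Equiv.apply_symm_apply, hvv, ← Equiv.symm_apply_eq] at this
        exact hne _ this.symm
      · have := mem_hits.1 (hσ h)
        rw [sub_add_cancel, Equiv.apply_symm_apply] at this
        have h6 : σ.toEquiv (σ.toEquiv.symm v - 1) = v := by rw [← hi (σ.toEquiv _), this, hvv]
        rw [← Equiv.eq_symm_apply, sub_eq_iff_eq_add] at h6
        exact hne _ h6.symm
    rw [Finset.card_eq_sum_card_fiberwise hmaps, ← smul_eq_mul, ← Finset.sum_const]
    refine Finset.sum_congr rfl fun b hb => ?_
    simp only [hU, mem_filter, mem_univ, true_and] at hb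
    have adj : ∀ (σ : Arrangement (⊤ : SimpleGraph W) m) (j : Fin (m + 3)),
        (⊤ : SimpleGraph W).Adj (((Equiv.swap b c).trans σ.toEquiv) j)
          (((Equiv.swap b c).trans σ.toEquiv) (j + 1)) := fun σ j => by
      simp only [SimpleGraph.top_adj, ne_eq, EmbeddingLike.apply_eq_iff_eq]
      exact (hne j).symm
    refine Finset.card_bij (fun σ _ => σ.swap b c (adj σ)) ?_ ?_ ?_
    · intro σ hσ
      simp only [hZ, mem_filter, mem_univ, true_and] at hσ ⊢
      refine ⟨subset_hits_swap hσ.1 hb hcU, ?_⟩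
      change ((Equiv.swap b c).trans σ.toEquiv).symm v = b
      rw [Equiv.symm_apply_eq, Equiv.trans_apply, Equiv.swap_apply_left, hσ.2]
    · intro σ _ τ _ h
      apply Arrangement.toEquiv_injective
      have h1 : (Equiv.swap b c).trans σ.toEquiv = (Equiv.swap b c).trans τ.toEquiv :=
        congrArg Arrangement.toEquiv h
      ext j
      have := congrArg (fun e : Fin (m + 3) ≃ W => e (Equiv.swap b c j)) h1
      simpa using this
    · intro τ hτ
      simp only [hZ, mem_filter, mem_univ, true_and] at hτ
      refine ⟨τ.swap b c (adj τ), ?_, ?_⟩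
      · simp only [hZ, mem_filter, mem_univ, true_and]
        refine ⟨subset_hits_swap hτ.1 hb hcU, ?_⟩
        change ((Equiv.swap b c).trans τ.toEquiv) c = v
        rw [Equiv.trans_apply, Equiv.swap_apply_right, ← hτ.2, Equiv.apply_symm_apply]
      · apply Arrangement.toEquiv_injective
        change (Equiv.swap b c).trans ((Equiv.swap b c).trans τ.toEquiv) = τ.toEquiv
        ext j; simp
  have h6 := Finset.card_filter_add_card_filter_not (s := Z) fun σ => σ.toEquiv c = v
  have h7 : Nat.card {σ : Arrangement (⊤ : SimpleGraph W) m //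
      P ⊆ hits i σ.toEquiv ∧ i (σ.toEquiv c) ≠ σ.toEquiv c}
      = (Z.filter fun σ => ¬ σ.toEquiv c = v).card := by
    rw [Nat.card_eq_fintype_card, Fintype.card_subtype, hZ, filter_filter]
    simp only [ne_eq, hv]
  rw [h7] at h1
  have h8 : hitCount (⊤ : SimpleGraph W) m i P = Z.card := rfl
  rw [show m + 3 - 2 * P.card = U.card by omega, h8]
  set E := ((univ.erase c).filter fun b => b ∉ P ∧ b - 1 ∉ P).card
  set X := (Z.filter fun σ => σ.toEquiv c = v).card
  set Y := hitCount (⊤ : SimpleGraph W) m i (insert c P)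
  rw [← h1, ← h5, ← h2] at h6
  -- With `E + 1` free positions, `E Y` arrangements have `v` off `c`, `X` have it at `c`, and there
  -- are `(E + 1) X` in total. As `E ≥ 1` this forces `Y = X`.
  have h9 : E * Y = E * X := by linarith
  have h10 : Y = X := Nat.eq_of_mul_eq_mul_left (by omega) h9
  rw [h10, h5]

theorem Arrangement.isLeft_add_one {V₁ V₂ : Type*} {m : ℕ}
    (σ : Arrangement (completeBipartiteGraph V₁ V₂) m) (j : Fin (m + 3)) :
    (σ.toEquiv (j + 1)).isLeft = !(σ.toEquiv j).isLeft := by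
  have := σ.adj j
  revert this
  rcases σ.toEquiv j with a | a <;> rcases σ.toEquiv (j + 1) with b | b <;> simp

/-- Sides alternate along every arrangement, so two arrangements agree on sides up to a global
exchange. Whether two positions are on the same side is thus independent of the arrangement. -/
theorem Arrangement.isLeft_eq_iff {V₁ V₂ : Type*} {m : ℕ}
    (σ τ : Arrangement (completeBipartiteGraph V₁ V₂) m) (a b : Fin (m + 3)) :
    (σ.toEquiv a).isLeft = (σ.toEquiv b).isLeft ↔ (τ.toEquiv a).isLeft = (τ.toEquiv b).isLeft := by
  have h : ∀ a : Fin (m + 2 + 1), ((σ.toEquiv a).isLeft ^^ (τ.toEquiv a).isLeft)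
      = ((σ.toEquiv 0).isLeft ^^ (τ.toEquiv 0).isLeft) := by
    intro a
    induction a using Fin.induction with
    | zero => rfl
    | succ a ih =>
      rw [← Fin.coeSucc_eq_succ, σ.isLeft_add_one, τ.isLeft_add_one, ← ih]
      cases (σ.toEquiv a.castSucc).isLeft <;> cases (τ.toEquiv a.castSucc).isLeft <;> rfl
  have := (h a).trans (h b).symm
  revert this
  cases (σ.toEquiv a).isLeft <;> cases (σ.toEquiv b).isLeft <;>
    cases (τ.toEquiv a).isLeft <;> cases (τ.toEquiv b).isLeft <;> decide

theorem hitCount_insert_bipartite {n m : ℕ} {i : Fin n ⊕ Fin n → Fin n ⊕ Fin n}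
    (hi : ∀ x, i (i x) = x) (hadj : ∀ x, (completeBipartiteGraph (Fin n) (Fin n)).Adj x (i x))
    (σ₀ : Arrangement (completeBipartiteGraph (Fin n) (Fin n)) m)
    {P : Finset (Fin (m + 3))} {c : Fin (m + 3)} (hc : c ∉ P)
    (hP : ∀ j ∈ insert c P, j + 1 ∉ insert c P) :
    (n - P.card) * hitCount (completeBipartiteGraph (Fin n) (Fin n)) m i (insert c P)
      = hitCount (completeBipartiteGraph (Fin n) (Fin n)) m i P := by
  classical
  have hleft : ∀ x, (i x).isLeft = !x.isLeft := by
    intro x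
    have := hadj x
    revert this
    rcases x with a | a <;> rcases i _ with b | b <;> simp
  -- The positions opposite to `c`; the reference arrangement `σ₀` serves only to define the parity
  -- classes.
  set A : Fin (m + 3) → Finset (Fin (m + 3)) := fun c =>
    univ.filter fun b => (σ₀.toEquiv b).isLeft ≠ (σ₀.toEquiv c).isLeft with hA
  have h1 := hitCount_insert hi A (G := completeBipartiteGraph (Fin n) (Fin n)) (P := P) (c := c)
    ?_ ?_ ?_ ?_ hc hP
  · have hne : ∀ x, i x ≠ x := fun x => (hadj x).ne'
    have hcard : ((A c).filter fun b => b ∉ P ∧ b - 1 ∉ P).card + P.card = n := by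
      have hAc : (A c).card = n := by
        have e1 : (A c).card
            = (univ.filter fun x : Fin n ⊕ Fin n => x.isLeft ≠ (σ₀.toEquiv c).isLeft).card := by
          refine Finset.card_bij (fun b _ => σ₀.toEquiv b) ?_ ?_ ?_
          · intro b hb; simpa [hA] using hb
          · intro b _ b' _ h; exact σ₀.toEquiv.injective h
          · intro x hx
            exact ⟨σ₀.toEquiv.symm x, by simpa [hA] using hx, by simp⟩
        rw [e1, Finset.card_filter, Fintype.sum_sum_type]
        cases (σ₀.toEquiv c).isLeft <;> simp
      have e2 := Finset.card_filter_add_card_filter_not (s := A c) fun b => b ∉ P ∧ b - 1 ∉ P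
      -- Each hit occupies one position on either side, so `P` blocks exactly `P.card` of the `n`
      -- opposite positions.
      have e3 : ((A c).filter fun b => ¬ (b ∉ P ∧ b - 1 ∉ P)).card = P.card := by
        symm
        refine Finset.card_bij (fun j _ => if j ∈ A c then j else j + 1) ?_ ?_ ?_
        · intro j hj
          simp only [mem_filter]
          split_ifs with h
          · exact ⟨h, fun h' => h'.1 hj⟩
          · refine ⟨?_, fun h' => h'.2 (by rwa [add_sub_cancel_right])⟩
            simp only [hA, mem_filter, mem_univ, true_and, ne_eq, not_not] at h ⊢
            rw [σ₀.isLeft_add_one, h]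
            exact (by decide : ∀ a : Bool, ¬ (!a) = a) _
        · intro j hj j' hj' h
          have n1 : j + 1 ≠ j' := fun h => hP j (mem_insert_of_mem hj)
            (h ▸ mem_insert_of_mem hj')
          have n2 : j' + 1 ≠ j := fun h => hP j' (mem_insert_of_mem hj')
            (h ▸ mem_insert_of_mem hj)
          split_ifs at h
          · exact h
          · exact absurd h.symm n2
          · exact absurd h n1
          · exact add_right_cancel h
        · intro b hb
          simp only [mem_filter, not_and_or, not_not] at hb
          by_cases hbP : b ∈ P
          · exact ⟨b, hbP, by simp [hb.1]⟩
          · have hb1 := hb.2.resolve_left hbP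
            refine ⟨b - 1, hb1, ?_⟩
            have : b - 1 ∉ A c := by
              have h2 := hb.1
              simp only [hA, mem_filter, mem_univ, true_and, ne_eq, not_not] at h2 ⊢
              have h3 := σ₀.isLeft_add_one (b - 1)
              rw [sub_add_cancel] at h3
              rw [h3] at h2
              exact (by decide : ∀ a b : Bool, ¬ (!a) = b → a = b) _ _ h2
            rw [if_neg this, sub_add_cancel]
      omega
    rw [show n - P.card = ((A c).filter fun b => b ∉ P ∧ b - 1 ∉ P).card by omega, h1, hitCount,
      Nat.card_eq_fintype_card, Fintype.card_subtype]
    simp only [hne, ne_eq, not_false_eq_true, and_true]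
  · intro σ c _
    simp only [hA, mem_filter, mem_univ, true_and]
    rw [Ne, σ₀.isLeft_eq_iff σ, Equiv.apply_symm_apply, hleft]
    exact (by decide : ∀ a : Bool, ¬ (!a) = a) _
  · intro c; simp [hA]
  · intro c
    simp only [hA, mem_filter, mem_univ, true_and]
    rw [σ₀.isLeft_add_one]
    exact (by decide : ∀ a : Bool, ¬ (!a) = a) _
  · intro c b hb b' hb' σ j
    simp only [hA, mem_filter, mem_univ, true_and] at hb hb'
    have hbb : (σ.toEquiv b).isLeft = (σ.toEquiv b').isLeft := by
      rw [σ.isLeft_eq_iff σ₀]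
      exact (by decide : ∀ a b c : Bool, a ≠ c → b ≠ c → a = b) _ _ _ hb hb'
    have hside : ∀ j, (((Equiv.swap b b').trans σ.toEquiv) j).isLeft = (σ.toEquiv j).isLeft := by
      intro j
      rw [Equiv.trans_apply, Equiv.swap_apply_def]
      split_ifs with e1 e2
      · rw [e1, hbb]
      · rw [e2, hbb]
      · rfl
    have adj_iff : ∀ x y : Fin n ⊕ Fin n, (completeBipartiteGraph (Fin n) (Fin n)).Adj x y ↔
        x.isLeft ≠ y.isLeft := by
      rintro (x | x) (y | y) <;> simp
    rw [adj_iff, hside, hside, ← adj_iff]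
    exact σ.adj j

end FactorialMoments

end

/-! ### Explicit moment ratios and the resulting scaling bounds. -/

noncomputable section

section MomentBounds

open Finset

/-- The ratio `(l + 1) μ_{l+1} / μ_l` for a perfect matching of the complete graph. -/
def evenRatio (n l : ℕ) : ℝ := (n - 2 * l) / (n - 1 - l)

/-- The ratio `(l + 1) μ_{l+1} / μ_l` for a matching of the complete graph that misses one
vertex. -/
def oddRatio (n l : ℕ) : ℝ := (n - 1 - 2 * l) / (n - 1 - l)

/-- The ratio `(l + 1) μ_{l+1} / μ_l` for a perfect matching of the complete bipartite graph. -/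
def bipRatio (n l : ℕ) : ℝ := if l < n then 2 * (2 * n - 2 * l - 1) / (2 * n - l - 1) else 0

theorem nonempty_arrangement_top (m : ℕ) :
    Nonempty (Arrangement (⊤ : SimpleGraph (Fin (m + 3))) m) :=
  ⟨⟨Equiv.refl _, fun j => by
    simp only [Equiv.refl_apply, SimpleGraph.top_adj, ne_eq, left_eq_add]
    exact one_ne_zero⟩⟩

theorem nonempty_arrangement_bipartite {n m : ℕ} (h : n + n = m + 3) :
    Nonempty (Arrangement (completeBipartiteGraph (Fin n) (Fin n)) m) := by
  let f : Fin (m + 3) → Fin n ⊕ Fin n := fun j =>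
    if j.val % 2 = 0 then Sum.inl ⟨j.val / 2, by omega⟩ else Sum.inr ⟨j.val / 2, by omega⟩
  have hf : Function.Bijective f := by
    rw [Fintype.bijective_iff_injective_and_card]
    refine ⟨fun a b hab => ?_, by simp [h]⟩
    apply Fin.ext
    simp only [f] at hab
    split_ifs at hab <;> simp only [Sum.inl.injEq, Sum.inr.injEq, Fin.mk.injEq] at hab <;> omega
  refine ⟨⟨Equiv.ofBijective f hf, fun j => ?_⟩⟩
  have hv : (j + 1).val % 2 ≠ j.val % 2 := by
    rw [Fin.val_add_one]
    split_ifs with h1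
    · rw [h1, Fin.val_last]; omega
    · omega
  simp only [Equiv.ofBijective_apply, f]
  split_ifs <;> simp <;> omega

theorem tspScaling_top_le_of_even {n : ℕ} (hn : 4 ≤ n) (heven : Even n) (k : ℕ) (c : ℕ → ℝ)
    {L : ℕ} {a : ℕ → ℝ} (hQ : ∀ h : ℕ, ∏ j ∈ range k, ((h : ℝ) - c j) ^ 2
      = ∑ l ∈ range L, a l * (h.choose l : ℝ))
    {E E₁ : ℝ} (hE : E = ∑ l ∈ range L, a l * binomMoment (evenRatio n) l)
    (hE₁ : E₁ = ∑ l ∈ range L, a l * (binomMoment (evenRatio n) l * (l + evenRatio n l)))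
    (hpos : (n : ℝ) * E < (n - 1) * E₁) :
    tspScaling (⊤ : SimpleGraph (Fin n)) k
      ≤ (((n - 2) * n * E / ((n - 1) * E₁ - n * E) : ℝ) : EReal) := by
  classical
  obtain ⟨m, rfl⟩ := Nat.exists_eq_add_of_le' (show 3 ≤ n by omega)
  have hm : Fintype.card (Fin (m + 3)) = m + 3 := Fintype.card_fin _
  have hpar : (m + 3) % 2 = 0 := Nat.even_iff.1 heven
  have := nonempty_arrangement_top m
  have : Nonempty (HamCycle (⊤ : SimpleGraph (Fin (m + 3)))) := this.map fun σ => σ.toHamCycle hm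
  have hmom : ∀ i : Fin (m + 3) → Fin (m + 3), (∀ x, i (i x) = x) → (∀ x, i x ≠ x) → ∀ l,
      unifIntegral (fun σ : Arrangement (⊤ : SimpleGraph (Fin (m + 3))) m =>
        ((hits i σ.toEquiv).card.choose l : ℝ)) = binomMoment (evenRatio (m + 3)) l := by
    intro i hi hi'
    -- With `d = n - 2l - 1` the sparse sets contribute the factor `(d + 1) d / (l + d)`, and a
    -- further hit has probability `1 / d`; the quotient is `evenRatio`.
    refine unifIntegral_choose_hits hi (fun l => m + 2 - 2 * l)
      (fun P c hc hP => hitCount_insert_top_even hi hi' hc hP) ?_ ?_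
    · intro l d hd
      refine ⟨by omega, ?_⟩
      have e1 : m + 2 - 2 * l = d := by omega
      have e2 : ((m + 3 : ℕ) : ℝ) = 2 * l + 1 + d := by rw [hd]; push_cast; ring
      have e3 : (l : ℝ) + d ≠ 0 := by
        have : l + d ≠ 0 := by omega
        exact_mod_cast this
      rw [e1, evenRatio, e2, show (2 * (l : ℝ) + 1 + d - 1 - l) = l + d by ring]
      field_simp; ring
    · intro l hl
      rw [evenRatio, hl]; push_cast; simp
  have hadj : ∀ i : Fin (m + 3) → Fin (m + 3),
      (∀ x, (⊤ : SimpleGraph (Fin (m + 3))).Adj x (i x)) → ∀ x, i x ≠ x :=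
    fun i h x => (h x).ne'
  have main := tspScaling_le_of_perfect (G := (⊤ : SimpleGraph (Fin (m + 3)))) (D := m + 2) hm hpar
    ?_ (by omega) ?_ (fun i hi _ => symmMatching_top hi) k c (E := E) (E₁ := E₁) ?_ ?_ ?_
  · convert main using 3 <;> rw [Fintype.card_fin] <;> push_cast <;> ring
  · intro x
    have : (univ.filter fun y => (⊤ : SimpleGraph (Fin (m + 3))).Adj x y) = univ.erase x := by
      ext y; simp [eq_comm]
    convert congrArg Finset.card this using 1
    · simp
    · rw [card_erase_of_mem (mem_univ _), card_univ, Fintype.card_fin]; rfl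
  · intro x y y' hy hy'
    exact ⟨Equiv.swap y y', fun _ _ => by simp, Equiv.swap_apply_of_ne_of_ne
        (by simpa using hy) (by simpa using hy'), Equiv.swap_apply_left _ _⟩
  · intro i hi hi'
    rw [hE]; exact (matchMoment_of_choose hm hi (hmom i hi (hadj i hi')) hQ).1
  · intro i hi hi'
    rw [hE₁]; exact (matchMoment_of_choose hm hi (hmom i hi (hadj i hi')) hQ).2
  · rw [Fintype.card_fin]
    push_cast at hpos ⊢
    linarith

theorem tspScaling_top_le_of_odd {n : ℕ} (hn : 4 ≤ n) (hodd : ¬ Even n) (k : ℕ) (c : ℕ → ℝ)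
    {L : ℕ} {a : ℕ → ℝ} (hQ : ∀ h : ℕ, ∏ j ∈ range k, ((h : ℝ) - c j) ^ 2
      = ∑ l ∈ range L, a l * (h.choose l : ℝ))
    {E E₁ : ℝ} (hE : E = ∑ l ∈ range L, a l * binomMoment (oddRatio n) l)
    (hE₁ : E₁ = ∑ l ∈ range L, a l * (binomMoment (oddRatio n) l * (l + oddRatio n l)))
    (hpos : E < E₁) :
    tspScaling (⊤ : SimpleGraph (Fin n)) k
      ≤ ((n * (n - 3) * E / ((n - 2) * (E₁ - E)) : ℝ) : EReal) := by
  classical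
  obtain ⟨m, rfl⟩ := Nat.exists_eq_add_of_le' (show 3 ≤ n by omega)
  have hm : Fintype.card (Fin (m + 3)) = m + 3 := Fintype.card_fin _
  have hpar : (m + 3) % 2 = 1 := Nat.odd_iff.1 (Nat.not_even_iff_odd.1 hodd)
  have := nonempty_arrangement_top m
  have : Nonempty (HamCycle (⊤ : SimpleGraph (Fin (m + 3)))) := this.map fun σ => σ.toHamCycle hm
  have hmom : ∀ (i : Fin (m + 3) → Fin (m + 3)) (v : Fin (m + 3)), (∀ x, i (i x) = x) →
      (∀ x, i x = x ↔ x = v) → ∀ l,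
      unifIntegral (fun σ : Arrangement (⊤ : SimpleGraph (Fin (m + 3))) m =>
        ((hits i σ.toEquiv).card.choose l : ℝ)) = binomMoment (oddRatio (m + 3)) l := by
    intro i v hi hi'
    -- The conditional probability of a further hit is now `1 / (d + 1)`, which leaves `d / (l +
    -- d)`.
    refine unifIntegral_choose_hits hi (fun l => m + 3 - 2 * l)
      (fun P c hc hP => hitCount_insert_top_odd hi hi' hc hP) ?_ ?_
    · intro l d hd
      refine ⟨by omega, ?_⟩
      have e1 : m + 3 - 2 * l = d + 1 := by omega
      have e2 : ((m + 3 : ℕ) : ℝ) = 2 * l + 1 + d := by rw [hd]; push_cast; ring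
      have e3 : (l : ℝ) + d ≠ 0 := by
        have : l + d ≠ 0 := by omega
        exact_mod_cast this
      rw [e1, oddRatio, e2, show (2 * (l : ℝ) + 1 + d - 1 - l) = l + d by ring]
      push_cast; field_simp; ring
    · intro l hl; omega
  have main := tspScaling_le_of_near_perfect hm hpar (by omega) k c (E := E) (E₁ := E₁)
    (fun i v hi hi' => by rw [hE]; exact (matchMoment_of_choose hm hi (hmom i v hi hi') hQ).1)
    (fun i v hi hi' => by rw [hE₁]; exact (matchMoment_of_choose hm hi (hmom i v hi hi') hQ).2)
    hpos
  convert main using 3 <;> rw [Fintype.card_fin]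

theorem tspScaling_bipartite_le {n : ℕ} (hn : 3 ≤ n) (k : ℕ) (c : ℕ → ℝ)
    {L : ℕ} {a : ℕ → ℝ} (hQ : ∀ h : ℕ, ∏ j ∈ range k, ((h : ℝ) - c j) ^ 2
      = ∑ l ∈ range L, a l * (h.choose l : ℝ))
    {E E₁ : ℝ} (hE : E = ∑ l ∈ range L, a l * binomMoment (bipRatio n) l)
    (hE₁ : E₁ = ∑ l ∈ range L, a l * (binomMoment (bipRatio n) l * (l + bipRatio n l)))
    (hpos : 2 * E < E₁) :
    tspScaling (completeBipartiteGraph (Fin n) (Fin n)) k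
      ≤ ((2 * (n - 1) * E / (E₁ - 2 * E) : ℝ) : EReal) := by
  classical
  obtain ⟨m, hnm⟩ := Nat.exists_eq_add_of_le' (show 3 ≤ n + n by omega)
  have hm : Fintype.card (Fin n ⊕ Fin n) = m + 3 := by simp [hnm]
  obtain ⟨σ₀⟩ := nonempty_arrangement_bipartite hnm
  have : Nonempty (Arrangement (completeBipartiteGraph (Fin n) (Fin n)) m) := ⟨σ₀⟩
  have : Nonempty (HamCycle (completeBipartiteGraph (Fin n) (Fin n))) := ⟨σ₀.toHamCycle hm⟩
  have hn0 : (0 : ℝ) < n := by exact_mod_cast (show 0 < n by omega)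
  have hmom : ∀ i : Fin n ⊕ Fin n → Fin n ⊕ Fin n, (∀ x, i (i x) = x) →
      (∀ x, (completeBipartiteGraph (Fin n) (Fin n)).Adj x (i x)) → ∀ l,
      unifIntegral (fun σ : Arrangement (completeBipartiteGraph (Fin n) (Fin n)) m =>
        ((hits i σ.toEquiv).card.choose l : ℝ)) = binomMoment (bipRatio n) l := by
    intro i hi hi'
    -- Here the conditional probability is `1 / (n - l) = 2 / (d + 1)`, which leaves `2 d / (l +
    -- d)`.
    refine unifIntegral_choose_hits hi (fun l => n - l)
      (fun P c hc hP => hitCount_insert_bipartite hi hi' σ₀ hc hP) ?_ ?_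
    · intro l d hd
      refine ⟨by omega, ?_⟩
      have e1 : ((n - l : ℕ) : ℝ) = n - l := Nat.cast_sub (by omega)
      have e2 : (d : ℝ) = 2 * n - 2 * l - 1 := by
        have : d + 2 * l + 1 = 2 * n := by omega
        have : (d : ℝ) + 2 * l + 1 = 2 * n := by exact_mod_cast this
        linarith
      have e3 : (2 * (n : ℝ) - l - 1) ≠ 0 := by
        have : l + d ≠ 0 := by omega
        have : (l : ℝ) + d ≠ 0 := by exact_mod_cast this
        rw [e2] at this
        intro h; apply this; linarith
      rw [e1, bipRatio, if_pos (by omega), e2,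
        show (l : ℝ) + (2 * n - 2 * l - 1) = 2 * n - l - 1 by ring]
      field_simp; ring
    · intro l hl
      rw [bipRatio, if_neg (by omega)]
  have main := tspScaling_le_of_perfect (G := completeBipartiteGraph (Fin n) (Fin n)) (D := n) hm
    (by omega) ?_ (by omega) ?_ (fun i hi hi' => symmMatching_completeBipartite hi hi') k c
    (E := E) (E₁ := E₁) ?_ ?_ ?_
  · convert main using 2
    have h1 : E₁ - 2 * E ≠ 0 := by linarith
    rw [Fintype.card_sum, Fintype.card_fin]; push_cast
    rw [show (n : ℝ) * E₁ - (n + n) * E = n * (E₁ - 2 * E) by ring]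
    field_simp; ring
  · rintro (x | x) <;>
    · rw [Finset.card_filter, Fintype.sum_sum_type]; simp
  · have side : ∀ y y' z : Fin n ⊕ Fin n, y.isLeft = y'.isLeft →
        ((Equiv.swap y y' z : Fin n ⊕ Fin n)).isLeft = z.isLeft := by
      intro y y' z h
      rw [Equiv.swap_apply_def]; split_ifs with h1 h2
      · rw [h1, h]
      · rw [h2, h]
      · rfl
    have adj_iff : ∀ x y : Fin n ⊕ Fin n, (completeBipartiteGraph (Fin n) (Fin n)).Adj x y ↔
        x.isLeft ≠ y.isLeft := by
      rintro (x | x) (y | y) <;> simp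
    intro x y y' hy hy'
    have hs : y.isLeft = y'.isLeft := by
      rw [adj_iff] at hy hy'
      exact (by decide : ∀ a b c : Bool, a ≠ b → a ≠ c → b = c) _ _ _ hy hy'
    exact ⟨Equiv.swap y y', fun a b => by rw [adj_iff, adj_iff, side _ _ _ hs, side _ _ _ hs],
      Equiv.swap_apply_of_ne_of_ne hy.ne hy'.ne, Equiv.swap_apply_left _ _⟩
  · intro i hi hi'
    rw [hE]; exact (matchMoment_of_choose hm hi (hmom i hi hi') hQ).1
  · intro i hi hi'
    rw [hE₁]; exact (matchMoment_of_choose hm hi (hmom i hi hi') hQ).2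
  · rw [Fintype.card_sum, Fintype.card_fin]
    push_cast
    nlinarith

end MomentBounds

end

/-! ### Binomial weights do not lower the average. -/

section BinomialWeights

open Finset

theorem choose_le_choose_of_add_lt {k j l : ℕ} (hjl : j < l) (h : j + l < k) :
    k.choose j ≤ k.choose l := by
  have mono : ∀ a b, a ≤ b → b ≤ k / 2 → k.choose a ≤ k.choose b := by
    intro a b hab
    induction b, hab using Nat.le_induction with
    | base => intro _; exact le_rfl
    | succ b _ ih =>
      intro hb
      exact (ih (by omega)).trans (Nat.choose_le_succ_of_lt_half_left (by omega))
  by_cases hl : l ≤ k / 2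
  · exact mono j l hjl.le hl
  · rw [← Nat.choose_symm (show l ≤ k by omega)]
    exact mono j (k - l) (by omega) (by omega)

/-- Weighting by the binomial coefficients `k.choose j` increases the average of `T`, under a
condition on the pairs of indices that are reflections of each other. -/
theorem sum_choose_mul_le (k : ℕ) (u T : ℕ → ℝ)
    (H : ∀ a b s, a < b → 1 ≤ s → a + b + s = k →
      u (a + s) * u (b + s) * (T (b + s) - T (a + s)) ≤ u a * u b * (T b - T a)) :
    (∑ j ∈ range (k + 1), (k.choose j : ℝ) * u j) * ∑ j ∈ range (k + 1), u j * T j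
      ≤ (∑ j ∈ range (k + 1), (k.choose j : ℝ) * (u j * T j)) * ∑ j ∈ range (k + 1), u j := by
  set w : ℕ → ℝ := fun j => (k.choose j : ℝ) with hw
  set F : ℕ → ℕ → ℝ := fun j l => u j * u l * (T l - T j) with hF
  have hF' : ∀ j l, F l j = - F j l := fun j l => by simp only [hF]; ring
  have e1 : (∑ j ∈ range (k + 1), w j * (u j * T j)) * ∑ j ∈ range (k + 1), u j
      - (∑ j ∈ range (k + 1), w j * u j) * ∑ j ∈ range (k + 1), u j * T j
      = ∑ j ∈ range (k + 1), ∑ l ∈ range (k + 1), w l * F j l := by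
    rw [Finset.sum_mul_sum, Finset.sum_mul_sum, ← Finset.sum_sub_distrib, Finset.sum_comm]
    refine Finset.sum_congr rfl fun l _ => ?_
    rw [← Finset.sum_sub_distrib]
    refine Finset.sum_congr rfl fun j _ => ?_
    simp only [hF]; ring
  have e2 : 2 * ∑ j ∈ range (k + 1), ∑ l ∈ range (k + 1), w l * F j l
      = ∑ j ∈ range (k + 1), ∑ l ∈ range (k + 1), (w l - w j) * F j l := by
    have : ∑ j ∈ range (k + 1), ∑ l ∈ range (k + 1), w l * F j l
        = ∑ j ∈ range (k + 1), ∑ l ∈ range (k + 1), - (w j * F j l) := by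
      rw [Finset.sum_comm]
      refine Finset.sum_congr rfl fun l _ => Finset.sum_congr rfl fun j _ => ?_
      rw [hF']; ring
    rw [two_mul]
    nth_rewrite 2 [this]
    rw [← Finset.sum_add_distrib]
    refine Finset.sum_congr rfl fun j _ => ?_
    rw [← Finset.sum_add_distrib]
    exact Finset.sum_congr rfl fun l _ => by ring
  -- Reflection `j ↦ k - j` preserves the binomial weights but reverses the order of a pair, so the
  -- term of `(j, l)` can be grouped with that of `(k - l, k - j)`.
  have e3 : ∑ j ∈ range (k + 1), ∑ l ∈ range (k + 1), (w l - w j) * F j l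
      = ∑ j ∈ range (k + 1), ∑ l ∈ range (k + 1), (w l - w j) * (- F (k - l) (k - j)) := by
    rw [← Finset.sum_range_reflect, Finset.sum_comm, ← Finset.sum_range_reflect]
    refine Finset.sum_congr rfl fun j hj => Finset.sum_congr rfl fun l hl => ?_
    have hj' : j ≤ k := by have := mem_range.1 hj; omega
    have hl' : l ≤ k := by have := mem_range.1 hl; omega
    rw [show k + 1 - 1 - j = k - j by omega, show k + 1 - 1 - l = k - l by omega]
    simp only [hw, Nat.choose_symm hj', Nat.choose_symm hl']
    ring
  -- By unimodality the sign of `w l - w j` is determined by whether `j + l` is below or above `k`;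
  -- `H` gives the second factor the same sign.
  have key : ∀ j l, j < l → l ≤ k → 0 ≤ (w l - w j) * (F j l - F (k - l) (k - j)) := by
    intro j l hjl hl
    rcases Nat.lt_trichotomy (j + l) k with h | h | h
    · refine mul_nonneg (sub_nonneg.2 (by
        simp only [hw]; exact_mod_cast choose_le_choose_of_add_lt hjl h)) (sub_nonneg.2 ?_)
      have := H j l (k - j - l) hjl (by omega) (by omega)
      rwa [show j + (k - j - l) = k - l by omega, show l + (k - j - l) = k - j by omega] at this
    · have : w l = w j := by
        simp only [hw]
        rw [← Nat.choose_symm hl, show k - l = j by omega]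
      rw [this]; simp
    · refine mul_nonneg_of_nonpos_of_nonpos (sub_nonpos.2 ?_) (sub_nonpos.2 ?_)
      · simp only [hw]
        rw [← Nat.choose_symm hl, ← Nat.choose_symm (show j ≤ k by omega)]
        exact_mod_cast choose_le_choose_of_add_lt (by omega) (by omega)
      · have := H (k - l) (k - j) (j + l - k) (by omega) (by omega) (by omega)
        rwa [show k - l + (j + l - k) = j by omega, show k - j + (j + l - k) = l by omega] at this
  have e4 : 0 ≤ ∑ j ∈ range (k + 1), ∑ l ∈ range (k + 1),
      (w l - w j) * (F j l - F (k - l) (k - j)) := by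
    refine Finset.sum_nonneg fun j hj => Finset.sum_nonneg fun l hl => ?_
    have hj' : j ≤ k := by have := mem_range.1 hj; omega
    have hl' : l ≤ k := by have := mem_range.1 hl; omega
    rcases Nat.lt_trichotomy j l with h | h | h
    · exact key j l h hl'
    · simp [h]
    · have := key l j h hj'
      rw [hF' j l, hF' (k - l) (k - j)] at this
      linarith
  have e5 : ∑ j ∈ range (k + 1), ∑ l ∈ range (k + 1), (w l - w j) * (F j l - F (k - l) (k - j))
      = ∑ j ∈ range (k + 1), ∑ l ∈ range (k + 1), (w l - w j) * F j l
        + ∑ j ∈ range (k + 1), ∑ l ∈ range (k + 1), (w l - w j) * (- F (k - l) (k - j)) := by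
    rw [← Finset.sum_add_distrib]
    refine Finset.sum_congr rfl fun j _ => ?_
    rw [← Finset.sum_add_distrib]
    exact Finset.sum_congr rfl fun l _ => by ring
  linarith

-- Pair the rising factors of `(a + s)! / a!` and `(b + s)! / b!` in opposite order: each product
-- has the form `(x + 1) (y + 1)` with `x + y + 1 = k`, hence is at least `k`.
open Nat in
theorem pow_mul_factorial_mul_factorial_le {k a b s : ℕ} (h : a + b + s = k) :
    k ^ s * (a ! * b !) ≤ (a + s)! * (b + s)! := by
  rw [← Nat.factorial_mul_ascFactorial a s, ← Nat.factorial_mul_ascFactorial b s,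
    Nat.ascFactorial_eq_prod_range, Nat.ascFactorial_eq_prod_range,
    ← Finset.prod_range_reflect (fun i => b + 1 + i)]
  have : k ^ s ≤ (∏ i ∈ range s, (a + 1 + i)) * ∏ i ∈ range s, (b + 1 + (s - 1 - i)) := by
    rw [← Finset.prod_mul_distrib]
    calc k ^ s = ∏ _i ∈ range s, k := by simp
      _ ≤ _ := by
        refine Finset.prod_le_prod' fun i hi => ?_
        have hi' := mem_range.1 hi
        obtain ⟨e, he⟩ := Nat.exists_eq_add_of_lt hi'
        rw [show s - 1 - i = e by omega]
        nlinarith [Nat.zero_le (a * b), Nat.zero_le (a * e), Nat.zero_le (i * b),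
          Nat.zero_le (i * e)]
  calc k ^ s * (a ! * b !) ≤ _ * (a ! * b !) := Nat.mul_le_mul_right _ this
    _ = _ := by ring

theorem binomMoment_nonneg {ρ : ℕ → ℝ} {R : ℕ} (h0 : ∀ i ≤ R, 0 ≤ ρ i) (hR : ρ R = 0) (i : ℕ) :
    0 ≤ binomMoment ρ i ∧ (R < i → binomMoment ρ i = 0) := by
  induction i with
  | zero => exact ⟨zero_le_one, fun h => by omega⟩
  | succ i ih =>
    rw [binomMoment]
    rcases Nat.lt_trichotomy R i with h | h | h
    · rw [ih.2 h]; simp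
    · rw [← h, hR]; simp
    · exact ⟨div_nonneg (mul_nonneg ih.1 (h0 i h.le)) (by positivity), fun h' => by omega⟩

theorem binomMoment_pos {ρ : ℕ → ℝ} {R : ℕ} (h0 : ∀ i < R, 0 < ρ i) {i : ℕ} (hi : i ≤ R) :
    0 < binomMoment ρ i := by
  induction i with
  | zero => exact zero_lt_one
  | succ i ih =>
    rw [binomMoment]
    exact div_pos (mul_pos (ih (by omega)) (h0 i hi)) (by positivity)

open Nat in
/-- The comparison of the averages of `i + ρ_i` for the weights `(k.choose (i - k)) (i.choose k) μ_i`
and `(i.choose k) μ_i`. -/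
theorem binomMoment_comparison {ρ θ : ℕ → ℝ} {R k : ℕ} {L : ℝ} (hL : 0 ≤ L)
    (h0 : ∀ i ≤ R, 0 ≤ ρ i) (hR : ρ R = 0) (hk : k + 2 ≤ R → L ^ 2 ≤ k)
    (hρ : ∀ i, k ≤ i → i < R → ρ i ≤ L * θ (i + 1)) (hθ : ∀ i, 0 ≤ θ i ∧ θ i ≤ 1)
    (hmono : ∀ i i', k ≤ i → i ≤ i' → i' ≤ R → (i : ℝ) + ρ i ≤ i' + ρ i')
    (hconc : ∀ i i' s, k ≤ i → i < i' → 1 ≤ s → i' + s ≤ R →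
      θ (i' + s) * (((i' + s : ℕ) + ρ (i' + s)) - ((i + s : ℕ) + ρ (i + s)))
        ≤ ((i' : ℝ) + ρ i') - (i + ρ i)) :
    (∑ j ∈ range (k + 1), (k.choose j : ℝ) * (((k + j).choose k : ℝ) * binomMoment ρ (k + j)))
      * (∑ j ∈ range (k + 1), ((k + j).choose k : ℝ) * binomMoment ρ (k + j)
          * ((k + j : ℕ) + ρ (k + j)))
      ≤ (∑ j ∈ range (k + 1), (k.choose j : ℝ) * (((k + j).choose k : ℝ) * binomMoment ρ (k + j)
          * ((k + j : ℕ) + ρ (k + j))))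
        * ∑ j ∈ range (k + 1), ((k + j).choose k : ℝ) * binomMoment ρ (k + j) := by
  set u : ℕ → ℝ := fun j => ((k + j).choose k : ℝ) * binomMoment ρ (k + j) with hu
  have hu0 : ∀ j, 0 ≤ u j := fun j =>
    mul_nonneg (Nat.cast_nonneg _) (binomMoment_nonneg h0 hR _).1
  have huR : ∀ j, R < k + j → u j = 0 := fun j hj => by
    simp only [hu]; rw [(binomMoment_nonneg h0 hR _).2 hj, mul_zero]
  -- The factor `(k + j choose k)` replaces the denominator `k + j + 1` of the moment recursion by
  -- `j + 1`. So `u_j j!` is multiplied by `ρ_{k+j}` at each step, which yields the factorial decay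
  -- below.
  have hstep : ∀ j, u (j + 1) * ((j : ℝ) + 1) = u j * ρ (k + j) := by
    intro j
    simp only [hu]
    have h1 := Nat.add_one_mul_choose_eq (k + j) j
    rw [← Nat.choose_symm_add, show k + j + 1 = k + (j + 1) by ring, ← Nat.choose_symm_add] at h1
    have h2 := congrArg (Nat.cast : ℕ → ℝ) h1
    push_cast at h2
    rw [show k + (j + 1) = (k + j) + 1 by ring, binomMoment]
    push_cast
    have h3 : (k : ℝ) + j + 1 ≠ 0 := by positivity
    rw [show k + (j + 1) = (k + j) + 1 by ring] at h2
    field_simp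
    linear_combination (-(binomMoment ρ (k + j) * ρ (k + j))) * h2
  have hiter : ∀ a s, k + a + s ≤ R → 1 ≤ s →
      u (a + s) * ((a + s)! : ℝ) ≤ L ^ s * θ (k + a + s) * (u a * (a ! : ℝ)) := by
    intro a s
    induction s with
    | zero => intro _ h; omega
    | succ s ih =>
      intro hs _
      have h1 : u (a + (s + 1)) * ((a + (s + 1))! : ℝ)
          = (u (a + s) * ((a + s)! : ℝ)) * ρ (k + (a + s)) := by
        rw [← add_assoc, Nat.factorial_succ]
        have := hstep (a + s)
        push_cast at this ⊢
        linear_combination ((a + s)! : ℝ) * this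
      have h2 : u (a + s) * ((a + s)! : ℝ) ≤ L ^ s * (u a * (a ! : ℝ)) := by
        rcases Nat.eq_zero_or_pos s with rfl | hs0
        · simp
        · refine (ih (by omega) hs0).trans ?_
          have : 0 ≤ u a * (a ! : ℝ) := mul_nonneg (hu0 a) (by positivity)
          refine mul_le_mul_of_nonneg_right ?_ this
          exact mul_le_of_le_one_right (by positivity) (hθ _).2
      have h3 := hρ (k + (a + s)) (by omega) (by omega)
      rw [h1]
      have h4 : 0 ≤ u a * (a ! : ℝ) := mul_nonneg (hu0 a) (by positivity)
      calc (u (a + s) * ((a + s)! : ℝ)) * ρ (k + (a + s))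
          ≤ (L ^ s * (u a * (a ! : ℝ))) * (L * θ (k + (a + s) + 1)) :=
            mul_le_mul h2 h3 (h0 _ (by omega)) (by positivity)
        _ = _ := by
            rw [show k + (a + s) + 1 = k + a + (s + 1) by ring]; ring
  refine sum_choose_mul_le k u (fun j => (k + j : ℕ) + ρ (k + j)) ?_
  intro a b s hab hs hk'
  by_cases hbs : k + b + s ≤ R
  · have h1 := hiter a s (by omega) hs
    have h2 := hiter b s hbs hs
    have hfac : (k : ℝ) ^ s * ((a ! : ℝ) * b !) ≤ ((a + s)! : ℝ) * (b + s)! := by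
      exact_mod_cast pow_mul_factorial_mul_factorial_le hk'
    have hLk : (L ^ s) * (L ^ s) ≤ (k : ℝ) ^ s := by
      rw [← mul_pow, ← sq]
      exact pow_le_pow_left₀ (by positivity) (hk (by omega)) s
    have ha := (hθ (k + a + s))
    have hb := (hθ (k + b + s))
    -- The decay gives `L^{2s}`, and the factorials give back `k^s ≥ L^{2s}`. One factor `θ` is kept
    -- for the possible failure of concavity at the end of the range.
    have hP : u (a + s) * u (b + s) ≤ θ (k + b + s) * (u a * u b) := by
      have e0 : 0 < ((a + s)! : ℝ) * (b + s)! := by positivity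
      refine le_of_mul_le_mul_right ?_ e0
      have hua := hu0 a
      have hub := hu0 b
      have hX : 0 ≤ θ (k + b + s) * (u a * u b) := mul_nonneg hb.1 (mul_nonneg hua hub)
      calc u (a + s) * u (b + s) * (((a + s)! : ℝ) * (b + s)!)
          = (u (a + s) * ((a + s)! : ℝ)) * (u (b + s) * ((b + s)! : ℝ)) := by ring
        _ ≤ (L ^ s * θ (k + a + s) * (u a * (a ! : ℝ)))
            * (L ^ s * θ (k + b + s) * (u b * (b ! : ℝ))) :=
          mul_le_mul h1 h2 (mul_nonneg (hu0 _) (by positivity))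
            (mul_nonneg (mul_nonneg (by positivity) ha.1) (mul_nonneg hua (by positivity)))
        _ = θ (k + a + s) * ((θ (k + b + s) * (u a * u b)) *
            ((L ^ s * L ^ s) * ((a ! : ℝ) * b !))) := by ring
        _ ≤ 1 * ((θ (k + b + s) * (u a * u b)) * ((L ^ s * L ^ s) * ((a ! : ℝ) * b !))) :=
          mul_le_mul_of_nonneg_right ha.2 (mul_nonneg hX (by positivity))
        _ ≤ (θ (k + b + s) * (u a * u b)) * (((a + s)! : ℝ) * (b + s)!) := by
          rw [one_mul]
          refine mul_le_mul_of_nonneg_left (le_trans ?_ hfac) hX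
          exact mul_le_mul_of_nonneg_right hLk (by positivity)
    have hmon := hmono (k + (a + s)) (k + (b + s)) (by omega) (by omega) (by omega)
    have hc := hconc (k + a) (k + b) s (by omega) (by omega) hs hbs
    have hab0 : 0 ≤ u a * u b := mul_nonneg (hu0 a) (hu0 b)
    calc u (a + s) * u (b + s) * (((k + (b + s) : ℕ) + ρ (k + (b + s)))
          - ((k + (a + s) : ℕ) + ρ (k + (a + s))))
        ≤ θ (k + b + s) * (u a * u b) * (((k + (b + s) : ℕ) + ρ (k + (b + s)))
          - ((k + (a + s) : ℕ) + ρ (k + (a + s)))) :=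
          mul_le_mul_of_nonneg_right hP (by linarith)
      _ = (u a * u b) * (θ (k + b + s) * (((k + b + s : ℕ) + ρ (k + b + s))
          - ((k + a + s : ℕ) + ρ (k + a + s)))) := by
          simp only [add_assoc]; ring
      _ ≤ _ := mul_le_mul_of_nonneg_left hc hab0
  -- Beyond `R` the weights vanish, so the reflected term drops out and monotonicity suffices.
  · rw [huR (b + s) (by omega)]
    by_cases hb : k + b ≤ R
    · have := hmono (k + a) (k + b) (by omega) (by omega) hb
      simp only [mul_zero, zero_mul]
      exact mul_nonneg (mul_nonneg (hu0 a) (hu0 b)) (by linarith)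
    · rw [huR b (by omega)]; simp

/-! ### Binomial expansions -/

theorem prod_sub_eq_descFactorial (h k : ℕ) :
    ∏ j ∈ range k, ((h : ℝ) - j) = (h.descFactorial k : ℝ) := by
  induction k with
  | zero => simp
  | succ k ih =>
    rw [prod_range_succ, ih, Nat.descFactorial_succ]
    rcases Nat.lt_or_ge h k with hk | hk
    · rw [Nat.descFactorial_of_lt hk]; simp
    · push_cast [hk]; ring

/-- Expand one factor by Vandermonde over `h = k + (h - k)` and absorb the other factor into `(h
choose k + j)`. -/
theorem choose_mul_choose_self (h k : ℕ) :
    h.choose k * h.choose k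
      = ∑ j ∈ range (k + 1), k.choose j * (k + j).choose k * h.choose (k + j) := by
  rcases Nat.lt_or_ge h k with hk | hk
  · rw [Nat.choose_eq_zero_of_lt hk, Finset.sum_eq_zero]
    · simp
    · intro j _
      rw [Nat.choose_eq_zero_of_lt (show h < k + j by omega), mul_zero]
  · obtain ⟨e, rfl⟩ := Nat.exists_eq_add_of_le hk
    have h1 : (k + e).choose k = ∑ j ∈ range (k + 1), e.choose j * k.choose j := by
      rw [add_comm, Nat.add_choose_eq, Finset.Nat.sum_antidiagonal_eq_sum_range_succ_mk]
      refine Finset.sum_congr rfl fun j hj => ?_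
      rw [Nat.choose_symm (by have := mem_range.1 hj; omega)]
    nth_rewrite 2 [h1]
    rw [Finset.mul_sum]
    refine Finset.sum_congr rfl fun j _ => ?_
    have h2 : (k + e).choose (k + j) * (k + j).choose k = (k + e).choose k * e.choose j := by
      rcases Nat.lt_or_ge e j with hj | hj
      · rw [Nat.choose_eq_zero_of_lt hj, Nat.choose_eq_zero_of_lt (by omega)]; simp
      · rw [Nat.choose_mul (by omega)]
        simp
    calc (k + e).choose k * (e.choose j * k.choose j)
        = ((k + e).choose k * e.choose j) * k.choose j := by ring
      _ = _ := by rw [← h2]; ring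

end BinomialWeights

/-! ### The bound as a ratio of moment sums. -/

noncomputable section

section ClosedBounds

open Finset

/-- The sum of `(i.choose k) μ_i` over `k ≤ i ≤ 2 k`. -/
def momentSum (ρ : ℕ → ℝ) (k : ℕ) : ℝ :=
  ∑ j ∈ range (k + 1), ((k + j).choose k : ℝ) * binomMoment ρ (k + j)

/-- The sum of `(i.choose k) μ_i (i + ρ_i)` over `k ≤ i ≤ 2 k`. -/
def momentSumMul (ρ : ℕ → ℝ) (k : ℕ) : ℝ :=
  ∑ j ∈ range (k + 1), ((k + j).choose k : ℝ) * binomMoment ρ (k + j)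
    * ((k + j : ℕ) + ρ (k + j))

/-- The coefficients of the square of the falling factorial in the basis of binomial
coefficients. -/
def fallingSqCoeff (k l : ℕ) : ℝ :=
  if l < k then 0 else (k.factorial : ℝ) ^ 2 * ((k.choose (l - k) : ℝ) * (l.choose k : ℝ))

theorem sum_fallingSqCoeff (k : ℕ) (f : ℕ → ℝ) :
    ∑ l ∈ range (k + (k + 1)), fallingSqCoeff k l * f l
      = (k.factorial : ℝ) ^ 2 *
        ∑ j ∈ range (k + 1), (k.choose j : ℝ) * (((k + j).choose k : ℝ) * f (k + j)) := by
  rw [sum_range_add, sum_eq_zero, zero_add, mul_sum]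
  · refine sum_congr rfl fun j _ => ?_
    rw [fallingSqCoeff, if_neg (by omega), Nat.add_sub_cancel_left]
    ring
  · intro l hl
    rw [fallingSqCoeff, if_pos (mem_range.1 hl), zero_mul]

theorem prod_sub_sq_eq (h k : ℕ) :
    ∏ j ∈ range k, ((h : ℝ) - j) ^ 2
      = ∑ l ∈ range (k + (k + 1)), fallingSqCoeff k l * (h.choose l : ℝ) := by
  rw [sum_fallingSqCoeff, prod_pow, prod_sub_eq_descFactorial, Nat.descFactorial_eq_factorial_mul_choose]
  have := congrArg (Nat.cast : ℕ → ℝ) (choose_mul_choose_self h k)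
  push_cast at this ⊢
  rw [mul_pow, sq (h.choose k : ℝ), this]
  congr 1
  exact sum_congr rfl fun j _ => by ring

/-- The inequality `lam < i + ρ_i` holds on the support of the moments, so it passes to the weighted
sums; the term `j = 0` has positive weight and makes it strict. -/
theorem sum_choose_moment_pos {ρ : ℕ → ℝ} {R k : ℕ} {lam : ℝ} (h0 : ∀ i < R, 0 < ρ i)
    (hR : ρ R = 0) (hkR : k ≤ R) (hlam : ∀ i, k ≤ i → i ≤ R → lam < i + ρ i)
    {w : ℕ → ℝ} (hw : ∀ j, 0 ≤ w j) (hw0 : 0 < w 0) :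
    lam * (∑ j ∈ range (k + 1), w j * (((k + j).choose k : ℝ) * binomMoment ρ (k + j)))
      < ∑ j ∈ range (k + 1), w j * (((k + j).choose k : ℝ) * binomMoment ρ (k + j)
          * ((k + j : ℕ) + ρ (k + j))) := by
  have h0' : ∀ i ≤ R, 0 ≤ ρ i := fun i hi => by
    rcases hi.lt_or_eq with h | h
    · exact (h0 i h).le
    · rw [h, hR]
  rw [mul_sum]
  refine sum_lt_sum (fun j _ => ?_) ⟨0, by simp, ?_⟩
  · rcases Nat.lt_or_ge R (k + j) with h | h
    · rw [(binomMoment_nonneg h0' hR (k + j)).2 h]; simp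
    · have h1 := hlam (k + j) (by omega) h
      have h2 : 0 ≤ w j * (((k + j).choose k : ℝ) * binomMoment ρ (k + j)) :=
        mul_nonneg (hw j) (mul_nonneg (Nat.cast_nonneg _) (binomMoment_nonneg h0' hR _).1)
      nlinarith
  · have h1 := hlam k le_rfl hkR
    have h2 : 0 < w 0 * (((k + 0).choose k : ℝ) * binomMoment ρ (k + 0)) := by
      have := binomMoment_pos h0 hkR
      simp only [add_zero, Nat.choose_self]
      positivity
    simp only [add_zero] at h2 ⊢
    nlinarith

theorem mul_momentSum_lt {ρ : ℕ → ℝ} {R k : ℕ} {lam : ℝ} (h0 : ∀ i < R, 0 < ρ i)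
    (hR : ρ R = 0) (hkR : k ≤ R) (hlam : ∀ i, k ≤ i → i ≤ R → lam < i + ρ i) :
    lam * momentSum ρ k < momentSumMul ρ k := by
  have := sum_choose_moment_pos h0 hR hkR hlam (w := fun _ => 1) (fun _ => zero_le_one) one_pos
  simpa only [one_mul, momentSum, momentSumMul] using this

/-- The expression decreases as the ratio `E₁ / E` grows, and `h` says that this ratio is at least
`S₁ / S`. -/
theorem mul_div_sub_le {E E₁ S S₁ κ lam : ℝ} (hκ : 0 ≤ κ) (hE : lam * E < E₁)
    (hS : lam * S < S₁) (h : E * S₁ ≤ E₁ * S) :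
    κ * E / (E₁ - lam * E) ≤ κ * S / (S₁ - lam * S) := by
  rw [div_le_div_iff₀ (by linarith) (by linarith)]
  nlinarith [mul_le_mul_of_nonneg_left h hκ]

theorem sum_Icc_min_eq {R k : ℕ} {f : ℕ → ℝ} (hf : ∀ i, R < i → f i = 0) :
    ∑ i ∈ Icc k (min R (2 * k)), f i = ∑ j ∈ range (k + 1), f (k + j) := by
  have h1 : ∑ i ∈ Icc k (min R (2 * k)), f i = ∑ i ∈ Ico k (2 * k + 1), f i := by
    refine sum_subset (fun i hi => ?_) fun i hi hi' => hf i ?_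
    · simp only [mem_Icc, mem_Ico] at hi ⊢; omega
    · simp only [mem_Icc, mem_Ico] at hi hi'; omega
  rw [h1, sum_Ico_eq_sum_range, show 2 * k + 1 - k = k + 1 by omega]

/-- Constants proportional to `μ_i (i + ρ_i - lam)`, respectively to `μ_i`, recover the bound. -/
theorem sum_ratio_eq {ρ A B : ℕ → ℝ} {R k : ℕ} {s κ lam c : ℝ} (h0 : ∀ i < R, 0 < ρ i)
    (hR : ρ R = 0) (hkR : k ≤ R) (hlam : ∀ i, k ≤ i → i ≤ R → lam < i + ρ i) (hc : 0 < c)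
    (hA : ∀ i, k ≤ i → i ≤ R → A i = c * (binomMoment ρ i * (i + ρ i - lam)))
    (hB : ∀ i, k ≤ i → i ≤ R → A i + s * B i = κ * c * binomMoment ρ i) :
    0 < ∑ i ∈ Icc k (min R (2 * k)), (i.choose k : ℝ) * A i ∧
    1 + s * ((∑ i ∈ Icc k (min R (2 * k)), (i.choose k : ℝ) * B i)
        / ∑ i ∈ Icc k (min R (2 * k)), (i.choose k : ℝ) * A i)
      = κ * momentSum ρ k / (momentSumMul ρ k - lam * momentSum ρ k) := by
  have h0' : ∀ i ≤ R, 0 ≤ ρ i := fun i hi => by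
    rcases hi.lt_or_eq with h | h
    · exact (h0 i h).le
    · rw [h, hR]
  have hlt := mul_momentSum_lt h0 hR hkR hlam
  have e1 : ∑ i ∈ Icc k (min R (2 * k)), (i.choose k : ℝ) * A i
      = c * (momentSumMul ρ k - lam * momentSum ρ k) := by
    calc _ = ∑ i ∈ Icc k (min R (2 * k)),
          (i.choose k : ℝ) * (c * (binomMoment ρ i * (i + ρ i - lam))) := by
          refine sum_congr rfl fun i hi => ?_
          rw [mem_Icc] at hi
          rw [hA i hi.1 (by omega)]
      _ = _ := by
          rw [sum_Icc_min_eq fun i hi => by rw [(binomMoment_nonneg h0' hR i).2 hi]; simp,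
            momentSum, momentSumMul, mul_sum, ← sum_sub_distrib, mul_sum]
          exact sum_congr rfl fun i _ => by ring
  have e2 : ∑ i ∈ Icc k (min R (2 * k)), (i.choose k : ℝ) * A i
      + s * ∑ i ∈ Icc k (min R (2 * k)), (i.choose k : ℝ) * B i
      = κ * c * momentSum ρ k := by
    calc _ = ∑ i ∈ Icc k (min R (2 * k)),
          (i.choose k : ℝ) * (κ * c * binomMoment ρ i) := by
          rw [mul_sum, ← sum_add_distrib]
          refine sum_congr rfl fun i hi => ?_
          rw [mem_Icc] at hi
          rw [← hB i hi.1 (by omega)]; ring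
      _ = _ := by
          rw [sum_Icc_min_eq fun i hi => by rw [(binomMoment_nonneg h0' hR i).2 hi]; simp,
            momentSum, mul_sum]
          exact sum_congr rfl fun i _ => by ring
  have hpos : 0 < momentSumMul ρ k - lam * momentSum ρ k := by linarith
  have hpos' := mul_pos hc hpos
  refine ⟨by rw [e1]; exact hpos', ?_⟩
  rw [e1] at e2 ⊢
  have e3 : s * ((∑ i ∈ Icc k (min R (2 * k)), (i.choose k : ℝ) * B i)
      / (c * (momentSumMul ρ k - lam * momentSum ρ k)))
      = (κ * c * momentSum ρ k - c * (momentSumMul ρ k - lam * momentSum ρ k))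
        / (c * (momentSumMul ρ k - lam * momentSum ρ k)) := by
    rw [← e2]; ring
  rw [e3]
  generalize momentSumMul ρ k - lam * momentSum ρ k = d at hpos ⊢
  field_simp
  ring

/-- A mediant estimate: with nonnegative weights, a bound for each quotient `κ / (i + ρ_i - lam)`
bounds the quotient of the sums. -/
theorem momentSum_ratio_le {ρ : ℕ → ℝ} {R k : ℕ} {κ lam U : ℝ} (h0 : ∀ i < R, 0 < ρ i)
    (hR : ρ R = 0) (hkR : k ≤ R) (hlam : ∀ i, k ≤ i → i ≤ R → lam < i + ρ i)
    (hU : ∀ i, k ≤ i → i ≤ R → κ ≤ U * (i + ρ i - lam)) :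
    κ * momentSum ρ k / (momentSumMul ρ k - lam * momentSum ρ k) ≤ U := by
  have h0' : ∀ i ≤ R, 0 ≤ ρ i := fun i hi => by
    rcases hi.lt_or_eq with h | h
    · exact (h0 i h).le
    · rw [h, hR]
  have hlt := mul_momentSum_lt h0 hR hkR hlam
  rw [div_le_iff₀ (by linarith), momentSum, momentSumMul, mul_sum, mul_sum, ← sum_sub_distrib,
    mul_sum]
  refine sum_le_sum fun j _ => ?_
  rcases Nat.lt_or_ge R (k + j) with h | h
  · rw [(binomMoment_nonneg h0' hR (k + j)).2 h]; simp
  · have h2 : 0 ≤ ((k + j).choose k : ℝ) * binomMoment ρ (k + j) :=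
      mul_nonneg (Nat.cast_nonneg _) (binomMoment_nonneg h0' hR _).1
    have := mul_le_mul_of_nonneg_left (hU (k + j) (by omega) h) h2
    linarith

end ClosedBounds

end

/-! ### The constants of the complete graph in terms of moments. -/

noncomputable section

section CompleteConstants

open scoped Nat

/-- The recursion solved in closed form. Both parities of `n` are covered, with `N = n - 1` and `r =
n / 2` rounded down. -/
theorem binomMoment_mul_factorial {ρ : ℕ → ℝ} {N r : ℕ} (hr : r ≤ N)
    (hρ : ∀ l < r, ρ l = (2 * r - 2 * l) / (N - l)) {i : ℕ} (hi : i ≤ r) :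
    binomMoment ρ i * (N ! : ℝ) = 2 ^ i * (r.choose i : ℝ) * ((N - i)! : ℝ) := by
  induction i with
  | zero => simp [binomMoment]
  | succ i ih =>
    have h1 := ih (by omega)
    have h2 : (r.choose (i + 1) : ℝ) * (i + 1) = r.choose i * (r - i) := by
      have := congrArg (Nat.cast : ℕ → ℝ) (Nat.choose_succ_right_eq r i)
      push_cast [show i ≤ r by omega] at this
      exact this
    have h3 : ((N - i)! : ℝ) = (N - i) * ((N - (i + 1))! : ℝ) := by
      rw [show N - i = (N - (i + 1)) + 1 by omega, Nat.factorial_succ]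
      push_cast [show i + 1 ≤ N by omega]
      ring
    have h4 : (N : ℝ) - i ≠ 0 := by
      have : (i : ℝ) + 1 ≤ N := by exact_mod_cast (show i + 1 ≤ N by omega)
      linarith
    rw [binomMoment, hρ i (by omega)]
    calc binomMoment ρ i * ((2 * r - 2 * i) / (N - i)) / (i + 1) * (N ! : ℝ)
        = (binomMoment ρ i * (N ! : ℝ)) * ((2 * r - 2 * i) / (N - i)) / (i + 1) := by ring
      _ = 2 ^ i * (r.choose i : ℝ) * ((N - i) * ((N - (i + 1))! : ℝ))
            * ((2 * r - 2 * i) / (N - i)) / (i + 1) := by rw [h1, h3]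
      _ = 2 ^ (i + 1) * (r.choose i * (r - i)) * ((N - (i + 1))! : ℝ) / (i + 1) := by
          field_simp; ring
      _ = _ := by
          rw [← h2]; field_simp

theorem cast_choose_mul_eq {r i : ℕ} (hi : i ≤ r) :
    (r.choose i : ℝ) * (i ! * (r - i)!) = r ! := by
  have := Nat.choose_mul_factorial_mul_factorial hi
  rw [← this]; push_cast; ring

theorem cast_choose_pred_mul_eq {r i : ℕ} (hi : i ≤ r + 1) :
    (r.choose i : ℝ) * (i ! * (r + 1 - i)!) = r ! * (r + 1 - i) := by
  rcases hi.lt_or_eq with h | h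
  · rw [show r + 1 - i = (r - i) + 1 by omega, Nat.factorial_succ,
      ← cast_choose_mul_eq (show i ≤ r by omega)]
    push_cast [show i ≤ r by omega]
    ring
  · subst h; simp

theorem chooseSubTwo_mul_eq {r i : ℕ} (hi : i ≤ r + 2) :
    (chooseSubTwo r i : ℝ) * (i ! * (r + 2 - i)!) = r ! * (i * (i - 1)) := by
  rw [chooseSubTwo]
  split_ifs with h
  · obtain ⟨j, rfl⟩ := Nat.exists_eq_add_of_le' h
    rw [show r + 2 - (j + 2) = r - j by omega, Nat.add_sub_cancel, Nat.factorial_succ,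
      Nat.factorial_succ, ← cast_choose_mul_eq (show j ≤ r by omega)]
    push_cast
    ring
  · obtain rfl | rfl : i = 0 ∨ i = 1 := by omega
    all_goals simp

theorem two_zpow_sub_two (i : ℕ) : (2 : ℝ) ^ ((i : ℤ) - 2) = 2 ^ i / 4 := by
  rw [zpow_sub₀ two_ne_zero, zpow_natCast]; norm_num

theorem two_zpow_sub_one (i : ℕ) : (2 : ℝ) ^ ((i : ℤ) - 1) = 2 ^ i / 2 := by
  rw [zpow_sub₀ two_ne_zero, zpow_natCast]; norm_num

/-- All binomials and factorial quotients are polynomial multiples of one quantity `Z = (r - 2)! /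
(i! (r - i)!)`, `r = p + 2`, so that identities between the constants become polynomial identities.
-/
theorem veomett_even {p i : ℕ} (hi : i ≤ p + 2) {n : ℕ} (hn : n = 2 * (p + 2)) :
    ∃ Z : ℝ, ((p + 2).choose i : ℝ) = (p + 2) * (p + 1) * Z ∧
      veomettAlpha n i = 2 ^ i / 4 *
        (4 * (i + 2) * ((p : ℝ) + 2) ^ 2 - 2 * (i * (i + 7) + 4) * (p + 2) + 3 * i * (i + 3)) *
          Z * ((2 * (p + 2) - i - 2)! : ℝ) ∧
      veomettBeta n i = 2 ^ i / 2 * (i * (i - 1) + 4 * (p + 1) * (p + 2 - i)) *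
          Z * ((2 * (p + 2) - i - 2)! : ℝ) := by
  have h0 : ((i ! : ℝ) * ((p + 2 - i)! : ℝ)) ≠ 0 := by positivity
  refine ⟨(p ! : ℝ) / (i ! * (p + 2 - i)!), ?_, ?_, ?_⟩
  · have := cast_choose_mul_eq hi
    rw [eq_comm, mul_div_assoc', div_eq_iff h0, this, Nat.factorial_succ, Nat.factorial_succ]
    push_cast; ring
  · rw [veomettAlpha]
    have hr : n / 2 = p + 2 := by omega
    rw [if_pos ⟨p + 2, by omega⟩, hr, two_zpow_sub_two, show p + 2 - 2 = p by omega]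
    push_cast
    ring
  · rw [veomettBeta]
    have hr : n / 2 = p + 2 := by omega
    rw [if_pos ⟨p + 2, by omega⟩, hr, two_zpow_sub_one, show p + 2 - 2 = p by omega,
      show p + 2 - 1 = p + 1 by omega]
    have h1 : (chooseSubTwo p i : ℝ) = p ! * (i * (i - 1)) / (i ! * (p + 2 - i)!) := by
      rw [eq_div_iff h0, chooseSubTwo_mul_eq hi]
    have h2 : ((p + 1).choose i : ℝ) = (p + 1) * p ! * (p + 2 - i) / (i ! * (p + 2 - i)!) := by
      rw [eq_div_iff h0, cast_choose_pred_mul_eq (show i ≤ p + 1 + 1 by omega), Nat.factorial_succ]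
      push_cast; ring
    rw [h1, h2]
    ring

theorem veomett_odd {p i : ℕ} (hi : i ≤ p + 2) {n : ℕ} (hn : n = 2 * (p + 2) + 1) :
    ∃ Z : ℝ, ((p + 2).choose i : ℝ) = (p + 2) * (p + 1) * Z ∧
      veomettAlpha n i = 2 ^ i / 4 *
        (4 * (i + 2) * ((p : ℝ) + 2) ^ 2 - 2 * i * (i + 4) * (p + 2) + (i - 1) * i + 4 * (p + 2)) *
          (p + 1) * Z * ((2 * (p + 2) - i - 1)! : ℝ) ∧
      veomettBeta n i = 2 ^ i / 4 * ((i : ℝ) ^ 2 * (2 * (p + 2) - 1) - 8 * i * ((p : ℝ) + 2) ^ 2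
          + 6 * i * (p + 2) + i + 4 * (p + 2 - 1) * (p + 2) * (2 * (p + 2) + 1)) *
          Z * ((2 * (p + 2) - i - 1)! : ℝ) := by
  have h0 : ((i ! : ℝ) * ((p + 2 - i)! : ℝ)) ≠ 0 := by positivity
  have hr : n / 2 = p + 2 := by omega
  have hodd : ¬ Even n := by rw [Nat.not_even_iff]; omega
  refine ⟨(p ! : ℝ) / (i ! * (p + 2 - i)!), ?_, ?_, ?_⟩
  · have := cast_choose_mul_eq hi
    rw [eq_comm, mul_div_assoc', div_eq_iff h0, this, Nat.factorial_succ, Nat.factorial_succ]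
    push_cast; ring
  · rw [veomettAlpha, if_neg hodd, hr, two_zpow_sub_two, show p + 2 - 1 = p + 1 by omega,
      Nat.factorial_succ p]
    push_cast
    ring
  · rw [veomettBeta, if_neg hodd, hr, two_zpow_sub_two, show p + 2 - 2 = p by omega]
    push_cast
    ring

theorem evenRatio_add_sub {n i : ℕ} (hi : 2 * i ≤ n) (hn : 4 ≤ n) :
    (i : ℝ) + evenRatio n i - n / (n - 1)
      = i * ((n - 1) * (n - 2 - i) + 1) / ((n - 1 - i) * (n - 1)) := by
  have h1 : (2 : ℝ) * i ≤ n := by exact_mod_cast hi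
  have h2 : (4 : ℝ) ≤ n := by exact_mod_cast hn
  have h3 : (n : ℝ) - 1 ≠ 0 := by linarith
  have h4 : (n : ℝ) - 1 - i ≠ 0 := by linarith
  rw [evenRatio]
  field_simp
  ring

theorem oddRatio_add_sub {n i : ℕ} (hi : 2 * i ≤ n) (hn : 4 ≤ n) :
    (i : ℝ) + oddRatio n i - 1 = i * (n - 2 - i) / (n - 1 - i) := by
  have h1 : (2 : ℝ) * i ≤ n := by exact_mod_cast hi
  have h2 : (4 : ℝ) ≤ n := by exact_mod_cast hn
  have h4 : (n : ℝ) - 1 - i ≠ 0 := by linarith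
  rw [oddRatio]
  field_simp
  ring

/-- The explicit constants are the summands of the moment bound in disguise: `α_i - β_i` belongs to
its denominator, and adding `(n - 1)/2 β_i` yields the numerator. The common factor is fixed by the
requirement of `sum_ratio_eq`. -/
theorem veomett_even_moment {n i : ℕ} (hn : 4 ≤ n) (heven : Even n) (hi : i ≤ n / 2) :
    veomettAlpha n i - veomettBeta n i = ((n - 1) * (n - 1)! / ((n - 2) * n) : ℝ) *
        (binomMoment (evenRatio n) i * (i + evenRatio n i - n / (n - 1))) ∧
    veomettAlpha n i - veomettBeta n i + ((n : ℝ) - 1) / 2 * veomettBeta n i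
      = (n - 1)! * binomMoment (evenRatio n) i := by
  obtain ⟨p, hp⟩ : ∃ p, n = 2 * (p + 2) := by
    obtain ⟨r, hr⟩ := heven
    exact ⟨r - 2, by omega⟩
  have hi' : i ≤ p + 2 := by omega
  obtain ⟨Z, h1, h2, h3⟩ := veomett_even hi' hp
  have hnp : (n : ℝ) = 2 * (p + 2) := by rw [hp]; push_cast; ring
  have hm := binomMoment_mul_factorial (ρ := evenRatio n) (N := n - 1) (r := p + 2) (by omega)
    (fun l _ => by
      rw [evenRatio, Nat.cast_sub (by omega), hnp]; push_cast; ring) hi'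
  rw [h1, show n - 1 - i = (2 * (p + 2) - i - 2) + 1 by omega, Nat.factorial_succ] at hm
  have hcast : ((2 * (p + 2) - i - 2 : ℕ) : ℝ) + 1 = n - 1 - i := by
    rw [← Nat.cast_succ, Nat.succ_eq_add_one, show 2 * (p + 2) - i - 2 + 1 = n - 1 - i by omega, Nat.cast_sub (by omega),
      Nat.cast_sub (by omega)]
    simp
  rw [Nat.cast_mul, Nat.cast_succ, hcast] at hm
  have hin : (i : ℝ) ≤ p + 2 := by exact_mod_cast hi'
  have hp0 : (0 : ℝ) ≤ p := Nat.cast_nonneg p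
  constructor
  · rw [evenRatio_add_sub (by omega) hn, h2, h3]
    have e : ∀ a b c d : ℝ, a * b / c * (d * (i * ((n - 1) * (n - 2 - i) + 1)
        / ((n - 1 - i) * (n - 1)))) = (d * b) * a / c * (i * ((n - 1) * (n - 2 - i) + 1)
        / ((n - 1 - i) * (n - 1))) := fun a b c d => by ring
    rw [e, hm, hnp]
    have h4 : 2 * ((p : ℝ) + 2) - 1 ≠ 0 := by linarith
    have h5 : 2 * ((p : ℝ) + 2) - 1 - i ≠ 0 := by linarith
    have h6 : (p : ℝ) + 1 ≠ 0 := by linarith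
    rw [show 2 * ((p : ℝ) + 2) - 2 = 2 * (p + 1) by ring]
    have h7 : (p : ℝ) + 2 ≠ 0 := by linarith
    generalize ((2 * (p + 2) - i - 2)! : ℝ) = F
    field_simp
    ring
  · rw [mul_comm ((n - 1)! : ℝ), hm, h2, h3, hnp]
    ring

theorem veomett_odd_moment {n i : ℕ} (hn : 4 ≤ n) (hodd : ¬ Even n) (hi : i ≤ n / 2) :
    veomettAlpha n i - veomettBeta n i = ((n - 2) * (n - 1)! / (2 * (n - 3)) : ℝ) *
        (binomMoment (oddRatio n) i * (i + oddRatio n i - 1)) ∧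
    veomettAlpha n i - veomettBeta n i + ((n : ℝ) - 1) / 2 * veomettBeta n i
      = n / 2 * (n - 1)! * binomMoment (oddRatio n) i := by
  obtain ⟨p, hp⟩ : ∃ p, n = 2 * (p + 2) + 1 := by
    rw [Nat.not_even_iff] at hodd
    exact ⟨n / 2 - 2, by omega⟩
  have hi' : i ≤ p + 2 := by omega
  obtain ⟨Z, h1, h2, h3⟩ := veomett_odd hi' hp
  have hnp : (n : ℝ) = 2 * (p + 2) + 1 := by rw [hp]; push_cast; ring
  have hm := binomMoment_mul_factorial (ρ := oddRatio n) (N := n - 1) (r := p + 2) (by omega)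
    (fun l _ => by
      rw [oddRatio, Nat.cast_sub (by omega), hnp]; push_cast; ring) hi'
  rw [h1, show n - 1 - i = (2 * (p + 2) - i - 1) + 1 by omega, Nat.factorial_succ] at hm
  have hcast : ((2 * (p + 2) - i - 1 : ℕ) : ℝ) + 1 = n - 1 - i := by
    rw [← Nat.cast_succ, Nat.succ_eq_add_one, show 2 * (p + 2) - i - 1 + 1 = n - 1 - i by omega, Nat.cast_sub (by omega),
      Nat.cast_sub (by omega)]
    simp
  rw [Nat.cast_mul, Nat.cast_succ, hcast] at hm
  have hin : (i : ℝ) ≤ p + 2 := by exact_mod_cast hi'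
  have hp0 : (0 : ℝ) ≤ p := Nat.cast_nonneg p
  constructor
  · rw [oddRatio_add_sub (by omega) hn, h2, h3]
    have e : ∀ a b c d : ℝ, a * b / c * (d * (i * (n - 2 - i) / (n - 1 - i)))
        = (d * b) * a / c * (i * (n - 2 - i) / (n - 1 - i)) := fun a b c d => by ring
    rw [e, hm, hnp]
    have h5 : 2 * ((p : ℝ) + 2) + 1 - 1 - i ≠ 0 := by linarith
    have h6 : 2 * ((p : ℝ) + 2) + 1 - 3 ≠ 0 := by linarith
    generalize ((2 * (p + 2) - i - 1)! : ℝ) = F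
    field_simp
    ring
  · rw [mul_assoc, mul_comm ((n - 1)! : ℝ), hm, h2, h3, hnp]
    ring

end CompleteConstants

end

/-! ### The complete graph. -/

noncomputable section

section CompleteBound

open Finset

/-- If the binomial weights do not decrease the average, the polynomial `∏ (t - j)` gives the bound
with the sums over `k ≤ i ≤ 2 k`. -/
theorem falling_bound {ρ : ℕ → ℝ} {R k : ℕ} {κ lam : ℝ} (hκ : 0 ≤ κ) (h0 : ∀ i < R, 0 < ρ i)
    (hR : ρ R = 0) (hkR : k ≤ R) (hlam : ∀ i, k ≤ i → i ≤ R → lam < i + ρ i)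
    (hcmp : (∑ j ∈ range (k + 1),
        (k.choose j : ℝ) * (((k + j).choose k : ℝ) * binomMoment ρ (k + j))) * momentSumMul ρ k
      ≤ (∑ j ∈ range (k + 1), (k.choose j : ℝ) * (((k + j).choose k : ℝ) * binomMoment ρ (k + j)
          * ((k + j : ℕ) + ρ (k + j)))) * momentSum ρ k)
    {E E₁ : ℝ} (hE : E = ∑ l ∈ range (k + (k + 1)), fallingSqCoeff k l * binomMoment ρ l)
    (hE₁ : E₁ = ∑ l ∈ range (k + (k + 1)), fallingSqCoeff k l * (binomMoment ρ l * (l + ρ l))) :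
    lam * E < E₁ ∧ κ * E / (E₁ - lam * E)
      ≤ κ * momentSum ρ k / (momentSumMul ρ k - lam * momentSum ρ k) := by
  have hf : (0 : ℝ) < (k.factorial : ℝ) ^ 2 := by positivity
  have h1 := sum_choose_moment_pos h0 hR hkR hlam (w := fun j => (k.choose j : ℝ))
    (fun j => Nat.cast_nonneg _) (by simp)
  rw [sum_fallingSqCoeff k] at hE hE₁
  simp only [← mul_assoc] at hE hE₁ h1 hcmp
  subst hE hE₁
  have h2 := mul_lt_mul_of_pos_left h1 hf
  have h3 := mul_le_mul_of_nonneg_left hcmp hf.le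
  have h4 : lam * ((k.factorial : ℝ) ^ 2 * ∑ j ∈ range (k + 1),
      (k.choose j : ℝ) * ((k + j).choose k : ℝ) * binomMoment ρ (k + j))
      < (k.factorial : ℝ) ^ 2 * ∑ j ∈ range (k + 1), (k.choose j : ℝ) * ((k + j).choose k : ℝ)
        * binomMoment ρ (k + j) * ((k + j : ℕ) + ρ (k + j)) := by
    linarith
  exact ⟨h4, mul_div_sub_le hκ h4 (mul_momentSum_lt h0 hR hkR hlam) (by linarith)⟩

section Ratio

variable {ρ : ℕ → ℝ} {N A c : ℝ} {R : ℕ}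

/-- For `ρ_i = c - A / (N - i)` the increments of `i + ρ_i` are explicit, so monotonicity needs only
the size of `A` at the end of the range, and concavity only its sign. -/
theorem add_ratio_sub (hN : 0 < N - R) (hρ : ∀ i ≤ R, ρ i = c - A / (N - i)) {i i' : ℕ}
    (hi : i ≤ R) (hi' : i' ≤ R) :
    ((i' : ℝ) + ρ i') - (i + ρ i) = (i' - i) * (1 - A / ((N - i) * (N - i'))) := by
  have h1 : (i : ℝ) ≤ R := by exact_mod_cast hi
  have h2 : (i' : ℝ) ≤ R := by exact_mod_cast hi'
  have h3 : N - i ≠ 0 := by linarith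
  have h4 : N - i' ≠ 0 := by linarith
  rw [hρ i hi, hρ i' hi']
  field_simp
  ring

theorem add_ratio_mono (hN : 0 < N - R) (hA : A ≤ (N - R) * (N - R + 1))
    (hρ : ∀ i ≤ R, ρ i = c - A / (N - i)) {i i' : ℕ} (h : i ≤ i') (hi' : i' ≤ R) :
    (i : ℝ) + ρ i ≤ i' + ρ i' := by
  rcases h.eq_or_lt with rfl | h
  · exact le_rfl
  have h1 : (i : ℝ) + 1 ≤ i' := by exact_mod_cast h
  have h2 : (i' : ℝ) ≤ R := by exact_mod_cast hi'
  rw [← sub_nonneg, add_ratio_sub hN hρ (by omega) hi']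
  refine mul_nonneg (by linarith) (sub_nonneg.2 ?_)
  rw [div_le_one (mul_pos (by linarith) (by linarith))]
  calc A ≤ (N - R + 1) * (N - R) := by linarith
    _ ≤ _ := mul_le_mul (by linarith) (by linarith) hN.le (by linarith)

theorem add_ratio_concave (hN : 0 < N - R) (hA : 0 ≤ A)
    (hρ : ∀ i ≤ R, ρ i = c - A / (N - i)) {i i' s : ℕ} (h : i ≤ i') (hs : i' + s ≤ R) :
    ((i' + s : ℕ) + ρ (i' + s)) - ((i + s : ℕ) + ρ (i + s)) ≤ ((i' : ℝ) + ρ i') - (i + ρ i) := by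
  rw [add_ratio_sub hN hρ (by omega) hs, add_ratio_sub hN hρ (by omega) (by omega)]
  have h1 : (i : ℝ) ≤ i' := by exact_mod_cast h
  have h2 : (i' : ℝ) + s ≤ R := by exact_mod_cast hs
  have h3 : (0 : ℝ) ≤ s := Nat.cast_nonneg s
  push_cast
  rw [show (i' : ℝ) + s - (i + s) = i' - i by ring]
  refine mul_le_mul_of_nonneg_left (sub_le_sub_left ?_ 1) (by linarith)
  refine div_le_div_of_nonneg_left hA (mul_pos (by linarith) (by linarith)) ?_
  exact mul_le_mul (by linarith) (by linarith) (by linarith) (by linarith)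

end Ratio

/-- For complete graphs `ρ_i ≤ 1` from `i = 1` on, so `L = 1` and `θ = 1` suffice for every `k ≥ 1`.
-/
theorem ratio_comparison {ρ : ℕ → ℝ} {N A c : ℝ} {R k : ℕ} (hk1 : 1 ≤ k)
    (hN : 0 < N - R) (hA0 : 0 ≤ A) (hA : A ≤ (N - R) * (N - R + 1))
    (hρ : ∀ i ≤ R, ρ i = c - A / (N - i)) (h0 : ∀ i < R, 0 < ρ i) (hR : ρ R = 0)
    (h1 : ∀ i, 1 ≤ i → i < R → ρ i ≤ 1) :
    (∑ j ∈ range (k + 1),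
        (k.choose j : ℝ) * (((k + j).choose k : ℝ) * binomMoment ρ (k + j))) * momentSumMul ρ k
      ≤ (∑ j ∈ range (k + 1), (k.choose j : ℝ) * (((k + j).choose k : ℝ) * binomMoment ρ (k + j)
          * ((k + j : ℕ) + ρ (k + j)))) * momentSum ρ k := by
  refine binomMoment_comparison (θ := fun _ => 1) (L := 1) zero_le_one (fun i hi => ?_) hR
    (fun _ => by simpa using hk1) (fun i hi hi' => by simpa using h1 i (by omega) hi')
    (fun _ => ⟨zero_le_one, le_rfl⟩) (fun i i' _ h hi' => add_ratio_mono hN hA hρ h hi')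
    (fun i i' s _ h _ hs => by
      rw [one_mul]; exact add_ratio_concave hN hA0 hρ h.le hs)
  rcases hi.lt_or_eq with h | h
  · exact (h0 i h).le
  · rw [h, hR]

theorem tspScaling_top_even {n k : ℕ} (hn : 4 ≤ n) (heven : Even n) (hk1 : 1 ≤ k)
    (hk : k ≤ n / 2) :
    0 < knDen n k ∧
      tspScaling (⊤ : SimpleGraph (Fin n)) k ≤
        ((1 + ((n : ℝ) - 1) / 2 * (knNum n k / knDen n k) : ℝ) : EReal) ∧
      1 + ((n : ℝ) - 1) / 2 * (knNum n k / knDen n k) ≤ (n : ℝ) / k + 10 / n := by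
  have hn' : (4 : ℝ) ≤ n := by exact_mod_cast hn
  have hR2 : ((n / 2 : ℕ) : ℝ) = n / 2 := by
    obtain ⟨r, rfl⟩ := heven
    rw [show (r + r) / 2 = r by omega]; push_cast; ring
  have hle : ∀ i : ℕ, i ≤ n / 2 → (i : ℝ) ≤ n / 2 := fun i hi => by
    rw [← hR2]; exact_mod_cast hi
  have h0 : ∀ i < n / 2, 0 < evenRatio n i := fun i hi => by
    have := hle (i + 1) hi
    push_cast at this
    exact div_pos (by linarith) (by linarith)
  have hR : evenRatio n (n / 2) = 0 := by
    rw [evenRatio, hR2]; ring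
  have hsub : ∀ i, k ≤ i → i ≤ n / 2 → (0 : ℝ) < i ∧ (0 : ℝ) < (n - 1 - i) * (n - 1) ∧
      0 < ((n : ℝ) - 1) * (n - 2 - i) + 1 := fun i hi hi' => by
    have h1 := hle i hi'
    have h2 : (1 : ℝ) ≤ i := by exact_mod_cast hk1.trans hi
    have h3 : 0 ≤ ((n : ℝ) - 1) * (n - 2 - i) := mul_nonneg (by linarith) (by linarith)
    exact ⟨by linarith, mul_pos (by linarith) (by linarith), by linarith⟩
  have hlam : ∀ i, k ≤ i → i ≤ n / 2 → (n : ℝ) / (n - 1) < i + evenRatio n i := fun i hi hi' => by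
    obtain ⟨h1, h2, h3⟩ := hsub i hi hi'
    rw [← sub_pos, evenRatio_add_sub (by omega) hn]
    positivity
  have hκ : 0 ≤ ((n : ℝ) - 2) * n / (n - 1) :=
    div_nonneg (mul_nonneg (by linarith) (by linarith)) (by linarith)
  have hcmp := ratio_comparison (k := k) (R := n / 2) (ρ := evenRatio n) (N := n - 1) (A := n - 2)
    (c := 2) hk1 (by rw [hR2]; linarith) (by linarith) (by rw [hR2]; nlinarith)
    (fun i hi => by
      have := hle i hi
      have h4 : (n : ℝ) - 1 - i ≠ 0 := by linarith
      rw [evenRatio]; field_simp; ring) h0 hR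
    (fun i hi hi' => by
      have := hle i hi'.le
      have h2 : (1 : ℝ) ≤ i := by exact_mod_cast hi
      rw [evenRatio, div_le_one (by linarith)]; linarith)
  obtain ⟨hpos, hle'⟩ := falling_bound hκ h0 hR hk hlam hcmp rfl rfl
  obtain ⟨hD, hval⟩ := sum_ratio_eq (A := fun i => veomettAlpha n i - veomettBeta n i)
    (B := veomettBeta n) (s := (n - 1) / 2) (κ := (n - 2) * n / (n - 1))
    (c := (n - 1) * (n - 1).factorial / ((n - 2) * n))
    h0 hR hk hlam
    (div_pos (mul_pos (by linarith) (by positivity)) (mul_pos (by linarith) (by linarith)))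
    (fun i _ hi => (veomett_even_moment hn heven hi).1)
    (fun i _ hi => by
      rw [(veomett_even_moment hn heven hi).2]
      have h1 : (n : ℝ) - 1 ≠ 0 := by linarith
      have h2 : (n : ℝ) - 2 ≠ 0 := by linarith
      have h3 : (n : ℝ) ≠ 0 := by linarith
      field_simp)
  rw [knDen, knNum, hval]
  refine ⟨hD, ?_, ?_⟩
  · have h1 : (0 : ℝ) < n - 1 := by linarith
    refine (tspScaling_top_le_of_even hn heven k (fun j => (j : ℝ))
      (fun h => prod_sub_sq_eq h k) rfl rfl ?_).trans (EReal.coe_le_coe_iff.2 (le_trans ?_ hle'))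
    · rw [div_mul_eq_mul_div, div_lt_iff₀ h1] at hpos
      linarith
    · generalize (∑ l ∈ range (k + (k + 1)), fallingSqCoeff k l
        * (binomMoment (evenRatio n) l * (l + evenRatio n l))) = E₁ at hpos ⊢
      generalize (∑ l ∈ range (k + (k + 1)), fallingSqCoeff k l
        * binomMoment (evenRatio n) l) = E at hpos ⊢
      refine le_of_eq ?_
      have h2 : E₁ - n / (n - 1) * E = ((n - 1) * E₁ - n * E) / (n - 1) := by
        field_simp
      rw [h2, div_div_eq_mul_div]
      field_simp
  · refine momentSum_ratio_le h0 hR hk hlam fun i hi hi' => ?_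
    obtain ⟨h1, h2, h3⟩ := hsub i hi hi'
    have hin := hle i hi'
    have hk0 : (0 : ℝ) < k := by exact_mod_cast hk1
    have hki : (k : ℝ) ≤ i := by exact_mod_cast hi
    rw [evenRatio_add_sub (by omega) hn]
    -- The bound is proved with `i` in place of `k`, which is stronger since `k ≤ i`.
    have hU : (n : ℝ) / i + 10 / n ≤ n / k + 10 / n := by gcongr
    refine le_trans ?_ (mul_le_mul_of_nonneg_right hU (by positivity))
    have h4 : (0 : ℝ) < n - 1 := by linarith
    have h5 : (0 : ℝ) < n - 1 - i := by linarith
    have h6 : (0 : ℝ) < n := by linarith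
    rw [div_add_div _ _ h1.ne' h6.ne', div_mul_div_comm, div_le_div_iff₀ h4 (by positivity)]
    -- This is what remains after clearing denominators: the main term `n / i` misses the target by
    -- a multiple of `n (i - 1)`, which `10 / n` has to cover.
    have key : (n : ℝ) ^ 2 * (i - 1) ≤ 10 * i * ((n - 1) * (n - 2 - i) + 1) := by
      have hi1 : (1 : ℝ) ≤ i := by exact_mod_cast hk1.trans hi
      -- The cruder estimate without the factor `i - 1` fails for `n = 4`, `i = 2`.
      rcases hn.eq_or_lt with h | h
      · subst h
        have hin2 : (i : ℝ) ≤ 2 := by push_cast at hin; linarith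
        push_cast
        nlinarith [mul_nonneg (sub_nonneg.2 hi1) (sub_nonneg.2 hin2)]
      · have h7 : (5 : ℝ) ≤ n := by exact_mod_cast h
        have h8 : (n : ℝ) ^ 2 ≤ 10 * ((n - 1) * (n - 2 - i) + 1) := by nlinarith
        nlinarith [mul_le_mul_of_nonneg_left h8 h1.le, sq_nonneg (n : ℝ)]
    have := mul_le_mul_of_nonneg_left key (mul_pos h1 h4).le
    nlinarith

theorem tspScaling_top_odd {n k : ℕ} (hn : 4 ≤ n) (hodd : ¬ Even n) (hk1 : 1 ≤ k)
    (hk : k ≤ n / 2) :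
    0 < knDen n k ∧
      tspScaling (⊤ : SimpleGraph (Fin n)) k ≤
        ((1 + ((n : ℝ) - 1) / 2 * (knNum n k / knDen n k) : ℝ) : EReal) ∧
      1 + ((n : ℝ) - 1) / 2 * (knNum n k / knDen n k) ≤ (n : ℝ) / k + 10 / n := by
  have hmod := Nat.odd_iff.1 (Nat.not_even_iff_odd.1 hodd)
  have hn' : (5 : ℝ) ≤ n := by exact_mod_cast (show 5 ≤ n by omega)
  have hR2 : ((n / 2 : ℕ) : ℝ) = (n - 1) / 2 := by
    have : (n : ℝ) = 2 * (n / 2 : ℕ) + 1 := by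
      exact_mod_cast (show n = 2 * (n / 2) + 1 by omega)
    linarith
  have hle : ∀ i : ℕ, i ≤ n / 2 → (i : ℝ) ≤ (n - 1) / 2 := fun i hi => by
    rw [← hR2]; exact_mod_cast hi
  have h0 : ∀ i < n / 2, 0 < oddRatio n i := fun i hi => by
    have := hle (i + 1) hi
    push_cast at this
    exact div_pos (by linarith) (by linarith)
  have hR : oddRatio n (n / 2) = 0 := by
    rw [oddRatio, hR2]; ring
  have hsub : ∀ i, k ≤ i → i ≤ n / 2 → (0 : ℝ) < i ∧ (0 : ℝ) < n - 1 - i ∧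
      (0 : ℝ) < n - 2 - i := fun i hi hi' => by
    have h1 := hle i hi'
    have h2 : (1 : ℝ) ≤ i := by exact_mod_cast hk1.trans hi
    exact ⟨by linarith, by linarith, by linarith⟩
  have hlam : ∀ i, k ≤ i → i ≤ n / 2 → (1 : ℝ) < i + oddRatio n i := fun i hi hi' => by
    obtain ⟨h1, h2, h3⟩ := hsub i hi hi'
    rw [← sub_pos, oddRatio_add_sub (by omega) hn]
    positivity
  have hκ : 0 ≤ (n : ℝ) * (n - 3) / (n - 2) :=
    div_nonneg (mul_nonneg (by linarith) (by linarith)) (by linarith)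
  have hcmp := ratio_comparison (k := k) (R := n / 2) (ρ := oddRatio n) (N := n - 1) (A := n - 1)
    (c := 2) hk1 (by rw [hR2]; linarith) (by linarith) (by rw [hR2]; nlinarith)
    (fun i hi => by
      have := hle i hi
      have h4 : (n : ℝ) - 1 - i ≠ 0 := by linarith
      rw [oddRatio]; field_simp; ring) h0 hR
    (fun i hi hi' => by
      have := hle i hi'.le
      have h2 : (1 : ℝ) ≤ i := by exact_mod_cast hi
      rw [oddRatio, div_le_one (by linarith)]; linarith)
  obtain ⟨hpos, hle'⟩ := falling_bound hκ h0 hR hk hlam hcmp rfl rfl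
  obtain ⟨hD, hval⟩ := sum_ratio_eq (A := fun i => veomettAlpha n i - veomettBeta n i)
    (B := veomettBeta n) (s := (n - 1) / 2) (κ := n * (n - 3) / (n - 2))
    (c := (n - 2) * (n - 1).factorial / (2 * (n - 3)))
    h0 hR hk hlam
    (div_pos (mul_pos (by linarith) (by positivity)) (mul_pos two_pos (by linarith)))
    (fun i _ hi => (veomett_odd_moment hn hodd hi).1)
    (fun i _ hi => by
      rw [(veomett_odd_moment hn hodd hi).2]
      have h2 : (n : ℝ) - 2 ≠ 0 := by linarith
      have h3 : (n : ℝ) - 3 ≠ 0 := by linarith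
      field_simp)
  rw [knDen, knNum, hval]
  refine ⟨hD, ?_, ?_⟩
  · rw [one_mul] at hpos hle'
    refine (tspScaling_top_le_of_odd hn hodd k (fun j => (j : ℝ))
      (fun h => prod_sub_sq_eq h k) rfl rfl hpos).trans
      (EReal.coe_le_coe_iff.2 (le_trans (le_of_eq ?_) hle'))
    rw [← div_div]
    congr 1
    ring
  · refine momentSum_ratio_le h0 hR hk hlam fun i hi hi' => ?_
    obtain ⟨h1, h2, h3⟩ := hsub i hi hi'
    have hin := hle i hi'
    have hk0 : (0 : ℝ) < k := by exact_mod_cast hk1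
    have hki : (k : ℝ) ≤ i := by exact_mod_cast hi
    rw [oddRatio_add_sub (by omega) hn]
    have hU : (n : ℝ) / i + 10 / n ≤ n / k + 10 / n := by gcongr
    refine le_trans ?_ (mul_le_mul_of_nonneg_right hU (by positivity))
    have h4 : (0 : ℝ) < n - 2 := by linarith
    have h6 : (0 : ℝ) < n := by linarith
    rw [div_add_div _ _ h1.ne' h6.ne', div_mul_div_comm, div_le_div_iff₀ h4 (by positivity)]
    have key : (n : ℝ) ^ 2 * (i - 1) ≤ 10 * i * ((n - 2) * (n - 2 - i)) := by
      have h8 : (n : ℝ) ^ 2 ≤ 10 * ((n - 2) * (n - 2 - i)) := by nlinarith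
      nlinarith [mul_le_mul_of_nonneg_left h8 h1.le, sq_nonneg (n : ℝ)]
    have := mul_le_mul_of_nonneg_left key h1.le
    nlinarith

theorem unifIntegral_of_const {X E : Type*} [Fintype X] [Nonempty X] [AddCommGroup E] [Module ℝ E]
    {f : X → E} (u : X) (h : ∀ v, f v = f u) : unifIntegral f = f u := by
  rw [unifIntegral, Finset.sum_congr rfl fun v _ => h v, Finset.sum_const, Finset.card_univ,
    ← Nat.cast_smul_eq_nsmul ℝ, smul_smul, inv_mul_cancel₀ (by simp), one_smul]

theorem hamCycle_three_graph_eq_top (u : HamCycle (⊤ : SimpleGraph (Fin 3))) : u.graph = ⊤ := by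
  obtain ⟨e⟩ := u.exists_iso (N := 3) (by simp)
  rw [eq_top_iff]
  intro x y hxy
  rw [← e.apply_symm_apply x, ← e.apply_symm_apply y, e.map_adj_iff]
  have : e.symm x ≠ e.symm y := fun h => hxy (e.symm.injective h)
  revert this
  generalize e.symm x = a
  generalize e.symm y = b
  revert a b
  decide

/-- The triangle has a single hamiltonian cycle, so `x̄ = φ(u)`, and testing with the constant
function `1` in `F_1` gives `l(φ(u)) ≥ 0`. -/
theorem tspScaling_top_three : tspScaling (⊤ : SimpleGraph (Fin 3)) 1 ≤ ((1 : ℝ) : EReal) := by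
  refine scalingConstant_le _ _ _ (tspForm_tspMap _) le_rfl fun l hl u => ?_
  have huv : ∀ v w : HamCycle (⊤ : SimpleGraph (Fin 3)), v = w := fun v w =>
    HamCycle.ext ((hamCycle_three_graph_eq_top v).trans (hamCycle_three_graph_eq_top w).symm)
  have : Nonempty (HamCycle (⊤ : SimpleGraph (Fin 3))) := ⟨u⟩
  have h := hl _ (one_mem_tspPoly_one _)
  rw [bvlForm, unifIntegral_of_const u fun v => by rw [huv v u]] at h
  simpa using h

theorem tspScaling_top_bounds {n k : ℕ} (hn : 3 ≤ n) (hk1 : 1 ≤ k) (hk : k ≤ n / 2) :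
    0 < knDen n k ∧
      tspScaling (⊤ : SimpleGraph (Fin n)) k ≤
        ((1 + ((n : ℝ) - 1) / 2 * (knNum n k / knDen n k) : ℝ) : EReal) ∧
      1 + ((n : ℝ) - 1) / 2 * (knNum n k / knDen n k) ≤ (n : ℝ) / k + 10 / n := by
  rcases hn.eq_or_lt with rfl | hn
  · obtain rfl : k = 1 := by omega
    have hodd : ¬ Even 3 := by decide
    have hN : knNum 3 1 = 0 := by
      simp [knNum, veomettBeta, hodd]
      norm_num
    have hD : knDen 3 1 = 3 := by
      simp [knDen, veomettAlpha, veomettBeta, hodd]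
      norm_num
    rw [hN, hD]
    norm_num
    exact_mod_cast tspScaling_top_three
  · by_cases heven : Even n
    · exact tspScaling_top_even hn heven hk1 hk
    · exact tspScaling_top_odd hn heven hk1 hk

end CompleteBound

end

/-! ### The constants of the complete bipartite graph in terms of moments. -/

noncomputable section

section BipartiteConstants

open scoped Nat

theorem bipRatio_of_lt {n i : ℕ} (h : i < n) :
    bipRatio n i = 2 * (2 * n - 2 * i - 1) / (2 * n - i - 1) := if_pos h

theorem bipRatio_self (n : ℕ) : bipRatio n n = 0 := if_neg (lt_irrefl n)

theorem cast_succ_mul_centralBinom_succ (d : ℕ) :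
    ((d : ℝ) + 1) * ((d + 1).centralBinom : ℝ) = 2 * (2 * d + 1) * (d.centralBinom : ℝ) := by
  exact_mod_cast Nat.succ_mul_centralBinom_succ d

/-- The closed form of the moments; the factors `2 (2d + 1) / (d + 1)` of the recursion telescope to
a quotient of central binomial coefficients. -/
theorem binomMoment_bipRatio {n i : ℕ} (hi : i ≤ n) :
    binomMoment (bipRatio n) i * (((2 * n - 1)! : ℝ) / (n.centralBinom : ℝ))
      = (n.choose i : ℝ) * ((2 * n - i - 1)! : ℝ) / ((n - i).centralBinom : ℝ) := by
  induction i with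
  | zero => simp [binomMoment]
  | succ i ih =>
    have h1 := ih (by omega)
    obtain ⟨d, hd⟩ := Nat.exists_eq_add_of_le' hi
    have h2 : (n.choose (i + 1) : ℝ) * (i + 1) = n.choose i * (d + 1) := by
      have := congrArg (Nat.cast : ℕ → ℝ) (Nat.choose_succ_right_eq n i)
      rw [show n - i = d + 1 by omega] at this
      push_cast at this
      exact this
    have hn : (n : ℝ) = d + i + 1 := by rw [hd]; push_cast; ring
    have h3 : ((2 * n - i - 1)! : ℝ) = (2 * d + i + 1) * ((2 * n - (i + 1) - 1)! : ℝ) := by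
      rw [show 2 * n - i - 1 = (2 * n - (i + 1) - 1) + 1 by omega, Nat.factorial_succ,
        show 2 * n - (i + 1) - 1 + 1 = 2 * d + i + 1 by omega]
      push_cast; ring
    have h4 := cast_succ_mul_centralBinom_succ d
    have h5 : (0 : ℝ) < d.centralBinom := by exact_mod_cast Nat.centralBinom_pos d
    have h6 : (0 : ℝ) < (d + 1).centralBinom := by exact_mod_cast Nat.centralBinom_pos (d + 1)
    rw [h3, show n - i = d + 1 by omega] at h1
    rw [binomMoment, bipRatio_of_lt (by omega), show n - (i + 1) = d by omega]
    have h7 : (2 * d + i + 1 : ℝ) ≠ 0 := by positivity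
    calc binomMoment (bipRatio n) i * (2 * (2 * n - 2 * i - 1) / (2 * n - i - 1)) / (i + 1)
          * (((2 * n - 1)! : ℝ) / (n.centralBinom : ℝ))
        = (binomMoment (bipRatio n) i * (((2 * n - 1)! : ℝ) / (n.centralBinom : ℝ)))
          * (2 * (2 * d + 1)) / (2 * d + i + 1) / (i + 1) := by
          rw [hn, show 2 * ((d : ℝ) + i + 1) - 2 * i - 1 = 2 * d + 1 by ring,
            show 2 * ((d : ℝ) + i + 1) - i - 1 = 2 * d + i + 1 by ring]
          ring
      _ = (n.choose i : ℝ) * (d + 1) / (i + 1) * ((2 * n - (i + 1) - 1)! : ℝ)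
          * (2 * (2 * d + 1) * (d.centralBinom : ℝ)) / ((d + 1) * ((d + 1).centralBinom : ℝ))
            / (d.centralBinom : ℝ) := by
          rw [h1]; field_simp
      _ = _ := by
          rw [← h4, ← h2]; field_simp

/-- With `n = p + 2` and `i = j + 1`, all binomials in `γ_i` and `η_i` are polynomial multiples of
one `X`. -/
theorem bip_choose_eq {p j : ℕ} (hj : j ≤ p + 1) :
    ∃ X : ℝ, ((p + 2).choose (j + 1) : ℝ) = (p + 2) * (p + 1) * X ∧
      ((p + 1).choose j : ℝ) = (p + 1) * (j + 1) * X ∧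
      (p.choose j : ℝ) = (j + 1) * (p + 1 - j) * X ∧
      ((p + 1).choose (j + 1) : ℝ) = (p + 1) * (p + 1 - j) * X ∧
      (p.choose (j + 1) : ℝ) = (p + 1 - j) * (p - j) * X ∧
      (chooseSubTwo p (j + 1) : ℝ) = (j + 1) * j * X := by
  have h0 : (((j + 1)! : ℝ) * ((p + 1 - j)! : ℝ)) ≠ 0 := by positivity
  have hs : p + 2 - (j + 1) = p + 1 - j := by omega
  have hp1 : ((p + 1)! : ℝ) = (p + 1) * p ! := by rw [Nat.factorial_succ]; push_cast; ring
  have hj1 : ((j + 1)! : ℝ) = (j + 1) * j ! := by rw [Nat.factorial_succ]; push_cast; ring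
  refine ⟨(p ! : ℝ) / ((j + 1)! * (p + 1 - j)!), ?_, ?_, ?_, ?_, ?_, ?_⟩ <;>
    rw [mul_div_assoc', eq_div_iff h0]
  · have := cast_choose_mul_eq (show j + 1 ≤ p + 2 by omega)
    rw [hs, Nat.factorial_succ (p + 1)] at this
    rw [this]; push_cast; rw [hp1]; ring
  · have := cast_choose_mul_eq hj
    rw [hj1, mul_assoc, mul_left_comm, this, hp1]; ring
  · have := cast_choose_pred_mul_eq hj
    rw [hj1, mul_assoc, mul_left_comm, this]; ring
  · have := cast_choose_pred_mul_eq (show j + 1 ≤ (p + 1) + 1 by omega)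
    rw [show p + 1 + 1 - (j + 1) = p + 1 - j by omega] at this
    rw [this, hp1]; push_cast; ring
  · rcases hj.lt_or_eq with h | h
    · have := cast_choose_pred_mul_eq (show j + 1 ≤ p + 1 by omega)
      rw [show p + 1 - (j + 1) = p - j by omega] at this
      rw [show p + 1 - j = (p - j) + 1 by omega, Nat.factorial_succ (p - j)]
      push_cast [show j ≤ p by omega] at this ⊢
      linear_combination ((p : ℝ) - j + 1) * this
    · subst h; simp [Nat.choose_eq_zero_of_lt (show p < p + 1 + 1 by omega)]
  · have := chooseSubTwo_mul_eq (show j + 1 ≤ p + 2 by omega)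
    rw [hs] at this
    rw [this]; push_cast; ring

theorem bipRatio_add_sub {n i : ℕ} (hi : i < n) :
    (i : ℝ) + bipRatio n i - 2 = i * (2 * n - i - 3) / (2 * n - i - 1) := by
  have h1 : (i : ℝ) + 1 ≤ n := by exact_mod_cast hi
  have h4 : 2 * (n : ℝ) - i - 1 ≠ 0 := by
    have : (0 : ℝ) ≤ i := Nat.cast_nonneg i
    linarith
  rw [bipRatio_of_lt hi]
  field_simp
  ring

/-- The bipartite constants are again the summands of the moment bound, now with `λ = 2` and `κ = 2
(n - 1)`. -/
theorem bip_constants_moment {n i : ℕ} (hn : 3 ≤ n) (hi1 : 1 ≤ i) (hi : i ≤ n) :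
    bipGamma n i - bipEta n i = ((2 * n - 1)! / n.centralBinom / (n - 1) : ℝ) *
        (binomMoment (bipRatio n) i * (i + bipRatio n i - 2)) ∧
    bipGamma n i - bipEta n i + (n : ℝ) / 2 * bipEta n i
      = 2 * (n - 1) * ((2 * n - 1)! / n.centralBinom / (n - 1) : ℝ)
        * binomMoment (bipRatio n) i := by
  have hm := binomMoment_bipRatio hi
  obtain ⟨p, rfl⟩ := Nat.exists_eq_add_of_le' (show 2 ≤ n by omega)
  obtain ⟨j, rfl⟩ := Nat.exists_eq_add_of_le' hi1
  obtain ⟨X, e1, e2, e3, e4, e5, e6⟩ := bip_choose_eq (show j ≤ p + 1 by omega)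
  have hp1 : (0 : ℝ) < p := by exact_mod_cast (show 0 < p by omega)
  have hn1 : (((p + 2 : ℕ) : ℝ) - 1) = p + 1 := by push_cast; ring
  have hg : ∀ a b m t : ℝ, a / (p + 1) * (m * t) = (m * a) * t / (p + 1) := fun a b m t => by ring
  have hg' : ∀ a m : ℝ, 2 * (p + 1) * (a / (p + 1)) * m = 2 * (m * a) := fun a m => by
    field_simp
  rw [hn1, hg _ 0, hg', hm]
  have hcb : (2 * (p + 2) - 2 * (j + 1)).choose (p + 2 - (j + 1)) = (p + 1 - j).centralBinom := by
    rw [Nat.centralBinom]; congr 1 <;> omega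
  have hcb' : (2 * (p + 2 - (j + 1) - 1)).choose (p + 2 - (j + 1) - 1) = (p - j).centralBinom := by
    rw [Nat.centralBinom]; congr 1 <;> omega
  rw [bipGamma, bipEta, hcb, hcb', show p + 2 - 1 = p + 1 by omega,
    show p + 2 - 2 = p by omega, show j + 1 - 1 = j by omega, e1, e2, e3, e4, e5, e6,
    show p + 2 - (j + 1) = p + 1 - j by omega]
  rcases (show j ≤ p + 1 by omega).lt_or_eq with h | h
  · rw [bipRatio_add_sub (by omega)]
    obtain ⟨d, rfl⟩ := Nat.exists_eq_add_of_le (show j ≤ p by omega)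
    rw [show j + d + 1 - j = d + 1 by omega, show j + d - j = d by omega,
      show 2 * (j + d + 2) - (j + 1) - 1 = (j + 2 * d + 1) + 1 by omega,
      show 2 * (j + d + 2) - (j + 1) - 2 = j + 2 * d + 1 by omega, Nat.factorial_succ (j + 2 * d + 1)]
    have h4 := cast_succ_mul_centralBinom_succ d
    have h5 : (0 : ℝ) < d.centralBinom := by exact_mod_cast Nat.centralBinom_pos d
    have h6 : ((d : ℝ) + 1) * ((d.centralBinom : ℝ))⁻¹
        = 2 * (2 * d + 1) * ((d + 1).centralBinom : ℝ)⁻¹ := by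
      have h7 : (0 : ℝ) < (d + 1).centralBinom := by exact_mod_cast Nat.centralBinom_pos (d + 1)
      field_simp
      linarith
    have h8 : 2 * ((j : ℝ) + d + 2) - (j + 1) - 1 ≠ 0 := by
      rw [show 2 * ((j : ℝ) + d + 2) - (j + 1) - 1 = j + 2 * d + 2 by ring]
      positivity
    have h9 : (j : ℝ) + d + 1 ≠ 0 := by positivity
    rw [div_eq_mul_inv _ ((d + 1).centralBinom : ℝ)]
    push_cast
    generalize ((d.centralBinom : ℕ) : ℝ)⁻¹ = B at h6 ⊢
    generalize (((d + 1).centralBinom : ℕ) : ℝ)⁻¹ = B' at h6 ⊢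
    generalize ((j + 2 * d + 1)! : ℝ) = F
    have h10 : (((j : ℝ) + d + 1) * ((j : ℝ) + d + 1 - j) * X) * F * B
        = (((j : ℝ) + d + 1) * X) * F * (2 * (2 * d + 1) * B') := by
      rw [← h6]; ring
    have h11 : (((j : ℝ) + d + 1 - j) * ((j : ℝ) + d - j) * X) * F * B
        = (d * X) * F * (2 * (2 * d + 1) * B') := by
      rw [← h6]; ring
    rw [h10, h11]
    constructor
    · field_simp
      ring
    · ring
  -- The case `i = n`, where `ρ_n = 0` is not the value of the rational formula. The terms with the
  -- truncated `n - i - 1` have zero coefficient.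
  · subst h
    rw [bipRatio_self]
    have h1 : X = ((p + 2) * (p + 1) : ℝ)⁻¹ := by
      rw [show p + 1 + 1 = p + 2 by omega, Nat.choose_self] at e1
      rw [eq_comm, inv_eq_iff_eq_inv, eq_comm, inv_eq_iff_eq_inv]
      field_simp
      push_cast at e1
      linarith
    rw [show 2 * (p + 2) - (p + 1 + 1) - 1 = p + 1 by omega,
      show 2 * (p + 2) - (p + 1 + 1) - 2 = p by omega, Nat.factorial_succ]
    have h2 : ((p : ℝ) + 1) ≠ 0 := by positivity
    have h3 : ((p : ℝ) + 2) ≠ 0 := by positivity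
    simp only [Nat.sub_self, Nat.centralBinom_zero, h1]
    push_cast
    constructor
    · field_simp
      ring
    · field_simp
      ring

end BipartiteConstants

end

/-! ### Comparison and alternative polynomials for the complete bipartite graph. -/

noncomputable section

section BipartiteBound

open Finset

theorem bipRatio_pos {n i : ℕ} (hi : i < n) : 0 < bipRatio n i := by
  rw [bipRatio_of_lt hi]
  have h1 : (i : ℝ) + 1 ≤ n := by exact_mod_cast hi
  have h2 : (0 : ℝ) ≤ i := Nat.cast_nonneg i
  exact div_pos (by linarith) (by linarith)

theorem bipRatio_nonneg (n i : ℕ) : 0 ≤ bipRatio n i := by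
  by_cases hi : i < n
  · exact (bipRatio_pos hi).le
  · rw [bipRatio, if_neg hi]

theorem bipRatio_eq {n i : ℕ} (hi : i < n) :
    bipRatio n i = 4 - 2 * (2 * n - 1) / (2 * n - 1 - i) := by
  rw [bipRatio_of_lt hi]
  have h1 : (i : ℝ) + 1 ≤ n := by exact_mod_cast hi
  have h2 : (0 : ℝ) ≤ i := Nat.cast_nonneg i
  rw [sub_right_comm (2 * (n : ℝ)) i 1]
  have h3 : 2 * (n : ℝ) - 1 - i ≠ 0 := by linarith
  field_simp
  ring

theorem two_lt_add_bipRatio {n i : ℕ} (hn : 3 ≤ n) (hi1 : 1 ≤ i) (hi : i ≤ n) :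
    2 < (i : ℝ) + bipRatio n i := by
  rcases hi.lt_or_eq with h | rfl
  · rw [← sub_pos, bipRatio_add_sub h]
    have h1 : (i : ℝ) + 1 ≤ n := by exact_mod_cast h
    have h2 : (1 : ℝ) ≤ i := by exact_mod_cast hi1
    have h3 : (3 : ℝ) ≤ n := by exact_mod_cast hn
    exact div_pos (mul_pos (by linarith) (by linarith)) (by linarith)
  · have h3 : (3 : ℝ) ≤ i := by exact_mod_cast hn
    rw [bipRatio_self]
    linarith

theorem add_bipRatio_mono {n i i' : ℕ} (hn : 3 ≤ n) (h : i ≤ i') (hi' : i' ≤ n) :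
    (i : ℝ) + bipRatio n i ≤ i' + bipRatio n i' := by
  have hn' : (3 : ℝ) ≤ n := by exact_mod_cast hn
  have hR : ((n - 1 : ℕ) : ℝ) = n - 1 := by rw [Nat.cast_sub (by omega)]; simp
  rcases hi'.lt_or_eq with h1 | rfl
  · exact add_ratio_mono (N := 2 * n - 1) (A := 2 * (2 * n - 1)) (c := 4) (R := n - 1)
      (by rw [hR]; linarith) (by rw [hR]; nlinarith) (fun l hl => bipRatio_eq (by omega)) h
      (by omega)
  · rcases h.lt_or_eq with h | rfl
    · rw [bipRatio_self, bipRatio_of_lt h]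
      have h1 : (i : ℝ) + 1 ≤ i' := by exact_mod_cast h
      have h2 : (0 : ℝ) ≤ i := Nat.cast_nonneg i
      rw [← le_sub_iff_add_le', div_le_iff₀ (by linarith)]
      have : 0 ≤ (i' : ℝ) - i - 1 := by linarith
      nlinarith
    · exact le_rfl

/-- Here `ρ_i` can only be bounded by `L = 2`, hence the condition `4 ≤ k`; it is not needed when at
most two indices `i ≥ k` carry weight. -/
theorem bip_comparison {n k : ℕ} (hn : 3 ≤ n) (hk : k + 2 ≤ n → 4 ≤ k) :
    (∑ j ∈ range (k + 1),
        (k.choose j : ℝ) * (((k + j).choose k : ℝ) * binomMoment (bipRatio n) (k + j)))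
          * momentSumMul (bipRatio n) k
      ≤ (∑ j ∈ range (k + 1), (k.choose j : ℝ) * (((k + j).choose k : ℝ)
          * binomMoment (bipRatio n) (k + j) * ((k + j : ℕ) + bipRatio n (k + j))))
        * momentSum (bipRatio n) k := by
  have hn' : (3 : ℝ) ≤ n := by exact_mod_cast hn
  have hR : ((n - 1 : ℕ) : ℝ) = n - 1 := by rw [Nat.cast_sub (by omega)]; simp
  have hN : (0 : ℝ) < (2 * n - 1) - (n - 1 : ℕ) := by rw [hR]; linarith
  have hinv : (n : ℝ)⁻¹ ≤ 1 := inv_le_one_of_one_le₀ (by linarith)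
  -- Concavity may fail at `i = n`, where `ρ_n = 0` exceeds the rational formula. The small last
  -- ratio `ρ_{n-1} = 2 / n` makes up for it through `θ n = 1 / n`.
  refine binomMoment_comparison (θ := fun i => if i = n then (n : ℝ)⁻¹ else 1) (L := 2) (R := n)
    zero_le_two (fun i _ => bipRatio_nonneg n i) (bipRatio_self n)
    (fun h => by have : (4 : ℝ) ≤ k := by exact_mod_cast hk h
                 linarith) (fun i hi hi' => ?_)
    (fun i => ?_) (fun i i' _ h hi' => add_bipRatio_mono hn h hi') (fun i i' s hi h hs hs' => ?_)
  · have h2 : (0 : ℝ) ≤ i := Nat.cast_nonneg i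
    have h1 : (i : ℝ) + 1 ≤ n := by exact_mod_cast hi'
    rw [bipRatio_of_lt hi']
    split_ifs with h
    · have h3 : (i : ℝ) = n - 1 := by rw [← h]; push_cast; ring
      rw [h3, show 2 * (n : ℝ) - (n - 1) - 1 = n by ring,
        show 2 * (n : ℝ) - 2 * (n - 1) - 1 = 1 by ring]
      rw [mul_one, div_eq_mul_inv]
    · rw [div_le_iff₀ (by linarith)]; linarith
  · split_ifs
    · exact ⟨by positivity, hinv⟩
    · exact ⟨zero_le_one, le_rfl⟩
  · rcases hs'.lt_or_eq with h1 | h1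
    · rw [if_neg h1.ne, one_mul]
      exact add_ratio_concave (N := 2 * n - 1) (A := 2 * (2 * n - 1)) (c := 4) (R := n - 1)
        hN (by linarith) (fun l hl => bipRatio_eq (by omega)) h.le (by omega)
    · have hk4 := hk (by omega)
      have hn6 : (6 : ℝ) ≤ n := by exact_mod_cast (show 6 ≤ n by omega)
      rw [if_pos h1, h1, bipRatio_self, add_ratio_sub (N := 2 * n - 1) (A := 2 * (2 * n - 1))
        (c := 4) (R := n - 1) hN (fun l hl => bipRatio_eq (by omega)) (by omega) (by omega)]
      have h2 : (i : ℝ) + 1 ≤ i' := by exact_mod_cast h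
      have h3 : (i' : ℝ) + s = n := by exact_mod_cast h1
      have h4 : (1 : ℝ) ≤ s := by exact_mod_cast hs
      have h5 : (n : ℝ) + 0 - ((i + s : ℕ) + bipRatio n (i + s)) ≤ i' - i := by
        have := bipRatio_nonneg n (i + s)
        push_cast
        linarith
      refine (mul_le_mul_of_nonneg_left h5 (by positivity)).trans ?_
      rw [mul_comm]
      refine mul_le_mul_of_nonneg_left ?_ (by linarith)
      -- The indices satisfy `i ≤ n - 2` and `i' ≤ n - 1`, so the increment of `i + ρ_i` is at least
      -- `i' - i` times a quantity that exceeds `1 / n`.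
      have h6 : 2 * (2 * (n : ℝ) - 1) / ((2 * n - 1 - i) * (2 * n - 1 - i'))
          ≤ 2 * (2 * n - 1) / ((n + 1) * n) :=
        div_le_div_of_nonneg_left (by linarith) (by positivity)
          (mul_le_mul (by linarith) (by linarith) (by linarith) (by linarith))
      refine le_trans ?_ (sub_le_sub_left h6 1)
      rw [le_sub_iff_add_le, inv_eq_one_div, div_add_div _ _ (by linarith) (by positivity),
        div_le_one (by positivity)]
      nlinarith [mul_pos (show (0 : ℝ) < n by linarith) (show (0 : ℝ) < n by linarith)]

theorem tspScaling_bipartite_le_of_mul_le {n k : ℕ} (hn : 3 ≤ n) (hk1 : 1 ≤ k) (hk : k ≤ n)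
    (c : ℕ → ℝ) {L : ℕ} {a : ℕ → ℝ} (hQ : ∀ h : ℕ, ∏ j ∈ range k, ((h : ℝ) - c j) ^ 2
      = ∑ l ∈ range L, a l * (h.choose l : ℝ))
    {E E₁ : ℝ} (hE : E = ∑ l ∈ range L, a l * binomMoment (bipRatio n) l)
    (hE₁ : E₁ = ∑ l ∈ range L, a l * (binomMoment (bipRatio n) l * (l + bipRatio n l)))
    (hpos : 2 * E < E₁)
    (h : E * momentSumMul (bipRatio n) k ≤ E₁ * momentSum (bipRatio n) k) :
    tspScaling (completeBipartiteGraph (Fin n) (Fin n)) k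
      ≤ ((2 * (n - 1) * momentSum (bipRatio n) k
        / (momentSumMul (bipRatio n) k - 2 * momentSum (bipRatio n) k) : ℝ) : EReal) := by
  have hn' : (3 : ℝ) ≤ n := by exact_mod_cast hn
  exact (tspScaling_bipartite_le hn k c hQ hE hE₁ hpos).trans (EReal.coe_le_coe_iff.2
    (mul_div_sub_le (by linarith) hpos (mul_momentSum_lt (R := n) (fun i => bipRatio_pos)
      (bipRatio_self n) hk (fun i hi hi' => two_lt_add_bipRatio hn (hk1.trans hi) hi')) h))

/-- The coefficients of `(t (t - 2))²` in the basis of binomial coefficients. -/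
def quarticCoeff : ℕ → ℝ
  | 1 => 1
  | 2 => -2
  | 3 => 12
  | 4 => 24
  | _ => 0

/-- The coefficients of `(t (t - 1) (t - 3))²` in the basis of binomial coefficients. -/
def sexticCoeff : ℕ → ℝ
  | 2 => 4
  | 3 => -12
  | 4 => 168
  | 5 => 840
  | 6 => 720
  | _ => 0

theorem cast_choose_eq_prod (h l : ℕ) :
    (h.choose l : ℝ) = (∏ j ∈ range l, ((h : ℝ) - j)) / (l.factorial : ℝ) := by
  rw [prod_sub_eq_descFactorial, Nat.descFactorial_eq_factorial_mul_choose]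
  push_cast
  field_simp

theorem prod_sub_sq_eq_quartic (h : ℕ) :
    ∏ j ∈ range 2, ((h : ℝ) - 2 * (j : ℕ)) ^ 2
      = ∑ l ∈ range 5, quarticCoeff l * (h.choose l : ℝ) := by
  simp only [cast_choose_eq_prod, sum_range_succ, prod_range_succ, quarticCoeff, Nat.factorial]
  simp
  ring

theorem prod_sub_sq_eq_sextic (h : ℕ) :
    ∏ j ∈ range 3, ((h : ℝ) - (j : ℕ) * ((j : ℕ) + 1) / 2) ^ 2
      = ∑ l ∈ range 7, sexticCoeff l * (h.choose l : ℝ) := by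
  simp only [cast_choose_eq_prod, sum_range_succ, prod_range_succ, sexticCoeff, Nat.factorial]
  simp
  ring

theorem quartic_moments (ρ : ℕ → ℝ) :
    ∑ l ∈ range 5, quarticCoeff l * binomMoment ρ l
      = ρ 0 * (1 - ρ 1 + 2 * (ρ 1 * ρ 2) + ρ 1 * ρ 2 * ρ 3) ∧
    ∑ l ∈ range 5, quarticCoeff l * (binomMoment ρ l * (l + ρ l))
      = ρ 0 * (1 - ρ 1 + 5 * (ρ 1 * ρ 2) + 6 * (ρ 1 * ρ 2 * ρ 3) + ρ 1 * ρ 2 * ρ 3 * ρ 4) ∧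
    momentSum ρ 2 = ρ 0 * (ρ 1 / 2 + ρ 1 * ρ 2 / 2 + ρ 1 * ρ 2 * ρ 3 / 4) ∧
    momentSumMul ρ 2 = ρ 0 * (ρ 1 + 2 * (ρ 1 * ρ 2) + 3 / 2 * (ρ 1 * ρ 2 * ρ 3)
      + ρ 1 * ρ 2 * ρ 3 * ρ 4 / 4) := by
  refine ⟨?_, ?_, ?_, ?_⟩
  · simp only [sum_range_succ, quarticCoeff, binomMoment]
    simp
    ring
  · simp only [sum_range_succ, quarticCoeff, binomMoment]
    simp
    ring
  · rw [momentSum]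
    simp only [sum_range_succ, binomMoment, Nat.choose]
    simp
    ring
  · rw [momentSumMul]
    simp only [sum_range_succ, binomMoment, Nat.choose]
    simp
    ring

theorem sextic_moments (ρ : ℕ → ℝ) :
    ∑ l ∈ range 7, sexticCoeff l * binomMoment ρ l
      = ρ 0 * (2 * ρ 1 - 2 * (ρ 1 * ρ 2) + 7 * (ρ 1 * ρ 2 * ρ 3) + 7 * (ρ 1 * ρ 2 * ρ 3 * ρ 4)
        + ρ 1 * ρ 2 * ρ 3 * ρ 4 * ρ 5) ∧
    ∑ l ∈ range 7, sexticCoeff l * (binomMoment ρ l * (l + ρ l))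
      = ρ 0 * (4 * ρ 1 - 4 * (ρ 1 * ρ 2) + 26 * (ρ 1 * ρ 2 * ρ 3) + 42 * (ρ 1 * ρ 2 * ρ 3 * ρ 4)
        + 13 * (ρ 1 * ρ 2 * ρ 3 * ρ 4 * ρ 5) + ρ 1 * ρ 2 * ρ 3 * ρ 4 * ρ 5 * ρ 6) ∧
    momentSum ρ 3 = ρ 0 * (ρ 1 * ρ 2 / 6 + ρ 1 * ρ 2 * ρ 3 / 6 + ρ 1 * ρ 2 * ρ 3 * ρ 4 / 12
      + ρ 1 * ρ 2 * ρ 3 * ρ 4 * ρ 5 / 36) ∧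
    momentSumMul ρ 3 = ρ 0 * (ρ 1 * ρ 2 / 2 + 5 / 6 * (ρ 1 * ρ 2 * ρ 3)
      + 7 / 12 * (ρ 1 * ρ 2 * ρ 3 * ρ 4) + ρ 1 * ρ 2 * ρ 3 * ρ 4 * ρ 5 / 4
      + ρ 1 * ρ 2 * ρ 3 * ρ 4 * ρ 5 * ρ 6 / 36) := by
  refine ⟨?_, ?_, ?_, ?_⟩
  · simp only [sum_range_succ, sexticCoeff, binomMoment]
    simp
    ring
  · simp only [sum_range_succ, sexticCoeff, binomMoment]
    simp
    ring
  · rw [momentSum]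
    simp only [sum_range_succ, binomMoment, Nat.choose]
    simp
    ring
  · rw [momentSumMul]
    simp only [sum_range_succ, binomMoment, Nat.choose]
    simp
    ring

theorem bipRatio_zero {n : ℕ} (hn : 0 < n) : bipRatio n 0 = 2 := by
  have h1 : (1 : ℝ) ≤ n := by exact_mod_cast hn
  have h2 : 2 * (n : ℝ) - 1 ≠ 0 := by linarith
  rw [bipRatio_of_lt hn]
  simp only [Nat.cast_zero, mul_zero, sub_zero]
  field_simp

end BipartiteBound

end

/-! ### The complete bipartite graph. -/

noncomputable section

section BipartiteMain

open Finset

theorem bipRatio_prods {n : ℕ} {y : ℝ} (hn : 5 ≤ n) (hy : (n : ℝ) = y + 5) :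
    bipRatio n 1 = (2 * y + 7) / (y + 4) ∧
    bipRatio n 1 * bipRatio n 2 = 2 * (2 * y + 5) / (y + 4) ∧
    bipRatio n 1 * bipRatio n 2 * bipRatio n 3
      = 2 * (2 * y + 5) * (2 * y + 3) / ((y + 4) * (y + 3)) ∧
    bipRatio n 1 * bipRatio n 2 * bipRatio n 3 * bipRatio n 4
      = 4 * (2 * y + 3) * (2 * y + 1) / ((y + 4) * (y + 3)) := by
  have hn' : (5 : ℝ) ≤ n := by exact_mod_cast hn
  have h1 : y + 4 ≠ 0 := by linarith
  have h2 : y + 3 ≠ 0 := by linarith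
  have h3 : 2 * y + 7 ≠ 0 := by linarith
  have h4 : 2 * y + 5 ≠ 0 := by linarith
  have r1 : bipRatio n 1 = (2 * y + 7) / (y + 4) := by
    rw [bipRatio_of_lt (by omega), hy, Nat.cast_one,
      show 2 * (y + 5) - 1 - 1 = 2 * (y + 4) by ring]
    field_simp; ring
  have r2 : bipRatio n 2 = 2 * (2 * y + 5) / (2 * y + 7) := by
    rw [bipRatio_of_lt (by omega), hy, Nat.cast_ofNat]
    congr 1 <;> ring
  have r3 : bipRatio n 3 = (2 * y + 3) / (y + 3) := by
    rw [bipRatio_of_lt (by omega), hy, Nat.cast_ofNat,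
      show 2 * (y + 5) - 3 - 1 = 2 * (y + 3) by ring]
    field_simp; ring
  have r4 : bipRatio n 4 = 2 * (2 * y + 1) / (2 * y + 5) := by
    rw [bipRatio_of_lt (by omega), hy, Nat.cast_ofNat]
    congr 1 <;> ring
  refine ⟨r1, ?_, ?_, ?_⟩
  · rw [r1, r2]; field_simp
  · rw [r1, r2, r3]; field_simp
  · rw [r1, r2, r3, r4]; field_simp; ring

theorem quartic_bound {n : ℕ} (hn : 4 ≤ n) :
    2 * (∑ l ∈ range 5, quarticCoeff l * binomMoment (bipRatio n) l)
      < ∑ l ∈ range 5, quarticCoeff l * (binomMoment (bipRatio n) l * (l + bipRatio n l)) ∧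
    (∑ l ∈ range 5, quarticCoeff l * binomMoment (bipRatio n) l) * momentSumMul (bipRatio n) 2
      ≤ (∑ l ∈ range 5, quarticCoeff l * (binomMoment (bipRatio n) l * (l + bipRatio n l)))
        * momentSum (bipRatio n) 2 := by
  obtain ⟨e1, e2, e3, e4⟩ := quartic_moments (bipRatio n)
  rw [e1, e2, e3, e4, bipRatio_zero (by omega)]
  rcases hn.eq_or_lt with rfl | hn
  -- For `n = 4` the exceptional value `ρ_4 = 0` enters, so the rational formulas do not apply.
  · norm_num [bipRatio]
  · have hn' : (5 : ℝ) ≤ n := by exact_mod_cast hn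
    have hy : (0 : ℝ) ≤ n - 5 := by linarith
    obtain ⟨r1, r2, r3, r4⟩ := bipRatio_prods hn (sub_add_cancel (n : ℝ) 5).symm
    rw [r4, r3, r2, r1]
    generalize (n : ℝ) - 5 = y at hy
    rw [← sub_pos, ← sub_nonneg]
    constructor
    · have : 0 < 2 * ((171 + 188 * y + 53 * y ^ 2) / ((y + 4) * (y + 3))) := by positivity
      refine this.trans_eq ?_
      field_simp
      ring
    -- The difference of the two sides as a rational function of `y = n - 5`; all coefficients are
    -- positive. The factor `2 * 2` is `ρ_0²`.
    · have : 0 ≤ 2 * 2 * ((540 + 2265 / 2 * y + 817 * y ^ 2 + 483 / 2 * y ^ 3 + 25 * y ^ 4)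
        / ((y + 4) * (y + 3)) ^ 2) := by positivity
      refine this.trans_eq ?_
      field_simp
      ring

theorem sextic_bound {n : ℕ} (hn : 5 ≤ n) :
    2 * (∑ l ∈ range 7, sexticCoeff l * binomMoment (bipRatio n) l)
      < ∑ l ∈ range 7, sexticCoeff l * (binomMoment (bipRatio n) l * (l + bipRatio n l)) ∧
    (∑ l ∈ range 7, sexticCoeff l * binomMoment (bipRatio n) l) * momentSumMul (bipRatio n) 3
      ≤ (∑ l ∈ range 7, sexticCoeff l * (binomMoment (bipRatio n) l * (l + bipRatio n l)))
        * momentSum (bipRatio n) 3 := by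
  obtain ⟨e1, e2, e3, e4⟩ := sextic_moments (bipRatio n)
  rw [e1, e2, e3, e4, bipRatio_zero (by omega)]
  rcases hn.eq_or_lt with rfl | hn
  · norm_num [bipRatio]
  -- The rational formulas up to `ρ_6` require `n ≥ 7`. With `y = n - 7` the differences below have
  -- positive coefficients.
  rcases (show 6 ≤ n from hn).eq_or_lt with rfl | hn
  · norm_num [bipRatio]
  · have hn' : (7 : ℝ) ≤ n := by exact_mod_cast hn
    have hy : (0 : ℝ) ≤ n - 7 := by linarith
    have hny : (n : ℝ) = (n - 7) + 7 := by ring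
    obtain ⟨r1, r2, r3, r4⟩ := bipRatio_prods (show 5 ≤ n by omega)
      (show (n : ℝ) = ((n - 7) + 2) + 5 by ring)
    have r5 : bipRatio n 5 = (2 * (n - 7) + 3) / ((n - 7) + 4) := by
      have : (n : ℝ) - 7 + 4 ≠ 0 := by linarith
      rw [bipRatio_of_lt (by omega), Nat.cast_ofNat,
        show 2 * (n : ℝ) - 5 - 1 = 2 * (n - 7 + 4) by ring]
      field_simp; ring
    have r6 : bipRatio n 6 = 2 * (2 * (n - 7) + 1) / (2 * (n - 7) + 7) := by
      rw [bipRatio_of_lt (by omega), Nat.cast_ofNat]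
      congr 1 <;> ring
    rw [r4, r3, r2, r1, r5, r6]
    generalize (n : ℝ) - 7 = y at hy
    rw [← sub_pos, ← sub_nonneg]
    constructor
    · have : 0 < 2 * ((26468 + 25872 * y + 8560 * y ^ 2 + 960 * y ^ 3)
          / ((y + 6) * (y + 5) * (y + 4))) := by positivity
      refine this.trans_eq ?_
      field_simp
      ring
    · have : 0 ≤ 2 * 2 * ((1717168 / 3 + 9066344 / 9 * y + 2176918 / 3 * y ^ 2
          + 2458118 / 9 * y ^ 3 + 169474 / 3 * y ^ 4 + 54632 / 9 * y ^ 5 + 264 * y ^ 6)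
          / ((y + 6) * (y + 5) * (y + 4)) ^ 2) := by positivity
      refine this.trans_eq ?_
      field_simp
      ring

theorem tspScaling_bipartite_le_momentSum {n k : ℕ} (hn : 3 ≤ n) (hk1 : 1 ≤ k) (hk : k ≤ n) :
    tspScaling (completeBipartiteGraph (Fin n) (Fin n)) k
      ≤ ((2 * (n - 1) * momentSum (bipRatio n) k
        / (momentSumMul (bipRatio n) k - 2 * momentSum (bipRatio n) k) : ℝ) : EReal) := by
  -- For `k = 2` and `k = 3` the hypothesis `4 ≤ k` of `bip_comparison` fails, so polynomials with
  -- other roots replace the falling factorial, except for small `n`, where the comparison needs no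
  -- lower bound on `k`.
  by_cases h2 : k = 2 ∧ 4 ≤ n
  · obtain ⟨rfl, hn4⟩ := h2
    exact tspScaling_bipartite_le_of_mul_le hn hk1 hk (fun j => 2 * (j : ℕ))
      prod_sub_sq_eq_quartic rfl rfl (quartic_bound hn4).1 (quartic_bound hn4).2
  by_cases h3 : k = 3 ∧ 5 ≤ n
  · obtain ⟨rfl, hn5⟩ := h3
    exact tspScaling_bipartite_le_of_mul_le hn hk1 hk (fun j => (j : ℕ) * ((j : ℕ) + 1) / 2)
      prod_sub_sq_eq_sextic rfl rfl (sextic_bound hn5).1 (sextic_bound hn5).2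
  have hn' : (3 : ℝ) ≤ n := by exact_mod_cast hn
  have hcmp : (∑ j ∈ range (k + 1),
        (k.choose j : ℝ) * (((k + j).choose k : ℝ) * binomMoment (bipRatio n) (k + j)))
          * momentSumMul (bipRatio n) k
      ≤ (∑ j ∈ range (k + 1), (k.choose j : ℝ) * (((k + j).choose k : ℝ)
          * binomMoment (bipRatio n) (k + j) * ((k + j : ℕ) + bipRatio n (k + j))))
        * momentSum (bipRatio n) k := by
    rcases hk1.eq_or_lt with rfl | hk1
    -- For `k = 1` the weights `(1 choose j)` are all `1`, and the two averages coincide.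
    · refine le_of_eq ?_
      simp only [momentSum, momentSumMul, sum_range_succ, sum_range_zero, Nat.choose_self,
        Nat.choose_zero_right, Nat.cast_one]
      ring
    · exact bip_comparison hn (by omega)
  obtain ⟨hpos, hle⟩ := falling_bound (κ := 2 * (n - 1)) (by linarith) (R := n)
    (fun i => bipRatio_pos) (bipRatio_self n) hk
    (fun i hi hi' => two_lt_add_bipRatio hn (hk1.trans hi) hi') hcmp rfl rfl
  exact (tspScaling_bipartite_le hn k (fun j => (j : ℝ)) (fun h => prod_sub_sq_eq h k) rfl rfl
    hpos).trans (EReal.coe_le_coe_iff.2 hle)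

theorem tspScaling_bipartite_bounds {n k : ℕ} (hn : 3 ≤ n) (hk1 : 1 ≤ k) (hk : k ≤ n) :
    0 < knnDen n k ∧
      tspScaling (completeBipartiteGraph (Fin n) (Fin n)) k ≤
        ((1 + (n : ℝ) / 2 * (knnNum n k / knnDen n k) : ℝ) : EReal) ∧
      (k + 3 < 2 * n →
        1 + (n : ℝ) / 2 * (knnNum n k / knnDen n k) ≤
          2 * (n : ℝ) / k + 2 * ((k : ℝ) + 1) / (k * (2 * (n : ℝ) - k - 3))) := by
  have hn' : (3 : ℝ) ≤ n := by exact_mod_cast hn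
  have hcb : (0 : ℝ) < n.centralBinom := by exact_mod_cast Nat.centralBinom_pos n
  have hlam : ∀ i, k ≤ i → i ≤ n → 2 < (i : ℝ) + bipRatio n i := fun i hi hi' =>
    two_lt_add_bipRatio hn (hk1.trans hi) hi'
  obtain ⟨hD, hval⟩ := sum_ratio_eq (A := fun i => bipGamma n i - bipEta n i)
    (B := bipEta n) (s := n / 2) (κ := 2 * (n - 1)) (R := n)
    (c := (2 * n - 1).factorial / n.centralBinom / (n - 1))
    (fun i => bipRatio_pos) (bipRatio_self n) hk hlam
    (div_pos (by positivity) (by linarith))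
    (fun i hi hi' => (bip_constants_moment hn (hk1.trans hi) hi').1)
    (fun i hi hi' => (bip_constants_moment hn (hk1.trans hi) hi').2)
  rw [knnDen, knnNum, hval]
  refine ⟨hD, tspScaling_bipartite_le_momentSum hn hk1 hk, fun h => ?_⟩
  have hk0 : (1 : ℝ) ≤ k := by exact_mod_cast hk1
  have h1 : (0 : ℝ) < 2 * n - k - 3 := by
    have : ((k + 3 : ℕ) : ℝ) < ((2 * n : ℕ) : ℝ) := by exact_mod_cast h
    push_cast at this
    linarith
  refine momentSum_ratio_le (R := n) (fun i => bipRatio_pos) (bipRatio_self n) hk hlam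
    fun i hi hi' => ?_
  have hU : 0 ≤ 2 * (n : ℝ) / k + 2 * ((k : ℝ) + 1) / (k * (2 * (n : ℝ) - k - 3)) := by
    positivity
  have hmono := add_bipRatio_mono hn hi hi'
  -- As `i + ρ_i` is increasing, the worst term is `i = k`. For `k < n` the stated bound is exactly
  -- the value of `κ / (k + ρ_k - 2)`.
  refine le_trans ?_ (mul_le_mul_of_nonneg_left (sub_le_sub_right hmono 2) hU)
  rcases hk.lt_or_eq with hkn | rfl
  · have h2 : (0 : ℝ) < 2 * n - k - 1 := by linarith
    rw [bipRatio_add_sub hkn]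
    refine le_of_eq ?_
    field_simp
    ring
  · rw [bipRatio_self, add_zero]
    have h2 : (0 : ℝ) < k - 3 := by linarith
    rw [show 2 * (k : ℝ) - k - 3 = k - 3 by ring, div_add_div _ _ (by linarith) (by positivity),
      div_mul_eq_mul_div, le_div_iff₀ (by positivity)]
    have h3 : 0 < (k : ℝ) * k := by positivity
    nlinarith [mul_pos h3 (show (0 : ℝ) < k - 1 by linarith)]

end BipartiteMain

end

/-! ### The theorem. -/

theorem theorem1p4 :
    (∀ n k : ℕ, 3 ≤ n → 1 ≤ k → k ≤ n / 2 →
      0 < knDen n k ∧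
      tspScaling (⊤ : SimpleGraph (Fin n)) k ≤
        ((1 + ((n : ℝ) - 1) / 2 * (knNum n k / knDen n k) : ℝ) : EReal) ∧
      1 + ((n : ℝ) - 1) / 2 * (knNum n k / knDen n k) ≤ (n : ℝ) / k + 10 / n) ∧
    (∀ n k : ℕ, 3 ≤ n → 1 ≤ k → k ≤ n →
      0 < knnDen n k ∧
      tspScaling (completeBipartiteGraph (Fin n) (Fin n)) k ≤
        ((1 + (n : ℝ) / 2 * (knnNum n k / knnDen n k) : ℝ) : EReal) ∧
      (k + 3 < 2 * n →
        1 + (n : ℝ) / 2 * (knnNum n k / knnDen n k) ≤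
          2 * (n : ℝ) / k + 2 * ((k : ℝ) + 1) / (k * (2 * (n : ℝ) - k - 3)))) :=
  ⟨fun _ _ hn hk1 hk => tspScaling_top_bounds hn hk1 hk,
    fun _ _ hn hk1 hk => tspScaling_bipartite_bounds hn hk1 hk⟩
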